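/- A link-diagram is a connected 4-regular multigraph (loops and multiple edges allowed) embedded in the sphere, together with the choice, at each vertex, of one of the two pairs of opposite half-edges at that vertex (the overcrossing strand). It is rooted if one of its edges is marked and oriented (equivalently, if a corner is marked). Two rooted link-diagrams are the same if an orientation-preserving homeomorphism of the sphere takes one to the other, respecting the root and the chosen pairs. A link-diagram is $K_4$-minor-free if its underlying graph does not contain $K_4$ as a minor. Let $a_n$ be the number of rooted $K_4$-minor-free link-diagrams with $n$ edges, where all edges, including the root edge, are counted. Then there are real constants $\rho$ and $c$ such that, as $n\to\infty$ through the even integers, $$a_n\sim\frac{c}{\Gamma(-1/2)}\, n^{-3/2}\, 2^{n/2}\,\rho^{-n},$$ where $\rho\approx 0.31184$, $2/\rho\approx 6.41337$ and $c\approx-3.04531$ (each approximation holds with an error less than $10^{-5}$). -/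

import Mathlib

open Filter Asymptotics
open scoped Topology

/-- `H` is a minor of `G`: there are pairwise disjoint nonempty connected vertex sets of `G`
(the sets that are contracted to the vertices of `H`), one for each vertex of `H`, such that
sets belonging to adjacent vertices of `H` are joined by an edge of `G`. -/
def SimpleGraph.HasMinor {V W : Type*} (G : SimpleGraph V) (H : SimpleGraph W) : Prop :=
  ∃ B : W → Set V,
    (∀ w, (G.induce (B w)).Connected) ∧
    (∀ w w', w ≠ w' → Disjoint (B w) (B w')) ∧
    (∀ w w', H.Adj w w' → ∃ x ∈ B w, ∃ y ∈ B w', G.Adj x y)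

/-- A multigraph (loops and multiple edges allowed) embedded in an oriented closed surface,
given as a combinatorial map (rotation system) whose set of half-edges is `D`:
`rot` sends a half-edge to the next half-edge around its vertex in the positive cyclic order,
and `opp` sends a half-edge to the other half of its edge. -/
structure CombMap (D : Type*) where
  rot : Equiv.Perm D
  opp : Equiv.Perm D
  opp_opp : ∀ d, opp (opp d) = d
  opp_ne : ∀ d, opp d ≠ d

namespace CombMap

variable {D : Type*}

/-- The vertices are the cycles of `rot`. -/
def Vertex (M : CombMap D) : Type _ := Quotient (Equiv.Perm.SameCycle.setoid M.rot)

/-- The edges are the cycles of `opp`. -/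
def Edge (M : CombMap D) : Type _ := Quotient (Equiv.Perm.SameCycle.setoid M.opp)

/-- The faces are the cycles of `rot ∘ opp`. -/
def Face (M : CombMap D) : Type _ := Quotient (Equiv.Perm.SameCycle.setoid (M.rot * M.opp))

/-- The vertex to which a half-edge is attached. -/
def vertexOf (M : CombMap D) (d : D) : M.Vertex :=
  Quotient.mk (Equiv.Perm.SameCycle.setoid M.rot) d

/-- Connectedness of the map. -/
def IsConnected (M : CombMap D) : Prop :=
  ∀ d e : D, ∃ g ∈ Subgroup.closure ({M.rot, M.opp} : Set (Equiv.Perm D)), g d = e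

/-- The surface is the sphere: Euler's relation `V - E + F = 2`. -/
def IsSpherical (M : CombMap D) : Prop :=
  Nat.card M.Vertex + Nat.card M.Face = Nat.card M.Edge + 2

/-- Every vertex is incident to exactly four half-edges. -/
def IsFourRegular (M : CombMap D) : Prop :=
  ∀ d : D, Function.minimalPeriod M.rot d = 4

/-- The underlying graph, with loops deleted and parallel edges identified. -/
def graph (M : CombMap D) : SimpleGraph M.Vertex :=
  SimpleGraph.fromRel fun u v => ∃ d : D, M.vertexOf d = u ∧ M.vertexOf (M.opp d) = v

/-- The underlying graph has no minor `K₄` (loops and parallel edges are irrelevant here). -/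
def IsK4MinorFree (M : CombMap D) : Prop :=
  ¬ M.graph.HasMinor (⊤ : SimpleGraph (Fin 4))

end CombMap

/-- A link-diagram with set of half-edges `D`: a connected 4-regular map on the sphere,
together with the choice, at each vertex, of one of its two pairs of opposite half-edges.
The set `upper` is the union of the chosen pairs, so around each vertex its elements alternate
with the other half-edges. -/
structure LinkDiagram (D : Type*) extends CombMap D where
  connected : toCombMap.IsConnected
  spherical : toCombMap.IsSpherical
  fourRegular : toCombMap.IsFourRegular
  upper : Set D
  rot_mem_upper : ∀ d, rot d ∈ upper ↔ d ∉ upper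

/-- A rooted link-diagram: a half-edge is marked. This is the same as marking a corner
(the one just before that half-edge), or as marking and orienting an edge. -/
structure RootedLinkDiagram (D : Type*) extends LinkDiagram D where
  root : D

namespace RootedLinkDiagram

variable {D : Type*}

/-- Two rooted link-diagrams are the same if some orientation-preserving homeomorphism of the
sphere takes one to the other, crossings and root included. In terms of half-edges: there is a
bijection of half-edges which respects all the structure. -/
def Iso (R S : RootedLinkDiagram D) : Prop :=
  ∃ f : Equiv.Perm D,
    (∀ d, f (R.rot d) = S.rot (f d)) ∧
    (∀ d, f (R.opp d) = S.opp (f d)) ∧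
    (∀ d, f d ∈ S.upper ↔ d ∈ R.upper) ∧
    f R.root = S.root

theorem iso_equivalence : Equivalence (Iso (D := D)) where
  refl _ := ⟨Equiv.refl D, fun _ => rfl, fun _ => rfl, fun _ => Iff.rfl, rfl⟩
  symm := by
    rintro R S ⟨f, h1, h2, h3, h4⟩
    refine ⟨f.symm, fun d => ?_, fun d => ?_, fun d => ?_, ?_⟩
    · rw [Equiv.symm_apply_eq, h1, Equiv.apply_symm_apply]
    · rw [Equiv.symm_apply_eq, h2, Equiv.apply_symm_apply]
    · rw [← h3, Equiv.apply_symm_apply]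
    · rw [Equiv.symm_apply_eq, h4]
  trans := by
    rintro R S T ⟨f, h1, h2, h3, h4⟩ ⟨g, k1, k2, k3, k4⟩
    refine ⟨f.trans g, fun d => ?_, fun d => ?_, fun d => ?_, ?_⟩
    · simp [h1, k1]
    · simp [h2, k2]
    · simp [h3, k3]
    · simp [h4, k4]

/-- The rooted `K₄`-minor-free link-diagrams on the set of half-edges `D`. -/
def K4MinorFree (D : Type*) : Type _ :=
  {R : RootedLinkDiagram D // R.toCombMap.IsK4MinorFree}

/-- Isomorphism of rooted `K₄`-minor-free link-diagrams. -/
def k4Setoid (D : Type*) : Setoid (K4MinorFree D) where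
  r R S := Iso R.1 S.1
  iseqv := iso_equivalence.comap Subtype.val

/-- The number of rooted `K₄`-minor-free link-diagrams with `n` edges (hence `2 * n`
half-edges), up to isomorphism. -/
noncomputable def count (n : ℕ) : ℕ :=
  Nat.card (Quotient (k4Setoid (Fin (2 * n))))

end RootedLinkDiagram

/-!
A diagram with `2 v` edges has `v` crossings, and its underlying map is a connected spherical
4-regular map without minor `K₄`. The proof finds a unique recursive description of these maps,
which gives an algebraic equation for their generating function, and extracts the asymptotics from
this equation by Lagrange inversion and the saddle point method. (The number of edges of a diagram
is always even.)

*From diagrams to permutations.* The half-edges of a spherical 4-regular map can be coloured black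
and white such that the colours alternate along edges and around vertices: the connected double
cover that exists otherwise contradicts Euler's inequality `exists_setoid_cyc_le`
(`CombMap.exists_colouring`). The map is then determined by the set `D` of its black half-edges,
with the fixed-point-free involution `s` which is the square of the rotation, and the permutation
`P` which moves along an edge and then around a vertex. The elements of `D` are at once the edges
of the 4-regular map, and the darts of the map `(P, s)` whose edges are the crossings; the
4-regular map is the medial map of `(P, s)`. The predicate `Good P s` says that `P` and `s` arise
in this way.

*Decomposition.* A pair of edges of the 4-regular map that form a cut (`OneOut`) splits a good map
into two good maps. If there is no such cut (`NoCut`), then the 4-regular map is a ring: its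
crossings form a cycle in which each is joined to the next by two edges. In terms of `(P, s)`, the
map is a cycle or dual to a cycle (`NoCut.fixFreeInvol_or`). The reason is that a graph without
minor `K₄` has a vertex with at most two neighbours. In a map without cuts, a combinatorial Jordan
curve theorem (`exists_oneOut`) makes two edges at this vertex parallel; contracting them gives a
smaller map without cuts, and the induction goes through.

*Codes.* Hence a rooted good map consists of the ring that contains the root, with rooted good
maps or nothing inserted in each of the `2 (k + 1)` edges of a ring of `k + 1` crossings. This is
recorded by the inductive type `Code`. Every code describes a good map: the absence of a minor
`K₄` follows from a certificate that the graph has treewidth at most two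
(`not_hasMinor_of_parents`, `Code.certificate`). A map determines its code because the inserted
maps are the maximal parts that are cut off from the root (`Code.eq_of_isomorphic`), and every
good map has a code by induction (`exists_code`). Rooted maps have no automorphisms, so each of
them carries `2 ^ v` different choices of crossings, and the number of diagrams is `2 ^ v` times
the number of codes of size `v` (`RootedLinkDiagram.count_two_mul`).

*Asymptotics.* There is one rooted ring with two crossings, and there are two with any other
positive number of crossings, so the generating function `N` of codes satisfies `N = B(z N ^ 2)`
with `B(y) = 2 / (1 - y) - 1 - y ^ 2`. By Lagrange inversion the number of codes of size `v` is
the coefficient of `y ^ v` in `B ^ (2 v + 1)`, divided by `2 v + 1` (`Code.card_size_eq`). This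
coefficient is a Fourier integral over the circle of radius `r`, where `r` is chosen such that
`r B'(r) = B(r) / 2`, that is, `3 r ^ 4 - 6 r ^ 3 + 2 r ^ 2 - 4 r + 1 = 0`. On this circle the
integrand is largest at `r`, where it has no linear term (`saddle_expansion`), so that its powers
are asymptotically Gaussian (`tendsto_coeff_ringGenFun`). With `S = r ^ 2 B''(r) / B(r) + 1 / 4`,
the result is `ρ = √r / B(r)` and `c = -√2 B(r) / √S`, which are computed from an interval of
length `10 ^ (-10)` that contains `r`.
-/

/-! ### Cycle counts and Euler's inequality -/

open Equiv in
/-- The number of cycles of a permutation, fixed points included. -/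
noncomputable def cyc {α : Type*} (f : Perm α) : ℕ :=
  Nat.card (Quotient (Perm.SameCycle.setoid f))

/-- The finest equivalence relation which is coarser than `r` and relates `a` to `b`. -/
def glue {α : Type*} (r : Setoid α) (a b : α) : Setoid α where
  r x y := r x y ∨ (r x a ∧ r b y) ∨ (r x b ∧ r a y)
  iseqv :=
    { refl := fun x => Or.inl (r.refl x)
      symm := by
        rintro x y (h | ⟨h, k⟩ | ⟨h, k⟩)
        · exact Or.inl (r.symm h)
        · exact Or.inr (Or.inr ⟨r.symm k, r.symm h⟩)
        · exact Or.inr (Or.inl ⟨r.symm k, r.symm h⟩)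
      trans := by
        rintro x y z (h | ⟨h, k⟩ | ⟨h, k⟩) (h' | ⟨h', k'⟩ | ⟨h', k'⟩)
        · exact Or.inl (r.trans h h')
        · exact Or.inr (Or.inl ⟨r.trans h h', k'⟩)
        · exact Or.inr (Or.inr ⟨r.trans h h', k'⟩)
        · exact Or.inr (Or.inl ⟨h, r.trans k h'⟩)
        · exact Or.inr (Or.inl ⟨h, k'⟩)
        · exact Or.inl (r.trans h k')
        · exact Or.inr (Or.inr ⟨h, r.trans k h'⟩)
        · exact Or.inl (r.trans h k')
        · exact Or.inr (Or.inr ⟨h, k'⟩) }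

theorem glue_rel {α : Type*} {r : Setoid α} {a b x y : α} :
    glue r a b x y ↔ r x y ∨ (r x a ∧ r b y) ∨ (r x b ∧ r a y) := Iff.rfl

theorem glue_eq_self {α : Type*} {r : Setoid α} {a b : α} (h : r a b) : glue r a b = r := by
  ext x y
  rw [glue_rel]
  constructor
  · rintro (h1 | ⟨h1, h2⟩ | ⟨h1, h2⟩)
    · exact h1
    · exact r.trans h1 (r.trans h h2)
    · exact r.trans h1 (r.trans (r.symm h) h2)
  · exact Or.inl

theorem card_ne_add_one {α : Type*} [Finite α] (x : α) :
    Nat.card {y : α // y ≠ x} + 1 = Nat.card α := by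
  classical
  have := Fintype.ofFinite α
  rw [Nat.card_eq_fintype_card, Nat.card_eq_fintype_card, Fintype.card_subtype_compl]
  simp only [Fintype.card_subtype_eq]
  have : 0 < Fintype.card α := Fintype.card_pos_iff.2 ⟨x⟩
  omega

theorem card_glue {α : Type*} [Finite α] {r : Setoid α} {a b : α} (h : ¬ r a b) :
    Nat.card (Quotient (glue r a b)) + 1 = Nat.card (Quotient r) := by
  rw [← card_ne_add_one (Quotient.mk r b)]
  congr 1
  symm
  let F : Quotient r → Quotient (glue r a b) :=
    Quotient.map' id (fun x y hxy => Or.inl hxy)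
  refine Nat.card_eq_of_bijective (fun q : {q // q ≠ Quotient.mk r b} => F q.1) ⟨?_, ?_⟩
  · rintro ⟨q, hq⟩ ⟨q', hq'⟩ hqq
    induction q using Quotient.inductionOn with | _ x => ?_
    induction q' using Quotient.inductionOn with | _ y => ?_
    have hx : ¬ r x b := fun h => hq (Quotient.sound h)
    have hy : ¬ r y b := fun h => hq' (Quotient.sound h)
    have : glue r a b x y := Quotient.exact hqq
    rcases this with h1 | ⟨h1, h2⟩ | ⟨h1, h2⟩
    · exact Subtype.ext (Quotient.sound h1)
    · exact absurd (r.symm h2) hy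
    · exact absurd h1 hx
  · intro q
    induction q using Quotient.inductionOn with | _ x => ?_
    by_cases hx : r x b
    · refine ⟨⟨Quotient.mk r a, fun hh => h (Quotient.exact hh)⟩, ?_⟩
      exact Quotient.sound (Or.inr (Or.inl ⟨r.refl a, r.symm hx⟩))
    · exact ⟨⟨Quotient.mk r x, fun hh => hx (Quotient.exact hh)⟩, rfl⟩

namespace Equiv.Perm

variable {α : Type*}

/-- On a finite type, a set that a permutation maps into itself is a union of cycles. -/
theorem SameCycle.mem_of_closed [Finite α] {f : Perm α} {A : Set α} (hA : ∀ x ∈ A, f x ∈ A)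
    {x y : α} (h : f.SameCycle x y) (hx : x ∈ A) : y ∈ A := by
  obtain ⟨n, rfl⟩ := h.exists_nat_pow_eq
  induction n with
  | zero => simpa
  | succ n ih =>
    rw [pow_succ', mul_apply]
    exact hA _ (ih (by exact ⟨n, by simp⟩))

theorem inv_mem_of_closed [Finite α] {f : Perm α} {A : Set α} (hA : ∀ x ∈ A, f x ∈ A)
    {x : α} (h : x ∈ A) : f⁻¹ x ∈ A :=
  SameCycle.mem_of_closed hA (x := x) ⟨-1, by simp⟩ h

theorem mem_iff_of_closed [Finite α] {f : Perm α} {A : Set α} (hA : ∀ x ∈ A, f x ∈ A)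
    {x : α} : f x ∈ A ↔ x ∈ A :=
  ⟨fun h => by simpa using inv_mem_of_closed hA h, hA x⟩

variable [DecidableEq α]

theorem sameCycle_mul_swap_le {r : Setoid α} {f : Perm α} (a b : α)
    (hr : ∀ x y, f.SameCycle x y → r x y) {x y : α} (h : (f * swap a b).SameCycle x y) :
    glue r a b x y := by
  have step : ∀ x, glue r a b x ((f * swap a b) x) := by
    intro x
    have hf : ∀ z, r z (f z) := fun z => hr _ _ ⟨1, by simp⟩
    rw [mul_apply]
    rcases eq_or_ne x a with rfl | hxa
    · rw [swap_apply_left]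
      exact Or.inr (Or.inl ⟨r.refl _, hf b⟩)
    rcases eq_or_ne x b with rfl | hxb
    · rw [swap_apply_right]
      exact Or.inr (Or.inr ⟨r.refl _, hf a⟩)
    rw [swap_apply_of_ne_of_ne hxa hxb]
    exact Or.inl (hf x)
  obtain ⟨n, rfl⟩ := h
  induction n using Int.induction_on with
  | zero => exact (glue r a b).refl _
  | succ n ih =>
    refine (glue r a b).trans ih ?_
    rw [add_comm, zpow_add, zpow_one, mul_apply]
    exact step _
  | pred n ih =>
    refine (glue r a b).trans ih ((glue r a b).symm ?_)
    convert step _ using 1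
    rw [← mul_apply, ← zpow_one_add]
    congr 2
    ring

variable [Finite α]

theorem sameCycle_mul_swap_of_not {f : Perm α} {a b : α} (h : ¬ f.SameCycle a b) :
    (f * swap a b).SameCycle a b := by
  have hab : a ≠ b := fun hh => h (hh ▸ SameCycle.refl _ _)
  -- follow the cycle of `b` from `f b = (f * swap a b) a` back to `b`
  have key : ∀ n : ℕ, (f * swap a b).SameCycle a ((f ^ (n + 1)) b) := by
    intro n
    induction n with
    | zero => exact ⟨1, by simp⟩
    | succ n ih =>
      rcases eq_or_ne ((f ^ (n + 1)) b) b with hb | hb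
      · rw [pow_succ', mul_apply, hb]
        exact ⟨1, by simp⟩
      · refine ih.trans ⟨1, ?_⟩
        rw [zpow_one, mul_apply, swap_apply_of_ne_of_ne _ hb, pow_succ' f (n + 1), mul_apply]
        intro ha
        exact h (SameCycle.symm ⟨(n + 1 : ℕ), by rw [zpow_natCast]; exact ha⟩)
  have hpos : 0 < orderOf f := orderOf_pos f
  have := key (orderOf f - 1)
  rwa [Nat.sub_add_cancel hpos, pow_orderOf_eq_one] at this

theorem setoid_mul_swap {f : Perm α} {a b : α} (h : ¬ f.SameCycle a b) :
    SameCycle.setoid (f * swap a b) = glue (SameCycle.setoid f) a b := by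
  have hab := sameCycle_mul_swap_of_not h
  ext x y
  constructor
  · exact fun h => sameCycle_mul_swap_le a b (fun _ _ h => h) h
  · -- `f = (f * swap a b) * swap a b`
    have sub : ∀ x y, f.SameCycle x y → (f * swap a b).SameCycle x y := by
      intro x y hxy
      have := sameCycle_mul_swap_le (r := SameCycle.setoid (f * swap a b))
        (f := f * swap a b) a b (fun _ _ h => h) (x := x) (y := y)
        (by rwa [mul_assoc, swap_mul_self, mul_one])
      rwa [glue_eq_self (show (SameCycle.setoid (f * swap a b)) a b from hab)] at this
    rintro (h1 | ⟨h1, h2⟩ | ⟨h1, h2⟩)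
    · exact sub _ _ h1
    · exact ((sub _ _ h1).trans hab).trans (sub _ _ h2)
    · exact ((sub _ _ h1).trans hab.symm).trans (sub _ _ h2)

theorem cyc_mul_swap_of_not {f : Perm α} {a b : α} (h : ¬ f.SameCycle a b) :
    cyc (f * swap a b) + 1 = cyc f := by
  unfold cyc
  rw [setoid_mul_swap h]
  exact card_glue h

theorem not_sameCycle_mul_swap {f : Perm α} {a b : α} (hab : a ≠ b) (h : f.SameCycle a b) :
    ¬ (f * swap a b).SameCycle a b := by
  classical
  have hex : ∃ n : ℕ, (f ^ n) a = b := h.exists_nat_pow_eq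
  set j := Nat.find hex with hj
  have hjb : (f ^ j) a = b := Nat.find_spec hex
  have hmin : ∀ i < j, (f ^ i) a ≠ b := fun i hi => Nat.find_min hex hi
  have hj0 : 0 < j := by
    rcases Nat.eq_zero_or_pos j with h0 | h0
    · rw [h0] at hjb
      exact absurd hjb hab
    · exact h0
  -- the cycle of `b` is the arc of the cycle of `f` from `f a` to `b`
  let A : Set α := {x | ∃ i, 1 ≤ i ∧ i ≤ j ∧ (f ^ i) a = x}
  have ha : a ∉ A := by
    rintro ⟨i, h1, h2, h3⟩
    refine hmin (j - i) (by omega) ?_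
    rw [← hjb]
    conv_rhs => rw [← Nat.sub_add_cancel h2, pow_add, mul_apply, h3]
  have hA : ∀ x ∈ A, (f * swap a b) x ∈ A := by
    rintro x ⟨i, h1, h2, rfl⟩
    rcases eq_or_lt_of_le h2 with rfl | h2
    · rw [mul_apply, hjb, swap_apply_right]
      exact ⟨1, le_rfl, h1, by simp⟩
    · rw [mul_apply, swap_apply_of_ne_of_ne, ← mul_apply, ← pow_succ']
      · exact ⟨i + 1, by omega, by omega, rfl⟩
      · exact fun hh => ha ⟨i, h1, h2.le, hh⟩
      · exact hmin i h2
  intro hs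
  exact ha (hs.symm.mem_of_closed hA ⟨j, hj0, le_rfl, hjb⟩)

theorem cyc_mul_swap_of_sameCycle {f : Perm α} {a b : α} (hab : a ≠ b) (h : f.SameCycle a b) :
    cyc (f * swap a b) = cyc f + 1 := by
  have := cyc_mul_swap_of_not (not_sameCycle_mul_swap hab h)
  rw [mul_assoc, swap_mul_self, mul_one] at this
  exact this.symm

theorem cyc_mul_swap_le (f : Perm α) (a b : α) : cyc (f * swap a b) ≤ cyc f + 1 := by
  by_cases h : f.SameCycle a b
  · rcases eq_or_ne a b with rfl | hab
    · rw [swap_self]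
      exact Nat.le_succ _
    · exact (cyc_mul_swap_of_sameCycle hab h).le
  · have := cyc_mul_swap_of_not h
    omega

end Equiv.Perm

open Equiv Equiv.Perm

theorem cyc_le_card {α : Type*} [Finite α] (f : Perm α) : cyc f ≤ Nat.card α :=
  Nat.card_le_card_of_surjective _ Quotient.mk_surjective

theorem cyc_one {α : Type*} : cyc (1 : Perm α) = Nat.card α := by
  refine (Nat.card_eq_of_bijective (Quotient.mk (SameCycle.setoid (1 : Perm α))) ⟨?_, ?_⟩).symm
  · intro x y h
    have : (1 : Perm α).SameCycle x y := Quotient.exact h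
    simpa using this
  · exact Quotient.mk_surjective

/-- `P` and `s` act transitively, expressed by invariant sets. -/
def PermConnected {D : Type*} (P s : Perm D) : Prop :=
  ∀ A : Set D, A.Nonempty → (∀ x ∈ A, P x ∈ A) → (∀ x ∈ A, s x ∈ A) → A = Set.univ

/-- The induction behind Euler's inequality: `s` is built up as a product of transpositions, and
each of them either joins two classes of `r` (and then two cycles of `P`) or splits at most one
cycle. -/
theorem exists_setoid_cyc_le {D : Type*} [Finite D] (n : ℕ) (s : Perm D)
    (hs : Nat.card D = cyc s + n) (c k : ℕ) (P : Perm D) (r : Setoid D)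
    (hr : ∀ x y, P.SameCycle x y → r x y) (hc : cyc P + c ≤ 2 * Nat.card (Quotient r) + k) :
    ∃ r' : Setoid D, (∀ x y, r x y → r' x y) ∧ (∀ x, r' x (s x)) ∧
      cyc (P * s) + c ≤ 2 * Nat.card (Quotient r') + k + n := by
  classical
  induction n generalizing s P r k with
  | zero =>
    have hs1 : s = 1 := by
      by_contra hne
      obtain ⟨x, hx⟩ : ∃ x, s x ≠ x := by
        by_contra! h
        exact hne (Equiv.ext h)
      have := cyc_mul_swap_of_sameCycle hx.symm (f := s) ⟨1, by simp⟩
      have := cyc_le_card (s * swap x (s x))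
      omega
    subst hs1
    exact ⟨r, fun _ _ h => h, fun x => r.refl x, by simpa using hc⟩
  | succ n ih =>
    by_cases hs1 : s = 1
    · subst hs1
      exact ⟨r, fun _ _ h => h, fun x => r.refl x, by simp; omega⟩
    obtain ⟨x, hx⟩ : ∃ x, s x ≠ x := by
      by_contra! h
      exact hs1 (Equiv.ext h)
    set s' := swap x (s x) * s with hs'
    -- splitting off a transposition from `s` gives a permutation with one more cycle
    have e1 : s' = s * swap (s⁻¹ x) x := by
      rw [hs']
      have := mul_swap_eq_swap_mul s (s⁻¹ x) x
      rw [this]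
      simp
    have hne : s⁻¹ x ≠ x := fun h => hx (by rw [inv_eq_iff_eq] at h; exact h.symm)
    have c1 := cyc_mul_swap_of_sameCycle hne (f := s) ⟨1, by simp⟩
    rw [← e1] at c1
    have e2 : s = swap x (s x) * s' := by
      rw [hs', ← mul_assoc, swap_mul_self, one_mul]
    have hr' : ∀ y z, (P * swap x (s x)).SameCycle y z → glue r x (s x) y z :=
      fun y z h => sameCycle_mul_swap_le x (s x) hr h
    -- joining two classes lowers `2 * card` by two and joins two cycles; otherwise the number of
    -- cycles grows by at most one: in each case the bound gets worse by at most one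
    have hc' : cyc (P * swap x (s x)) + c ≤
        2 * Nat.card (Quotient (glue r x (s x))) + (k + 1) := by
      by_cases hrx : r x (s x)
      · rw [glue_eq_self hrx]
        have := cyc_mul_swap_le P x (s x)
        omega
      · have h1 := card_glue hrx
        have h2 := cyc_mul_swap_of_not (fun h => hrx (hr _ _ h))
        omega
    obtain ⟨r', h1, h2, h3⟩ := ih s' (by omega) (k + 1) (P * swap x (s x)) _ hr' hc'
    refine ⟨r', fun y z h => h1 _ _ (Or.inl h), ?_, ?_⟩
    · intro y
      have hxx : r' x (s x) := h1 _ _ (Or.inr (Or.inl ⟨r.refl _, r.refl _⟩))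
      have hy := h2 y
      refine r'.trans hy ?_
      rw [hs', mul_apply]
      rcases eq_or_ne (s y) x with h | h
      · rw [h, swap_apply_left]
        exact r'.symm hxx
      rcases eq_or_ne (s y) (s x) with h' | h'
      · rw [h', swap_apply_right]
        exact hxx
      · rw [swap_apply_of_ne_of_ne h h']
    · rw [mul_assoc, ← e2] at h3
      omega

/-- **Euler's inequality** for a pair of permutations generating a transitive group. -/
theorem PermConnected.euler_le {D : Type*} [Finite D] {P s : Perm D} (h : PermConnected P s) :
    cyc P + cyc s + cyc (P * s) ≤ Nat.card D + 2 := by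
  obtain ⟨n, hn⟩ := Nat.exists_eq_add_of_le (cyc_le_card s)
  obtain ⟨r, h1, h2, h3⟩ := exists_setoid_cyc_le n s hn (cyc P) 0 P (SameCycle.setoid P)
    (fun _ _ h => h) (by unfold cyc; omega)
  have hr : Nat.card (Quotient r) ≤ 1 := by
    rw [Finite.card_le_one_iff_subsingleton]
    refine ⟨fun a b => ?_⟩
    induction a using Quotient.inductionOn with | _ x => ?_
    induction b using Quotient.inductionOn with | _ y => ?_
    have := h {z | r x z} ⟨x, r.refl x⟩
      (fun z hz => r.trans hz (h1 _ _ ⟨1, by simp⟩)) (fun z hz => r.trans hz (h2 z))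
    refine Quotient.sound ?_
    have hy : y ∈ {z | r x z} := this ▸ Set.mem_univ y
    exact hy
  omega

/-! ### Planar pairs of permutations and their cuts -/

theorem sameCycle_of_semiconj {α β : Type*} {f : Perm α} {g : Perm β} {j : α → β}
    (h : ∀ x, j (f x) = g (j x)) {x y : α} (hxy : f.SameCycle x y) :
    g.SameCycle (j x) (j y) := by
  have hinv : ∀ x, j (f⁻¹ x) = g⁻¹ (j x) := fun x => by
    rw [eq_inv_iff_eq, ← h]; simp
  obtain ⟨n, rfl⟩ := hxy
  refine ⟨n, ?_⟩
  induction n using Int.induction_on with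
  | zero => simp
  | succ n ih => rw [add_comm, zpow_add, zpow_add, zpow_one, zpow_one, mul_apply, mul_apply, ih, h]
  | pred n ih =>
    rw [sub_eq_add_neg, add_comm, zpow_add, zpow_add, zpow_neg_one, zpow_neg_one, mul_apply,
      mul_apply, ih, hinv]

theorem sameCycle_semiconj_iff {α β : Type*} {f : Perm α} {g : Perm β} {j : α → β}
    (h : ∀ x, j (f x) = g (j x)) (hj : Function.Injective j) {x y : α} :
    g.SameCycle (j x) (j y) ↔ f.SameCycle x y := by
  refine ⟨?_, sameCycle_of_semiconj h⟩
  rintro ⟨n, hn⟩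
  have key : j ((f ^ n) x) = (g ^ n) (j x) := by
    clear hn
    have hinv : ∀ x, j (f⁻¹ x) = g⁻¹ (j x) := fun x => by
      rw [eq_inv_iff_eq, ← h]; simp
    induction n using Int.induction_on with
    | zero => simp
    | succ n ih =>
      rw [add_comm, zpow_add, zpow_add, zpow_one, zpow_one, mul_apply, mul_apply, ← ih, h]
    | pred n ih =>
      rw [sub_eq_add_neg, add_comm, zpow_add, zpow_add, zpow_neg_one, zpow_neg_one, mul_apply,
        mul_apply, ← ih, hinv]
  exact ⟨n, hj (key.trans hn)⟩

theorem cyc_eq_of_equiv {α β : Type*} {f : Perm α} {g : Perm β} (j : α ≃ β)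
    (h : ∀ x, j (f x) = g (j x)) : cyc f = cyc g :=
  Nat.card_congr (Quotient.congr j fun _ _ =>
    (sameCycle_semiconj_iff h j.injective).symm)

theorem cyc_inv {α : Type*} (f : Perm α) : cyc f⁻¹ = cyc f := by
  have : SameCycle.setoid f⁻¹ = SameCycle.setoid f := by
    ext x y
    exact sameCycle_inv
  rw [cyc, this, cyc]

theorem cyc_mul_comm {α : Type*} (f g : Perm α) : cyc (f * g) = cyc (g * f) :=
  cyc_eq_of_equiv g fun _ => rfl

/-- The cycles of a permutation which preserves both parts of a partition in two parts. -/
theorem cyc_eq_add {α β γ : Type*} [Finite γ] {f : Perm α} {g : Perm β} {k : Perm γ}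
    {i : α → γ} {j : β → γ} (hi : Function.Injective i) (hj : Function.Injective j)
    (hdisj : ∀ x y, i x ≠ j y) (hcov : ∀ z, (∃ x, i x = z) ∨ ∃ y, j y = z)
    (hf : ∀ x, i (f x) = k (i x)) (hg : ∀ y, j (g y) = k (j y)) : cyc k = cyc f + cyc g := by
  have := Finite.of_injective i hi
  have := Finite.of_injective j hj
  unfold cyc
  rw [← Nat.card_sum]
  symm
  refine Nat.card_eq_of_bijective (Sum.elim
    (Quotient.map' i fun x y (h : f.SameCycle x y) => sameCycle_of_semiconj hf h)
    (Quotient.map' j fun x y (h : g.SameCycle x y) => sameCycle_of_semiconj hg h)) ⟨?_, ?_⟩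
  · have hne : ∀ x y, ¬ k.SameCycle (i x) (j y) := by
      intro x y h
      have := h.mem_of_closed (A := Set.range i) (by rintro _ ⟨a, rfl⟩; exact ⟨f a, hf a⟩) ⟨x, rfl⟩
      obtain ⟨a, ha⟩ := this
      exact hdisj _ _ ha
    rintro (a | a) (b | b) hab
    · induction a using Quotient.inductionOn with | _ x => ?_
      induction b using Quotient.inductionOn with | _ y => ?_
      have : k.SameCycle (i x) (i y) := Quotient.exact hab
      exact congrArg Sum.inl (Quotient.sound ((sameCycle_semiconj_iff hf hi).1 this))
    · induction a using Quotient.inductionOn with | _ x => ?_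
      induction b using Quotient.inductionOn with | _ y => ?_
      exact absurd (Quotient.exact hab) (hne x y)
    · induction a using Quotient.inductionOn with | _ x => ?_
      induction b using Quotient.inductionOn with | _ y => ?_
      exact absurd (SameCycle.symm (Quotient.exact hab)) (hne y x)
    · induction a using Quotient.inductionOn with | _ x => ?_
      induction b using Quotient.inductionOn with | _ y => ?_
      have : k.SameCycle (j x) (j y) := Quotient.exact hab
      exact congrArg Sum.inr (Quotient.sound ((sameCycle_semiconj_iff hg hj).1 this))
  · intro q
    induction q using Quotient.inductionOn with | _ z => ?_
    rcases hcov z with ⟨x, rfl⟩ | ⟨y, rfl⟩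
    · exact ⟨Sum.inl (Quotient.mk _ x), rfl⟩
    · exact ⟨Sum.inr (Quotient.mk _ y), rfl⟩

/-- The restriction of a permutation to an invariant subset of a finite type. -/
noncomputable def restrictPerm {D : Type*} [Finite D] (P : Perm D) {S : Set D}
    (h : ∀ x ∈ S, P x ∈ S) : Perm S :=
  P.subtypePerm fun _ => mem_iff_of_closed h

@[simp]
theorem coe_restrictPerm {D : Type*} [Finite D] (P : Perm D) {S : Set D}
    (h : ∀ x ∈ S, P x ∈ S) (x : S) : (restrictPerm P h x : D) = P x := rfl

theorem compl_closed {D : Type*} [Finite D] {P : Perm D} {S : Set D} (h : ∀ x ∈ S, P x ∈ S) :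
    ∀ x ∈ Sᶜ, P x ∈ Sᶜ := fun _ hx hPx => hx ((mem_iff_of_closed h).1 hPx)

theorem cyc_eq_restrict_add {D : Type*} [Finite D] (P : Perm D) {S : Set D}
    (h : ∀ x ∈ S, P x ∈ S) (h' : ∀ x ∈ Sᶜ, P x ∈ Sᶜ) :
    cyc P = cyc (restrictPerm P h) + cyc (restrictPerm P h') :=
  cyc_eq_add Subtype.val_injective Subtype.val_injective
    (fun x y hxy => y.2 (hxy ▸ x.2))
    (fun z => (em (z ∈ S)).imp (fun h => ⟨⟨z, h⟩, rfl⟩) fun h => ⟨⟨z, h⟩, rfl⟩)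
    (fun _ => rfl) (fun _ => rfl)

/-- An involution without fixed points. -/
def FixFreeInvol {D : Type*} (s : Perm D) : Prop :=
  ∀ x, s (s x) = x ∧ s x ≠ x

/-- The pair `P`, `s` satisfies Euler's relation for the sphere: `cyc P` is the number of
vertices, `cyc s` the number of edges and `cyc (P * s)` the number of faces of a map with darts
`D`. -/
def Planar {D : Type*} (P s : Perm D) : Prop :=
  cyc P + cyc s + cyc (P * s) = Nat.card D + 2

/-- `S` is a set of edges (that is, closed under `s`) which `P` leaves at exactly one place,
namely at `e`. In the medial 4-regular graph, whose vertices are the cycles of `s` and whose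
edges lead from the cycle of `x` to that of `P x`, this is one side of a 2-edge-cut. -/
structure OneOut {D : Type*} (P s : Perm D) (S : Set D) (e : D) : Prop where
  closed : ∀ x ∈ S, s x ∈ S
  mem : e ∈ S
  out : P e ∉ S
  stay : ∀ x ∈ S, x ≠ e → P x ∈ S

namespace OneOut

variable {D : Type*} [Finite D] {P s : Perm D} {S : Set D} {e f : D}

theorem exists_compl (h : OneOut P s S e) : ∃ f, OneOut P s Sᶜ f := by
  classical
  -- some `f` outside `S` is sent into `S`
  obtain ⟨f, hf, hPf⟩ : ∃ f, f ∉ S ∧ P f ∈ S := by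
    by_contra! hc
    have := compl_closed (P := P) (S := Sᶜ) hc
    rw [compl_compl] at this
    exact h.out (this e h.mem)
  refine ⟨f, compl_closed h.closed, hf, fun hh => hh hPf, ?_⟩
  intro g hg hgf hPg
  -- otherwise `P` maps `S ∖ {e} ∪ {f, g}` injectively into `S`
  have hsub : P '' (insert f (insert g (S \ {e}))) ⊆ S := by
    rintro _ ⟨x, hx | hx | hx, rfl⟩
    · exact hx ▸ hPf
    · exact hx ▸ hPg
    · exact h.stay x hx.1 hx.2
  have h1 := Set.ncard_le_ncard hsub (Set.toFinite S)
  rw [Set.ncard_image_of_injective _ P.injective, Set.ncard_insert_of_notMem,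
    Set.ncard_insert_of_notMem] at h1
  · have := Set.ncard_sdiff_singleton_add_one h.mem (Set.toFinite S)
    omega
  · exact fun hh => hg hh.1
  · rintro (hh | hh)
    · exact hgf hh.symm
    · exact hf hh.1

variable [DecidableEq D]

omit [Finite D] in
theorem cut_closed (h : OneOut P s S e) (h' : OneOut P s Sᶜ f) :
    ∀ x ∈ S, (P * swap e f) x ∈ S := by
  intro x hx
  rw [mul_apply]
  rcases eq_or_ne x e with rfl | hxe
  · rw [swap_apply_left]
    exact Set.notMem_compl_iff.1 h'.out
  · rw [swap_apply_of_ne_of_ne hxe (by rintro rfl; exact h'.mem hx)]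
    exact h.stay x hx hxe

theorem cut_connected (h : OneOut P s S e) (h' : OneOut P s Sᶜ f) (hc : PermConnected P s) :
    PermConnected (restrictPerm (P * swap e f) (h.cut_closed h'))
      (restrictPerm s h.closed) := by
  intro A hA hP hs
  have hs' : ∀ x ∈ ((↑) '' A : Set D), s x ∈ ((↑) '' A : Set D) := by
    rintro _ ⟨x, hx, rfl⟩
    exact ⟨_, hs x hx, rfl⟩
  have hne : ∀ x ∈ ((↑) '' A : Set D), x ≠ e → P x ∈ ((↑) '' A : Set D) := by
    rintro _ ⟨x, hx, rfl⟩ hxe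
    refine ⟨_, hP x hx, ?_⟩
    rw [coe_restrictPerm, mul_apply,
      swap_apply_of_ne_of_ne hxe (fun hh => h'.mem (by rw [← hh]; exact x.2))]
  by_cases heA : (⟨e, h.mem⟩ : S) ∈ A
  · have := hc ((↑) '' A ∪ Sᶜ) ⟨e, Or.inl ⟨_, heA, rfl⟩⟩ ?_ ?_
    · ext x
      refine ⟨fun _ => trivial, fun _ => ?_⟩
      have hx : (x : D) ∈ ((↑) '' A ∪ Sᶜ : Set D) := this ▸ Set.mem_univ _
      rcases hx with ⟨y, hy, hyx⟩ | hx
      · rwa [← Subtype.ext hyx]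
      · exact absurd x.2 hx
    · rintro x (hx | hx)
      · rcases eq_or_ne x e with rfl | hxe
        · exact Or.inr h.out
        · exact Or.inl (hne x hx hxe)
      · rcases eq_or_ne x f with rfl | hxf
        · refine Or.inl ⟨_, hP _ heA, ?_⟩
          rw [coe_restrictPerm, mul_apply, swap_apply_left]
        · exact Or.inr (h'.stay x hx hxf)
    · rintro x (hx | hx)
      · exact Or.inl (hs' x hx)
      · exact Or.inr (h'.closed x hx)
  · have heA' : e ∉ ((↑) '' A : Set D) := by
      rintro ⟨x, hx, rfl⟩
      exact heA hx
    have := hc ((↑) '' A) (hA.image _) (fun x hx => hne x hx (fun hh => heA' (hh ▸ hx))) hs'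
    exact absurd (this ▸ Set.mem_univ e) heA'

/-- Cutting a planar map along a 2-edge-cut: one more vertex and one more face arise, which makes
the Euler characteristics of the two parts add up to four, and neither of them exceeds two. -/
theorem cut_planar (h : OneOut P s S e) (h' : OneOut P s Sᶜ f) (hs : FixFreeInvol s)
    (hc : PermConnected P s) (hp : Planar P s) :
    Planar (restrictPerm (P * swap e f) (h.cut_closed h')) (restrictPerm s h.closed) := by
  set P' := P * swap e f with hP'
  have hP : P = P' * swap e f := by rw [hP', mul_assoc, swap_mul_self, mul_one]
  have hcl := h.cut_closed h'
  have hcl' : ∀ x ∈ Sᶜ, P' x ∈ Sᶜ := compl_closed hcl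
  have hnot : ∀ {g : Perm D}, (∀ x ∈ S, g x ∈ S) → ∀ {a b}, a ∈ S → b ∉ S → ¬ g.SameCycle a b :=
    fun hg _ _ ha hb hab => hb (hab.mem_of_closed hg ha)
  have c1 := cyc_mul_swap_of_not (hnot hcl h.mem h'.mem)
  have hcls : ∀ x ∈ S, (P' * s) x ∈ S := fun x hx => hcl _ (h.closed x hx)
  have c2 := cyc_mul_swap_of_not (hnot hcls (h.closed _ h.mem) (h'.closed _ h'.mem))
  have e2 : P' * s * swap (s e) (s f) = P * s := by
    have hss : s⁻¹ = s := by
      ext x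
      rw [inv_eq_iff_eq]
      exact (hs x).1.symm
    rw [mul_assoc, mul_swap_eq_swap_mul, (hs e).1, (hs f).1, ← mul_assoc, ← hP]
  rw [← hP', ← hP] at c1
  rw [e2] at c2
  have d1 := cyc_eq_restrict_add P' hcl hcl'
  have d2 := cyc_eq_restrict_add s h.closed h'.closed
  have d3 := cyc_eq_restrict_add (P' * s) hcls (compl_closed hcls)
  have e3 : restrictPerm (P' * s) hcls = restrictPerm P' hcl * restrictPerm s h.closed := rfl
  have e4 : restrictPerm (P' * s) (compl_closed hcls) =
    restrictPerm P' hcl' * restrictPerm s h'.closed := rfl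
  have k1 := (h.cut_connected h' hc).euler_le
  have h'' : OneOut P s Sᶜᶜ e := by rwa [compl_compl]
  have k2 := (h'.cut_connected h'' hc).euler_le
  have e5 : restrictPerm (P * swap f e) (h'.cut_closed h'') = restrictPerm P' hcl' := by
    congr 1
    rw [swap_comm]
  have hcard : Nat.card S + Nat.card (Sᶜ : Set D) = Nat.card D := by
    classical
    have := Fintype.ofFinite D
    rw [← Nat.card_sum]
    exact Nat.card_congr (Equiv.Set.sumCompl S)
  unfold Planar at hp ⊢
  rw [e5, ← e4] at k2
  change _ + _ + cyc (restrictPerm (P' * s) hcls) ≤ _ at k1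
  change _ + _ + cyc (restrictPerm (P' * s) hcls) = _
  change cyc (restrictPerm P' hcl) + _ + _ ≤ _ at k1
  change cyc (restrictPerm P' hcl) + _ + _ = _
  omega

end OneOut

/-- A combinatorial Jordan curve theorem: if two different elements `e` and `f` lie on the same
vertex and `s e` and `s f` lie on the same face, then there is a 2-edge-cut between them. -/
theorem exists_oneOut {D : Type*} [Finite D] {P s : Perm D} (hs : FixFreeInvol s)
    (hc : PermConnected P s) (hp : Planar P s) {e f : D} (hef : e ≠ f) (h1 : P.SameCycle e f)
    (h2 : (P * s).SameCycle (s e) (s f)) : ∃ S, OneOut P s S e ∧ f ∉ S := by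
  classical
  set P' := P * swap e f with hP'
  have hP : P = P' * swap e f := by rw [hP', mul_assoc, swap_mul_self, mul_one]
  have c1 := cyc_mul_swap_of_sameCycle hef h1
  have c2 := cyc_mul_swap_of_sameCycle (fun h => hef (s.injective h)) h2
  have e2 : P * s * swap (s e) (s f) = P' * s := by
    rw [hP', mul_assoc, mul_swap_eq_swap_mul, (hs e).1, (hs f).1, mul_assoc]
  rw [e2] at c2
  rw [← hP'] at c1
  -- splitting the vertex and the face would lead to Euler characteristic four
  have hnc : ¬ PermConnected P' s := by
    intro hc
    have := hc.euler_le
    unfold Planar at hp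
    omega
  have key : ∀ A : Set D, (∀ x ∈ A, P' x ∈ A) → (∀ x ∈ A, s x ∈ A) → e ∈ A → f ∉ A →
      ∃ S, OneOut P s S e ∧ f ∉ S := by
    intro A hA hsA he hf
    refine ⟨A, ⟨hsA, he, ?_, ?_⟩, hf⟩
    · rw [hP, mul_apply, swap_apply_left]
      exact fun h => hf ((mem_iff_of_closed hA).1 h)
    · intro x hx hxe
      rw [hP, mul_apply, swap_apply_of_ne_of_ne hxe (by rintro rfl; exact hf hx)]
      exact hA x hx
  unfold PermConnected at hnc
  push Not at hnc
  obtain ⟨A, ⟨a, ha⟩, hA, hsA, hne⟩ := hnc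
  -- a set closed under `P'` which does not separate `e` from `f` is closed under `P`
  have hsame : (e ∈ A ↔ f ∈ A) → False := by
    intro hiff
    have hPA : ∀ x ∈ A, P x ∈ A := by
      intro x hx
      rw [hP, mul_apply]
      refine hA _ ?_
      rcases eq_or_ne x e with rfl | hxe
      · rw [swap_apply_left]
        exact hiff.1 hx
      rcases eq_or_ne x f with rfl | hxf
      · rw [swap_apply_right]
        exact hiff.2 hx
      · rwa [swap_apply_of_ne_of_ne hxe hxf]
    exact hne (hc A ⟨a, ha⟩ hPA hsA)
  by_cases he : e ∈ A
  · by_cases hf : f ∈ A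
    · exact (hsame (iff_of_true he hf)).elim
    · exact key A hA hsA he hf
  · by_cases hf : f ∈ A
    · exact key Aᶜ (compl_closed hA) (compl_closed hsA) he (fun h => h hf)
    · exact (hsame (iff_of_false he hf)).elim

/-! ### Minors of simple graphs -/

theorem induce_connected_iff {V : Type*} {G : SimpleGraph V} {B : Set V} :
    (G.induce B).Connected ↔ B.Nonempty ∧ ∀ A ⊆ B, A.Nonempty →
      (∀ x ∈ A, ∀ y ∈ B, G.Adj x y → y ∈ A) → A = B := by
  constructor
  · intro h
    refine ⟨by have := h.nonempty; exact Set.nonempty_coe_sort.1 this, fun A hAB hA hcl => ?_⟩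
    refine hAB.antisymm fun y hy => ?_
    obtain ⟨a, ha⟩ := hA
    have key : ∀ (u w : B), (G.induce B).Walk u w → (u : V) ∈ A → (w : V) ∈ A := by
      intro u w p
      induction p with
      | nil => exact id
      | cons hadj _ ih => exact fun hu => ih (hcl _ hu _ (Subtype.prop _) hadj)
    obtain ⟨p⟩ := h.preconnected ⟨a, hAB ha⟩ ⟨y, hy⟩
    exact key _ _ p ha
  · rintro ⟨⟨b, hb⟩, h⟩
    have key : ∀ y : B, (G.induce B).Reachable ⟨b, hb⟩ y := by
      have := h {y | ∃ hy : y ∈ B, (G.induce B).Reachable ⟨b, hb⟩ ⟨y, hy⟩}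
        (fun y hy => hy.1) ⟨b, hb, SimpleGraph.Reachable.refl _⟩ ?_
      · intro y
        exact (this.ge y.2).2
      · rintro x ⟨hx, hr⟩ y hy hxy
        exact ⟨hy, hr.trans (SimpleGraph.Adj.reachable (G := G.induce B) (u := ⟨x, hx⟩)
          (v := ⟨y, hy⟩) hxy)⟩
    have : Nonempty B := ⟨⟨b, hb⟩⟩
    exact ⟨fun x y => (key x).symm.trans (key y)⟩

/-- Minors of a graph `G'` obtained from `G` by contracting connected sets (the fibres of `g`),
and possibly deleting edges, are minors of `G`. -/
theorem SimpleGraph.HasMinor.of_contraction {V W U : Type*} {G : SimpleGraph V}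
    {G' : SimpleGraph W} {H : SimpleGraph U} (g : V → W)
    (hconn : ∀ w, (G.induce (g ⁻¹' {w})).Connected)
    (hadj : ∀ w w', G'.Adj w w' → ∃ x y, g x = w ∧ g y = w' ∧ G.Adj x y)
    (h : G'.HasMinor H) : G.HasMinor H := by
  obtain ⟨B, h1, h2, h3⟩ := h
  refine ⟨fun u => g ⁻¹' (B u), fun u => ?_, fun u u' hu => (h2 u u' hu).preimage g, ?_⟩
  · rw [induce_connected_iff]
    obtain ⟨⟨b, hb⟩, hB⟩ := induce_connected_iff.1 (h1 u)
    have hsurj : ∀ w, ∃ x, g x = w := fun w => (induce_connected_iff.1 (hconn w)).1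
    refine ⟨by obtain ⟨x, rfl⟩ := hsurj b; exact ⟨x, hb⟩, fun A hAB ⟨a, ha⟩ hcl => ?_⟩
    have hfib : ∀ x y, g x = g y → x ∈ A → y ∈ A := by
      intro x y hxy hx
      have := (induce_connected_iff.1 (hconn (g y))).2 (A ∩ g ⁻¹' {g y}) Set.inter_subset_right
        ⟨x, hx, hxy⟩ ?_
      · have hy : y ∈ g ⁻¹' {g y} := rfl
        rw [← this] at hy
        exact hy.1
      · rintro z ⟨hz, hzy⟩ z' hz' hadj'
        refine ⟨hcl z hz z' ?_ hadj', hz'⟩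
        have := hAB hz
        rw [Set.mem_preimage] at this ⊢
        rw [Set.mem_preimage, Set.mem_singleton_iff] at hzy hz'
        rw [hz', ← hzy]
        exact this
    have := hB (g '' A) (by rintro _ ⟨x, hx, rfl⟩; exact hAB hx) ⟨_, a, ha, rfl⟩ ?_
    · refine hAB.antisymm fun y hy => ?_
      have hy' : g y ∈ B u := hy
      rw [← this] at hy'
      obtain ⟨x, hx, hxy⟩ := hy'
      exact hfib x y hxy hx
    · rintro _ ⟨x, hx, rfl⟩ y hy hxy
      obtain ⟨x', y', hx', rfl, hxy'⟩ := hadj _ _ hxy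
      exact ⟨y', hcl x' (hfib x x' hx'.symm hx) y' hy hxy', rfl⟩
  · intro u u' huu
    obtain ⟨w, hw, w', hw', hww⟩ := h3 u u' huu
    obtain ⟨x, y, rfl, rfl, hxy⟩ := hadj _ _ hww
    exact ⟨x, hw, y, hw', hxy⟩

theorem SimpleGraph.HasMinor.of_clique {V : Type*} {G : SimpleGraph V} {a b c d : V}
    (hab : G.Adj a b) (hac : G.Adj a c) (had : G.Adj a d) (hbc : G.Adj b c) (hbd : G.Adj b d)
    (hcd : G.Adj c d) : G.HasMinor (⊤ : SimpleGraph (Fin 4)) := by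
  have hadj : ∀ i j : Fin 4, i ≠ j → G.Adj (![a, b, c, d] i) (![a, b, c, d] j) := by
    intro i j hij
    fin_cases i <;> fin_cases j <;> first | exact absurd rfl hij | assumption |
      (apply SimpleGraph.Adj.symm; assumption)
  refine ⟨fun i => {![a, b, c, d] i}, fun i => ?_, fun i j hij => ?_, fun i j hij => ?_⟩
  · rw [induce_connected_iff]
    refine ⟨Set.singleton_nonempty _, fun A hA hne _ => ?_⟩
    exact (Set.subset_singleton_iff_eq.1 hA).resolve_left hne.ne_empty
  · rw [Set.disjoint_singleton]
    exact (hadj i j hij).ne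
  · exact ⟨_, rfl, _, rfl, hadj i j hij⟩

/-- The graph on `W` obtained from `G` by identifying vertices along `g`. -/
def SimpleGraph.contract {V W : Type*} (G : SimpleGraph V) (g : V → W) : SimpleGraph W where
  Adj a b := a ≠ b ∧ ∃ x y, g x = a ∧ g y = b ∧ G.Adj x y
  symm := ⟨fun _ _ ⟨h, x, y, hx, hy, hxy⟩ => ⟨h.symm, y, x, hy, hx, hxy.symm⟩⟩
  loopless := ⟨fun _ h => h.1 rfl⟩

theorem induce_connected_of_star {V : Type*} {G : SimpleGraph V} {B : Set V} {v : V} (hv : v ∈ B)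
    (h : ∀ x ∈ B, x ≠ v → G.Adj v x) : (G.induce B).Connected := by
  rw [induce_connected_iff]
  refine ⟨⟨v, hv⟩, fun A hAB ⟨a, ha⟩ hcl => ?_⟩
  have hvA : v ∈ A := by
    by_cases hav : a = v
    · exact hav ▸ ha
    · exact hcl a ha v hv (h a (hAB ha) hav).symm
  refine hAB.antisymm fun y hy => ?_
  by_cases hyv : y = v
  · exact hyv ▸ hvA
  · exact hcl v hvA y hy (h y hy hyv)

/-- A finite nonempty graph in which no two vertices cover the neighbourhood of a vertex, that
is, a graph of minimum degree at least three, has a minor `K₄`. In a smallest counterexample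
every contraction of an edge creates a vertex of degree two, so that every edge lies in a
triangle and there is a vertex of degree three; these local constraints lead to `K₄` or to a
further contraction. -/
theorem hasMinor_of_three_le_degree (n : ℕ) {V : Type*} [Finite V] (hn : Nat.card V = n)
    [Nonempty V] (G : SimpleGraph V)
    (hdeg : ∀ v a b : V, ∃ x, G.Adj v x ∧ x ≠ a ∧ x ≠ b) :
    G.HasMinor (⊤ : SimpleGraph (Fin 4)) := by
  induction n using Nat.strong_induction_on generalizing V with | _ n ih => ?_
  by_contra hfree
  classical
  -- contraction of a proper star
  have hcontr : ∀ (X : Set V) (v w : V), v ∉ X → w ∈ X → (∀ x ∈ X, G.Adj v x) →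
      ∃ z a b : V, z ∉ X ∧ ∀ x, x ∉ X → x ≠ z → (G.Adj z x ∨ (z = v ∧ ∃ y ∈ X, G.Adj y x) ∨
        (x = v ∧ ∃ y ∈ X, G.Adj z y)) → x = a ∨ x = b := by
    intro X v w hv hw hX
    by_contra! hcon
    let g : V → {x // x ∉ X} := fun x => if h : x ∈ X then ⟨v, hv⟩ else ⟨x, h⟩
    have hgX : ∀ x, x ∈ X → g x = ⟨v, hv⟩ := fun x hx => dif_pos hx
    have hg : ∀ x (hx : x ∉ X), g x = ⟨x, hx⟩ := fun x hx => dif_neg hx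
    have hlt : Nat.card {x // x ∉ X} < n := by
      rw [← hn]
      exact Finite.card_subtype_lt (x := w) (fun h => h hw)
    have : Nonempty {x // x ∉ X} := ⟨⟨v, hv⟩⟩
    refine hfree (SimpleGraph.HasMinor.of_contraction (G' := G.contract g) g ?_ ?_
      (ih _ hlt rfl (G.contract g) ?_))
    · rintro ⟨u, hu⟩
      apply induce_connected_of_star (v := u)
      · exact hg u hu
      · intro x hx hxu
        by_cases hxX : x ∈ X
        · have : g x = ⟨u, hu⟩ := hx
          rw [hgX x hxX] at this
          have hvu : v = u := congrArg Subtype.val this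
          exact hvu ▸ hX x hxX
        · have : g x = ⟨u, hu⟩ := hx
          rw [hg x hxX] at this
          exact absurd (congrArg Subtype.val this) hxu
    · exact fun w w' h => h.2
    · rintro ⟨z, hz⟩ ⟨a, ha⟩ ⟨b, hb⟩
      obtain ⟨x, hxX, hxz, h, hxa, hxb⟩ := hcon z a b hz
      refine ⟨⟨x, hxX⟩, ⟨fun hh => hxz (congrArg Subtype.val hh).symm, ?_⟩,
        fun hh => hxa (congrArg Subtype.val hh), fun hh => hxb (congrArg Subtype.val hh)⟩
      rcases h with h | ⟨rfl, y, hy, h⟩ | ⟨rfl, y, hy, h⟩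
      · exact ⟨z, x, hg z hz, hg x hxX, h⟩
      · exact ⟨y, x, hgX y hy, hg x hxX, h⟩
      · exact ⟨z, y, hg z hz, hgX y hy, h⟩
  -- contraction of an edge
  have hedge : ∀ v w, G.Adj v w →
      (∃ z b, G.Adj z w ∧ G.Adj z v ∧ ∀ x, G.Adj z x → x = w ∨ x = v ∨ x = b) ∨
      (∃ a b, G.Adj v a ∧ G.Adj v b ∧ G.Adj w a ∧ G.Adj w b ∧
        (∀ x, G.Adj v x → x = w ∨ x = a ∨ x = b) ∧ ∀ x, G.Adj w x → x = v ∨ x = a ∨ x = b) := by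
    intro v w hvw
    obtain ⟨z, a, b, hz, h⟩ := hcontr {w} v w hvw.ne rfl (fun x hx => by rwa [hx])
    have hz : z ≠ w := hz
    have h : ∀ x, x ≠ w → x ≠ z → (G.Adj z x ∨ (z = v ∧ G.Adj w x) ∨ (x = v ∧ G.Adj z w)) →
        x = a ∨ x = b := fun x hx hxz hh => h x hx hxz (by simpa using hh)
    by_cases hzv : z = v
    · subst hzv
      have hv : ∀ x, G.Adj z x → x = w ∨ x = a ∨ x = b := fun x hx => by
        by_cases hxw : x = w
        · exact Or.inl hxw
        · exact Or.inr (h x hxw hx.ne' (Or.inl hx))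
      have hw : ∀ x, G.Adj w x → x = z ∨ x = a ∨ x = b := fun x hx => by
        by_cases hxw : x = z
        · exact Or.inl hxw
        · exact Or.inr (h x hx.ne' hxw (Or.inr (Or.inl ⟨rfl, hx⟩)))
      refine Or.inr ⟨a, b, ?_, ?_, ?_, ?_, hv, hw⟩
      · obtain ⟨x, h1, h2, h3⟩ := hdeg z w b
        rcases hv x h1 with rfl | rfl | rfl <;> tauto
      · obtain ⟨x, h1, h2, h3⟩ := hdeg z w a
        rcases hv x h1 with rfl | rfl | rfl <;> tauto
      · obtain ⟨x, h1, h2, h3⟩ := hdeg w z b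
        rcases hw x h1 with rfl | rfl | rfl <;> tauto
      · obtain ⟨x, h1, h2, h3⟩ := hdeg w z a
        rcases hw x h1 with rfl | rfl | rfl <;> tauto
    · left
      obtain ⟨x, h1, h2, h3⟩ := hdeg z a b
      have hxw : x = w := by
        by_contra hxw
        rcases h x hxw h1.ne' (Or.inl h1) with h | h <;> tauto
      subst hxw
      have hall : ∀ y, G.Adj z y → y = x ∨ y = a ∨ y = b := fun y hy => by
        by_cases hyx : y = x
        · exact Or.inl hyx
        · exact Or.inr (h y hyx hy.ne' (Or.inl hy))
      rcases h v hvw.ne (Ne.symm hzv) (Or.inr (Or.inr ⟨rfl, h1⟩)) with rfl | rfl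
      · refine ⟨z, b, h1, ?_, hall⟩
        obtain ⟨y, k1, k2, k3⟩ := hdeg z x b
        rcases hall y k1 with rfl | rfl | rfl <;> tauto
      · refine ⟨z, a, h1, ?_, fun y hy => by have := hall y hy; tauto⟩
        obtain ⟨y, k1, k2, k3⟩ := hdeg z x a
        rcases hall y k1 with rfl | rfl | rfl <;> tauto
  have htri : ∀ v w, G.Adj v w → ∃ z, G.Adj z v ∧ G.Adj z w := by
    intro v w hvw
    rcases hedge v w hvw with ⟨z, b, h1, h2, _⟩ | ⟨a, b, h1, h2, h3, h4, _⟩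
    · exact ⟨z, h2, h1⟩
    · exact ⟨a, h1.symm, h3.symm⟩
  -- two adjacent vertices `w`, `u` of degree three on a common edge-diamond `v`, `t`
  have hdiamond : ∀ w u v t, G.Adj w u → G.Adj w v → G.Adj w t → G.Adj u v → G.Adj u t →
      v ≠ t → (∀ x, G.Adj w x → x = u ∨ x = v ∨ x = t) → False := by
    intro w u v t hwu hwv hwt huv hut hvt hw
    have hnvt : ¬ G.Adj v t := fun h =>
      hfree (SimpleGraph.HasMinor.of_clique hwu hwv hwt huv hut h)
    have hu : ∀ x, G.Adj u x → x = w ∨ x = v ∨ x = t := by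
      rcases hedge v w hwv.symm with ⟨z, b, h1, h2, h3⟩ | ⟨a, b, h1, h2, h3, h4, h5, h6⟩
      · rcases hw z h1.symm with rfl | rfl | rfl
        · intro x hx
          have k1 := h3 t hut
          have k2 := h3 x hx
          have := hwt.ne
          rcases k1 with rfl | rfl | rfl <;> tauto
        · exact absurd h2 (G.loopless.irrefl _)
        · exact absurd h2.symm hnvt
      · have := hw a h3
        have := hw b h4
        have k1 := h6 t hwt
        rcases k1 with rfl | rfl | rfl <;> tauto
    have hfour : ∀ v t, G.Adj w v → G.Adj u v → v ≠ t → ¬ G.Adj v t →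
        (∀ x, G.Adj w x → x = u ∨ x = v ∨ x = t) → (∀ x, G.Adj u x → x = w ∨ x = v ∨ x = t) →
        ∀ c, ∃ x, G.Adj v x ∧ x ≠ w ∧ x ≠ u ∧ x ≠ c := by
      intro v t hwv huv hvt hnvt hw hu c
      by_contra! hcon
      obtain ⟨x, h1, h2, h3⟩ := hdeg v w u
      obtain ⟨y, k1, k2⟩ := htri v x h1
      have hxc := hcon x h1 h2 h3
      by_cases hyw : y = w
      · subst hyw
        rcases hw x k2 with rfl | rfl | rfl
        · exact h3 rfl
        · exact h1.ne rfl
        · exact hnvt h1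
      by_cases hyu : y = u
      · subst hyu
        rcases hu x k2 with rfl | rfl | rfl
        · exact h2 rfl
        · exact h1.ne rfl
        · exact hnvt h1
      have hyc := hcon y k1.symm hyw hyu
      exact k2.ne (hyc.trans hxc.symm)
    have hv4 := hfour v t hwv huv hvt hnvt hw hu
    have ht4 := hfour t v hwt hut hvt.symm (fun h => hnvt h.symm)
      (fun x hx => by have := hw x hx; tauto) (fun x hx => by have := hu x hx; tauto)
    obtain ⟨z, a, b, hz, h⟩ := hcontr {w, u} v w
      (by rintro (hh | hh); exacts [hwv.ne hh.symm, huv.ne hh.symm]) (Or.inl rfl)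
      (by rintro x (rfl | rfl); exacts [hwv.symm, huv.symm])
    have hzw : z ≠ w := fun hh => hz (Or.inl hh)
    have hzu : z ≠ u := fun hh => hz (Or.inr hh)
    have h : ∀ x, x ≠ w → x ≠ u → x ≠ z → (G.Adj z x ∨ (z = v ∧ G.Adj w x) ∨
        (x = v ∧ G.Adj z w)) → x = a ∨ x = b := fun x hxw hxu hxz hh => by
      refine h x (by rintro (hh | hh); exacts [hxw hh, hxu hh]) hxz ?_
      rcases hh with hh | ⟨h1, h2⟩ | ⟨h1, h2⟩
      · exact Or.inl hh
      · exact Or.inr (Or.inl ⟨h1, w, Or.inl rfl, h2⟩)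
      · exact Or.inr (Or.inr ⟨h1, w, Or.inl rfl, h2⟩)
    by_cases hzv : z = v
    · subst hzv
      have h1 := h t hwt.ne' hut.ne' hvt.symm (Or.inr (Or.inl ⟨rfl, hwt⟩))
      obtain ⟨x, k1, k2, k3, k4⟩ := hv4 (if t = a then b else a)
      have h2 := h x k2 k3 k1.ne' (Or.inl k1)
      have hxt : x ≠ t := fun hh => hnvt (hh ▸ k1)
      split_ifs at k4 with hta
      · rcases h2 with h2 | h2
        · exact hxt (h2.trans hta.symm)
        · exact k4 h2
      · rcases h2 with h2 | h2
        · exact k4 h2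
        · exact hxt (h2.trans (h1.resolve_left hta).symm)
    by_cases hzt : z = t
    · subst hzt
      have h1 := h v hwv.ne' huv.ne' hvt (Or.inr (Or.inr ⟨rfl, hwt.symm⟩))
      obtain ⟨x, k1, k2, k3, k4⟩ := ht4 (if v = a then b else a)
      have h2 := h x k2 k3 k1.ne' (Or.inl k1)
      have hxt : x ≠ v := fun hh => hnvt (hh ▸ k1).symm
      split_ifs at k4 with hta
      · rcases h2 with h2 | h2
        · exact hxt (h2.trans hta.symm)
        · exact k4 h2
      · rcases h2 with h2 | h2
        · exact k4 h2
        · exact hxt (h2.trans (h1.resolve_left hta).symm)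
    obtain ⟨x, k1, k2, k3⟩ := hdeg z a b
    have hxw : x ≠ w := by
      rintro rfl
      have := hw z k1.symm
      tauto
    have hxu : x ≠ u := by
      rintro rfl
      have := hu z k1.symm
      tauto
    have := h x hxw hxu k1.ne' (Or.inl k1)
    tauto
  -- a vertex of degree three
  obtain ⟨w, p, q, r, hw⟩ : ∃ w p q r, ∀ x, G.Adj w x → x = p ∨ x = q ∨ x = r := by
    obtain ⟨v⟩ := ‹Nonempty V›
    obtain ⟨w, hvw, _⟩ := hdeg v v v
    rcases hedge v w hvw with ⟨z, b, _, _, h⟩ | ⟨a, b, _, _, _, _, h, _⟩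
    · exact ⟨z, _, _, _, h⟩
    · exact ⟨v, _, _, _, h⟩
  have hp : G.Adj w p ∧ p ≠ q ∧ p ≠ r := by
    obtain ⟨x, h1, h2, h3⟩ := hdeg w q r
    rcases hw x h1 with rfl | rfl | rfl <;> tauto
  have hq : G.Adj w q ∧ q ≠ r := by
    obtain ⟨x, h1, h2, h3⟩ := hdeg w p r
    rcases hw x h1 with rfl | rfl | rfl <;> tauto
  have hr : G.Adj w r := by
    obtain ⟨x, h1, h2, h3⟩ := hdeg w p q
    rcases hw x h1 with rfl | rfl | rfl <;> tauto
  have hpt : ∀ y, G.Adj w y → ∃ z, (z = p ∨ z = q ∨ z = r) ∧ G.Adj z y := by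
    intro y hy
    obtain ⟨z, h1, h2⟩ := htri w y hy
    exact ⟨z, hw z h1.symm, h2⟩
  have irr := G.loopless.irrefl
  have e1 : G.Adj q p ∨ G.Adj r p := by
    obtain ⟨z, rfl | rfl | rfl, hz⟩ := hpt p hp.1
    · exact absurd hz (irr _)
    · exact Or.inl hz
    · exact Or.inr hz
  have e2 : G.Adj p q ∨ G.Adj r q := by
    obtain ⟨z, rfl | rfl | rfl, hz⟩ := hpt q hq.1
    · exact Or.inl hz
    · exact absurd hz (irr _)
    · exact Or.inr hz
  have e3 : G.Adj p r ∨ G.Adj q r := by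
    obtain ⟨z, rfl | rfl | rfl, hz⟩ := hpt r hr
    · exact Or.inl hz
    · exact Or.inr hz
    · exact absurd hz (irr _)
  rw [G.adj_comm q p] at e1
  rw [G.adj_comm r q] at e2
  rw [G.adj_comm r p] at e1
  by_cases hpq : G.Adj p q
  · by_cases hpr : G.Adj p r
    · exact hdiamond w p q r hp.1 hq.1 hr hpq hpr hq.2 hw
    · exact hdiamond w q p r hq.1 hp.1 hr hpq.symm (e3.resolve_left hpr) hp.2.2
        (fun x hx => by have := hw x hx; tauto)
  · exact hdiamond w r p q hr hp.1 hq.1 (e1.resolve_left hpq).symm (e2.resolve_left hpq).symm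
      hp.2.1 (fun x hx => by have := hw x hx; tauto)

/-- A model of `K₄` in a graph, within the set `X` of vertices. -/
structure IsK4Model {V : Type*} (H : SimpleGraph V) (X : Set V) (B : Fin 4 → Set V) : Prop where
  sub : ∀ i, B i ⊆ X
  nonempty : ∀ i, (B i).Nonempty
  conn : ∀ i, ∀ A ⊆ B i, A.Nonempty → (∀ x ∈ A, ∀ y ∈ B i, H.Adj x y → y ∈ A) → A = B i
  disj : ∀ i j, i ≠ j → ∀ x ∈ B i, x ∉ B j
  adj : ∀ i j, i ≠ j → ∃ x ∈ B i, ∃ y ∈ B j, H.Adj x y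

/-- A vertex whose neighbours are among two vertices that are equal or adjacent can be dropped
from a model of `K₄`. -/
theorem IsK4Model.remove {V : Type*} {H : SimpleGraph V} {X : Set V} {B : Fin 4 → Set V}
    (hB : IsK4Model H X B) {v p q : V} (hpq : p = q ∨ H.Adj p q)
    (hv : ∀ y ∈ X, H.Adj v y → y = p ∨ y = q) :
    IsK4Model H (X \ {v}) fun i => B i \ {v} := by
  -- two different neighbours of `v` are adjacent
  have hnbr : ∀ y ∈ X, ∀ z ∈ X, H.Adj v y → H.Adj v z → y ≠ z → H.Adj y z := by
    intro y hy z hz h1 h2 hne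
    rcases hv y hy h1 with rfl | rfl <;> rcases hv z hz h2 with rfl | rfl
    · exact absurd rfl hne
    · exact hpq.resolve_left hne
    · exact (hpq.resolve_left hne.symm).symm
    · exact absurd rfl hne
  -- inside its own set, `v` has a neighbour, unless its set is `{v}`
  have hin : ∀ i, v ∈ B i → (B i \ {v}).Nonempty → ∃ y ∈ B i, y ≠ v ∧ H.Adj v y := by
    intro i hvi ⟨w, hw, hwv⟩
    by_contra! hcon
    have := hB.conn i {v} (by simpa using hvi) ⟨v, rfl⟩ (by
      rintro x rfl y hy hxy
      exact absurd hxy (hcon y hy hxy.ne'))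
    rw [← this] at hw
    exact hwv hw
  have hne : ∀ i, (B i \ {v}).Nonempty := by
    intro i
    by_contra hcon
    have hsub : ∀ x ∈ B i, x = v := fun x hx => by
      by_contra hxv
      exact hcon ⟨x, hx, hxv⟩
    have hnb : ∀ j, i ≠ j → ∃ y ∈ B j, H.Adj v y := fun j hij => by
      obtain ⟨x, hx, y, hy, hxy⟩ := hB.adj i j hij
      exact ⟨y, hy, hsub x hx ▸ hxy⟩
    have h3 : ∃ j k l : Fin 4, i ≠ j ∧ i ≠ k ∧ i ≠ l ∧ j ≠ k ∧ j ≠ l ∧ k ≠ l := by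
      clear hsub hnb
      fin_cases i
      exacts [⟨1, 2, 3, by decide⟩, ⟨0, 2, 3, by decide⟩, ⟨0, 1, 3, by decide⟩, ⟨0, 1, 2, by decide⟩]
    obtain ⟨j, k, l, hj, hk, hl, hjk, hjl, hkl⟩ := h3
    obtain ⟨a, ha, hva⟩ := hnb j hj
    obtain ⟨b, hb, hvb⟩ := hnb k hk
    obtain ⟨c, hc, hvc⟩ := hnb l hl
    have hab : a ≠ b := fun h => hB.disj j k hjk a ha (h ▸ hb)
    have hac : a ≠ c := fun h => hB.disj j l hjl a ha (h ▸ hc)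
    have hbc : b ≠ c := fun h => hB.disj k l hkl b hb (h ▸ hc)
    have ka := hv a (hB.sub _ ha) hva
    have kb := hv b (hB.sub _ hb) hvb
    have kc := hv c (hB.sub _ hc) hvc
    rcases ka with rfl | rfl <;> rcases kb with rfl | rfl <;> rcases kc with rfl | rfl <;> tauto
  refine ⟨fun i x hx => ⟨hB.sub i hx.1, hx.2⟩, hne, ?_, fun i j hij x hx hx' =>
    hB.disj i j hij x hx.1 hx'.1, ?_⟩
  · intro i A hA hAne hcl
    by_cases hvi : v ∈ B i
    · by_cases hvA : ∃ y ∈ A, H.Adj v y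
      · obtain ⟨y, hy, hvy⟩ := hvA
        have := hB.conn i (insert v A) ?_ ⟨v, Or.inl rfl⟩ ?_
        · rw [← this]
          ext x
          constructor
          · exact fun hx => ⟨Or.inr hx, (hA hx).2⟩
          · exact fun hx => hx.1.resolve_left hx.2
        · rintro x (rfl | hx)
          · exact hvi
          · exact (hA hx).1
        · rintro x (rfl | hx) z hz hxz
          · by_cases hyz : y = z
            · exact Or.inr (hyz ▸ hy)
            · exact Or.inr (hcl y hy z ⟨hz, hxz.ne'⟩
                (hnbr y (hB.sub i (hA hy).1) z (hB.sub i hz) hvy hxz hyz))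
          · by_cases hzv : z = v
            · exact Or.inl hzv
            · exact Or.inr (hcl x hx z ⟨hz, hzv⟩ hxz)
      · exfalso
        have := hB.conn i A (fun x hx => (hA hx).1) hAne (fun x hx z hz hxz => by
          by_cases hzv : z = v
          · exact absurd ⟨x, hx, (hzv ▸ hxz).symm⟩ hvA
          · exact hcl x hx z ⟨hz, hzv⟩ hxz)
        rw [← this] at hvi
        exact (hA hvi).2 rfl
    · have : B i \ {v} = B i := Set.sdiff_singleton_eq_self hvi
      simp only [this] at hA hcl ⊢
      exact hB.conn i A hA hAne hcl
  · have key : ∀ i j, i ≠ j → v ∈ B i → ∃ x ∈ B i \ {v}, ∃ y ∈ B j \ {v}, H.Adj x y := by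
      intro i j hij hvi
      obtain ⟨x, hx, y, hy, hxy⟩ := hB.adj i j hij
      have hyv : y ≠ v := fun h => hB.disj i j hij v hvi (h ▸ hy)
      by_cases hxv : x = v
      · subst hxv
        obtain ⟨z, hz, hzv, hvz⟩ := hin i hx (hne i)
        exact ⟨z, ⟨hz, hzv⟩, y, ⟨hy, hyv⟩, hnbr z (hB.sub i hz) y (hB.sub j hy) hvz hxy
          (fun h => hB.disj i j hij z hz (h ▸ hy))⟩
      · exact ⟨x, ⟨hx, hxv⟩, y, ⟨hy, hyv⟩, hxy⟩
    intro i j hij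
    by_cases hvi : v ∈ B i
    · exact key i j hij hvi
    by_cases hvj : v ∈ B j
    · obtain ⟨x, hx, y, hy, hxy⟩ := key j i hij.symm hvj
      exact ⟨y, hy, x, hx, hxy.symm⟩
    · obtain ⟨x, hx, y, hy, hxy⟩ := hB.adj i j hij
      exact ⟨x, ⟨hx, fun h => hvi (h ▸ hx)⟩, y, ⟨hy, fun h => hvj (h ▸ hy)⟩, hxy⟩

/-- A graph has no minor `K₄` if it is a subgraph of a graph which can be taken apart by removing,
in order of increasing `rank`, vertices `v` with at most two remaining neighbours `f₁ v`, `f₂ v`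
which are equal or adjacent: a graph of treewidth at most two. The value `v` for one of the two
parents `f₁ v`, `f₂ v` of `v` stands for a missing parent. -/
theorem not_hasMinor_of_parents {V : Type*} [Finite V] (G : SimpleGraph V) (rank : V → ℕ)
    (f₁ f₂ : V → V) (hG : ∀ v w, G.Adj v w → w = f₁ v ∨ w = f₂ v ∨ v = f₁ w ∨ v = f₂ w)
    (h₁ : ∀ v, f₁ v ≠ v → rank v < rank (f₁ v)) (h₂ : ∀ v, f₂ v ≠ v → rank v < rank (f₂ v))
    (h₁₂ : ∀ v, f₁ v ≠ v → f₂ v ≠ v → f₁ v = f₂ v ∨ f₁ v = f₁ (f₂ v) ∨ f₁ v = f₂ (f₂ v) ∨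
      f₂ v = f₁ (f₁ v) ∨ f₂ v = f₂ (f₁ v)) :
    ¬ G.HasMinor (⊤ : SimpleGraph (Fin 4)) := by
  classical
  let H : SimpleGraph V := SimpleGraph.fromRel fun v w => w = f₁ v ∨ w = f₂ v
  have hH : ∀ v w, H.Adj v w ↔ v ≠ w ∧ ((w = f₁ v ∨ w = f₂ v) ∨ v = f₁ w ∨ v = f₂ w) :=
    fun v w => Iff.rfl
  -- remove the vertices of `H` one by one from a model of `K₄`
  have hnone : ∀ n, ∀ (X : Set V) (B : Fin 4 → Set V), X.ncard = n → ¬ IsK4Model H X B := by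
    intro n
    induction n with
    | zero =>
      intro X B hX hB
      obtain ⟨x, hx⟩ := hB.nonempty 0
      have := hB.sub 0 hx
      rw [(Set.ncard_eq_zero (Set.toFinite X)).1 hX] at this
      exact this
    | succ n ih =>
      intro X B hX hB
      have hXne : X.Nonempty := Set.nonempty_of_ncard_ne_zero (by omega)
      obtain ⟨v, hv, hmin⟩ := Set.exists_min_image X rank (Set.toFinite X) hXne
      -- at the vertex `v` of least rank, only the parents are left as neighbours
      have hpar : ∀ y ∈ X, H.Adj v y → y = f₁ v ∨ y = f₂ v := by
        intro y hy hvy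
        rw [hH] at hvy
        obtain ⟨hne, h | h | h⟩ := hvy
        · exact h
        · have := h₁ y (h ▸ hne)
          rw [← h] at this
          exact absurd (hmin y hy) (by omega)
        · have := h₂ y (h ▸ hne)
          rw [← h] at this
          exact absurd (hmin y hy) (by omega)
      have hcard : (X \ {v}).ncard = n := by
        have := Set.ncard_sdiff_singleton_add_one hv (Set.toFinite X)
        omega
      by_cases k1 : f₁ v = v
      · refine ih _ _ hcard (hB.remove (v := v) (p := f₂ v) (q := f₂ v) (Or.inl rfl) ?_)
        intro y hy hvy
        rcases hpar y hy hvy with h | h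
        · exact absurd (h.trans k1) hvy.ne'
        · exact Or.inl h
      by_cases k2 : f₂ v = v
      · refine ih _ _ hcard (hB.remove (v := v) (p := f₁ v) (q := f₁ v) (Or.inl rfl) ?_)
        intro y hy hvy
        rcases hpar y hy hvy with h | h
        · exact Or.inl h
        · exact absurd (h.trans k2) hvy.ne'
      refine ih _ _ hcard (hB.remove (v := v) (p := f₁ v) (q := f₂ v) ?_ hpar)
      by_cases heq : f₁ v = f₂ v
      · exact Or.inl heq
      · right
        rw [hH]
        have := h₁₂ v k1 k2
        tauto
  rintro ⟨B, b1, b2, b3⟩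
  have hGH : ∀ v w, G.Adj v w → H.Adj v w := fun v w h => by
    rw [hH]
    have := hG v w h
    exact ⟨h.ne, by tauto⟩
  refine hnone _ Set.univ B rfl ⟨fun _ => Set.subset_univ _, fun i =>
    (induce_connected_iff.1 (b1 i)).1, fun i A hA hne hcl => ?_, fun i j hij x hx hx' => ?_, ?_⟩
  · exact (induce_connected_iff.1 (b1 i)).2 A hA hne fun x hx y hy hxy =>
      hcl x hx y hy (hGH _ _ hxy)
  · exact Set.disjoint_left.1 (b2 i j hij) hx hx'
  · intro i j hij
    obtain ⟨x, hx, y, hy, hxy⟩ := b3 i j hij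
    exact ⟨x, hx, y, hy, hGH _ _ hxy⟩

/-! ### The medial graph, and its behaviour under cuts and duality -/

/-- The underlying graph of the medial 4-regular map: its vertices are the cycles of `s`, and each
`x` contributes an edge from the cycle of `x` to the cycle of `P x`. -/
def medialGraph {D : Type*} (P s : Perm D) : SimpleGraph (Quotient (SameCycle.setoid s)) :=
  SimpleGraph.fromRel fun u v =>
    ∃ x, Quotient.mk (SameCycle.setoid s) x = u ∧ Quotient.mk (SameCycle.setoid s) (P x) = v

/-- The cycle of `s` which contains `x`, as a vertex of the medial graph. -/
def medialVertex {D : Type*} (s : Perm D) (x : D) : Quotient (SameCycle.setoid s) :=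
  Quotient.mk (SameCycle.setoid s) x

theorem medialGraph_adj {D : Type*} {P s : Perm D} {u v : Quotient (SameCycle.setoid s)} :
    (medialGraph P s).Adj u v ↔ u ≠ v ∧ ((∃ x, medialVertex s x = u ∧ medialVertex s (P x) = v) ∨
      ∃ x, medialVertex s x = v ∧ medialVertex s (P x) = u) := Iff.rfl

theorem medialVertex_surjective {D : Type*} (s : Perm D) : Function.Surjective (medialVertex s) :=
  Quotient.mk_surjective

namespace FixFreeInvol

variable {D : Type*} {s : Perm D}

theorem sameCycle_iff (hs : FixFreeInvol s) {x y : D} : s.SameCycle x y ↔ y = x ∨ y = s x := by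
  constructor
  · rintro ⟨n, rfl⟩
    have h2 : s * s = 1 := Equiv.ext fun x => (hs x).1
    rcases Int.even_or_odd' n with ⟨k, rfl | rfl⟩
    · left
      rw [zpow_mul, show s ^ (2 : ℤ) = 1 by rw [zpow_two, h2], one_zpow, one_apply]
    · right
      rw [zpow_add, zpow_mul, show s ^ (2 : ℤ) = 1 by rw [zpow_two, h2], one_zpow, one_mul, zpow_one]
  · rintro (rfl | rfl)
    · exact SameCycle.refl _ _
    · exact ⟨1, by simp⟩

theorem medialVertex_eq (hs : FixFreeInvol s) {x y : D} :
    medialVertex s x = medialVertex s y ↔ y = x ∨ y = s x := by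
  rw [← hs.sameCycle_iff]
  exact Quotient.eq

theorem medialVertex_apply (hs : FixFreeInvol s) (x : D) :
    medialVertex s (s x) = medialVertex s x :=
  (hs.medialVertex_eq.2 (Or.inr rfl)).symm

theorem adj (hs : FixFreeInvol s) {P : Perm D} {x : D} (h1 : P x ≠ x) (h2 : P x ≠ s x) :
    (medialGraph P s).Adj (medialVertex s x) (medialVertex s (P x)) := by
  rw [medialGraph_adj, Ne, hs.medialVertex_eq]
  exact ⟨by tauto, Or.inl ⟨x, rfl, rfl⟩⟩

theorem restrict [Finite D] (hs : FixFreeInvol s) {S : Set D} (h : ∀ x ∈ S, s x ∈ S) :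
    FixFreeInvol (restrictPerm s h) := fun x =>
  ⟨Subtype.ext (hs x).1, fun hh => (hs x).2 (congrArg Subtype.val hh)⟩

end FixFreeInvol

/-- The properties of `P`, `s` that correspond to connected spherical `K₄`-minor-free 4-regular
maps. -/
structure Good {D : Type*} (P s : Perm D) : Prop where
  inv : FixFreeInvol s
  conn : PermConnected P s
  planar : Planar P s
  free : ¬ (medialGraph P s).HasMinor (⊤ : SimpleGraph (Fin 4))

/-- The medial graph has no 2-edge-cut. -/
def NoCut {D : Type*} (P s : Perm D) : Prop :=
  ∀ S e, ¬ OneOut P s S e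

theorem OneOut.free {D : Type*} [Finite D] [DecidableEq D] {P s : Perm D} {S : Set D} {e f : D}
    (h : OneOut P s S e) (h' : OneOut P s Sᶜ f) (hs : FixFreeInvol s) (hc : PermConnected P s)
    (hfree : ¬ (medialGraph P s).HasMinor (⊤ : SimpleGraph (Fin 4))) :
    ¬ (medialGraph (restrictPerm (P * swap e f) (h.cut_closed h'))
      (restrictPerm s h.closed)).HasMinor (⊤ : SimpleGraph (Fin 4)) := by
  classical
  set s₁ := restrictPerm s h.closed with hs₁
  have hi₁ : FixFreeInvol s₁ := hs.restrict h.closed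
  -- contract the complement of `S` into the vertex of `e`
  let g₀ : D → Quotient (SameCycle.setoid s₁) := fun x =>
    if hx : x ∈ S then medialVertex s₁ ⟨x, hx⟩ else medialVertex s₁ ⟨e, h.mem⟩
  have hg₀s : ∀ x, g₀ (s x) = g₀ x := by
    intro x
    by_cases hx : x ∈ S
    · simp only [g₀, dif_pos hx, dif_pos (h.closed x hx)]
      exact hi₁.medialVertex_apply ⟨x, hx⟩
    · simp only [g₀, dif_neg hx, dif_neg (h'.closed x hx)]
  let g : Quotient (SameCycle.setoid s) → Quotient (SameCycle.setoid s₁) :=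
    Quotient.lift g₀ (by
      intro x y hxy
      rcases hs.sameCycle_iff.1 hxy with rfl | rfl
      · rfl
      · exact (hg₀s x).symm)
  have hgin : ∀ x (hx : x ∈ S), g (medialVertex s x) = medialVertex s₁ ⟨x, hx⟩ :=
    fun x hx => dif_pos hx
  have hgout : ∀ x, x ∉ S → g (medialVertex s x) = medialVertex s₁ ⟨e, h.mem⟩ :=
    fun x hx => dif_neg hx
  refine fun hm => hfree (SimpleGraph.HasMinor.of_contraction g ?_ ?_ hm)
  · -- fibres
    have hpre : ∀ x : S, ∀ v, g v = medialVertex s₁ x →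
        v = medialVertex s (x : D) ∨ (∃ y, y ∉ S ∧ v = medialVertex s y ∧
          medialVertex s₁ x = medialVertex s₁ ⟨e, h.mem⟩) := by
      intro x v hv
      obtain ⟨y, rfl⟩ := medialVertex_surjective s v
      by_cases hy : y ∈ S
      · left
        rw [hgin y hy, hi₁.medialVertex_eq] at hv
        rw [hs.medialVertex_eq]
        exact hv.imp (congrArg Subtype.val) (congrArg Subtype.val)
      · exact Or.inr ⟨y, hy, rfl, by rw [← hv, hgout y hy]⟩
    intro w
    obtain ⟨x, rfl⟩ := medialVertex_surjective s₁ w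
    by_cases hx : medialVertex s₁ x = medialVertex s₁ ⟨e, h.mem⟩
    · rw [hx, induce_connected_iff]
      have hmem : ∀ v, v ∈ g ⁻¹' {medialVertex s₁ ⟨e, h.mem⟩} ↔
          v = medialVertex s e ∨ ∃ y, y ∉ S ∧ v = medialVertex s y := by
        intro v
        constructor
        · intro hv
          rcases hpre ⟨e, h.mem⟩ v hv with h1 | ⟨y, h1, h2, _⟩
          · exact Or.inl h1
          · exact Or.inr ⟨y, h1, h2⟩
        · rintro (rfl | ⟨y, hy, rfl⟩)
          · exact hgin e h.mem
          · exact hgout y hy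
      -- a closed part of the fibre which contains the vertex of `e` is the whole fibre
      have key : ∀ A ⊆ g ⁻¹' {medialVertex s₁ ⟨e, h.mem⟩}, medialVertex s e ∈ A →
          (∀ x ∈ A, ∀ y ∈ g ⁻¹' {medialVertex s₁ ⟨e, h.mem⟩}, (medialGraph P s).Adj x y → y ∈ A) →
          A = g ⁻¹' {medialVertex s₁ ⟨e, h.mem⟩} := by
        intro A hA heA hcl
        have hT := hc {y | ¬ (y ∉ S ∧ medialVertex s y ∉ A)} ⟨e, fun hh => hh.1 h.mem⟩ ?_ ?_
        · refine hA.antisymm fun v hv => ?_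
          rcases (hmem v).1 hv with rfl | ⟨y, hy, rfl⟩
          · exact heA
          · by_contra hyA
            have : y ∈ {y | ¬ (y ∉ S ∧ medialVertex s y ∉ A)} := hT ▸ Set.mem_univ y
            exact this ⟨hy, hyA⟩
        · rintro y hy ⟨h1, h2⟩
          have hyA : medialVertex s y ∈ A := by
            by_cases hyS : y ∈ S
            · by_cases hye : y = e
              · exact hye ▸ heA
              · exact absurd (h.stay y hyS hye) h1
            · by_contra hyA
              exact hy ⟨hyS, hyA⟩
          by_cases heq : medialVertex s y = medialVertex s (P y)
          · exact h2 (heq ▸ hyA)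
          · exact h2 (hcl _ hyA _ ((hmem _).2 (Or.inr ⟨_, h1, rfl⟩))
              ⟨heq, Or.inl ⟨y, rfl, rfl⟩⟩)
        · rintro y hy ⟨h1, h2⟩
          rw [hs.medialVertex_apply] at h2
          exact hy ⟨fun hyS => h1 (h.closed y hyS), h2⟩
      refine ⟨⟨_, (hmem _).2 (Or.inl rfl)⟩, fun A hA hne hcl => ?_⟩
      by_cases heA : medialVertex s e ∈ A
      · exact key A hA heA hcl
      · exfalso
        have := key (g ⁻¹' {medialVertex s₁ ⟨e, h.mem⟩} \ A) Set.sdiff_subset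
          ⟨(hmem _).2 (Or.inl rfl), heA⟩ (fun x hx y hy hxy =>
            ⟨hy, fun hyA => hx.2 (hcl y hyA x hx.1 hxy.symm)⟩)
        obtain ⟨a, ha⟩ := hne
        have ha' := hA ha
        rw [← this] at ha'
        exact ha'.2 ha
    · apply induce_connected_of_star (v := medialVertex s (x : D))
      · exact hgin x x.2
      · intro v hv hne
        rcases hpre x v hv with h1 | ⟨_, _, _, h3⟩
        · exact absurd h1 hne
        · exact absurd h3 hx
  · -- edges
    have key : ∀ x : S, ∃ u v, g u = medialVertex s₁ x ∧
        g v = medialVertex s₁ (restrictPerm (P * swap e f) (h.cut_closed h') x) ∧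
        (u = v ∨ (medialGraph P s).Adj u v) := by
      have hval : ∀ x : S, (restrictPerm (P * swap e f) (h.cut_closed h') x : D) =
          P (swap e f x) := fun _ => rfl
      rintro ⟨x, hx⟩
      have hxf : x ≠ f := by rintro rfl; exact h'.mem hx
      have haux : ∀ z, medialVertex s z = medialVertex s (P z) ∨
          (medialGraph P s).Adj (medialVertex s z) (medialVertex s (P z)) := by
        intro z
        by_cases heq : medialVertex s z = medialVertex s (P z)
        · exact Or.inl heq
        · exact Or.inr ⟨heq, Or.inl ⟨z, rfl, rfl⟩⟩
      have hPx := (restrictPerm (P * swap e f) (h.cut_closed h') ⟨x, hx⟩).2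
      by_cases hxe : x = e
      · subst hxe
        refine ⟨medialVertex s f, medialVertex s (P f), hgout f h'.mem, ?_, haux f⟩
        have hv := hval ⟨x, hx⟩
        rw [swap_apply_left] at hv
        rw [hgin (P f) (hv ▸ hPx)]
        congr 1
        exact Subtype.ext hv.symm
      · refine ⟨medialVertex s x, medialVertex s (P x), hgin x hx, ?_, haux x⟩
        have hv := hval ⟨x, hx⟩
        rw [swap_apply_of_ne_of_ne hxe hxf] at hv
        rw [hgin (P x) (hv ▸ hPx)]
        congr 1
        exact Subtype.ext hv.symm
    intro w w' hww
    rw [medialGraph_adj] at hww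
    obtain ⟨hne, ⟨x, rfl, rfl⟩ | ⟨x, rfl, rfl⟩⟩ := hww
    · obtain ⟨u, v, h1, h2, h3⟩ := key x
      refine ⟨u, v, h1, h2, h3.resolve_left ?_⟩
      rintro rfl
      exact hne (h1.symm.trans h2)
    · obtain ⟨u, v, h1, h2, h3⟩ := key x
      refine ⟨v, u, h2, h1, (h3.resolve_left ?_).symm⟩
      rintro rfl
      exact hne (h2.symm.trans h1)

theorem OneOut.good {D : Type*} [Finite D] [DecidableEq D] {P s : Perm D} {S : Set D} {e f : D}
    (h : OneOut P s S e) (h' : OneOut P s Sᶜ f) (hg : Good P s) :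
    Good (restrictPerm (P * swap e f) (h.cut_closed h')) (restrictPerm s h.closed) :=
  ⟨hg.inv.restrict _, h.cut_connected h' hg.conn, h.cut_planar h' hg.inv hg.conn hg.planar,
    h.free h' hg.inv hg.conn hg.free⟩

section Duality

variable {D : Type*} {P s : Perm D}

theorem FixFreeInvol.mul_mul_cancel (hs : FixFreeInvol s) : P * s * s = P :=
  Equiv.ext fun x => congrArg P (hs x).1

theorem OneOut.of_dual (hs : FixFreeInvol s) {S : Set D} {e : D} (h : OneOut (P * s) s S e) :
    OneOut P s S (s e) where
  closed := h.closed
  mem := h.closed e h.mem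
  out := h.out
  stay x hx hxe := by
    have := h.stay (s x) (h.closed x hx) (fun hh => hxe (by rw [← hh, (hs x).1]))
    rwa [mul_apply, (hs x).1] at this

theorem NoCut.dual (hs : FixFreeInvol s) (h : NoCut P s) : NoCut (P * s) s :=
  fun S _ hS => h S _ (hS.of_dual hs)

theorem medialGraph_dual (hs : FixFreeInvol s) : medialGraph (P * s) s = medialGraph P s := by
  have key : ∀ u v, (∃ x, medialVertex s x = u ∧ medialVertex s ((P * s) x) = v) ↔
      ∃ x, medialVertex s x = u ∧ medialVertex s (P x) = v := by
    intro u v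
    constructor
    · rintro ⟨x, rfl, rfl⟩
      exact ⟨s x, hs.medialVertex_apply x, rfl⟩
    · rintro ⟨x, rfl, rfl⟩
      exact ⟨s x, hs.medialVertex_apply x, by rw [mul_apply, (hs x).1]⟩
  ext u v
  rw [medialGraph_adj, medialGraph_adj, key, key]

theorem Good.dual (h : Good P s) : Good (P * s) s where
  inv := h.inv
  conn := by
    intro A hA hP hs
    refine h.conn A hA (fun x hx => ?_) hs
    have := hP (s x) (hs x hx)
    rwa [mul_apply, (h.inv x).1] at this
  planar := by
    have := h.planar
    unfold Planar at this ⊢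
    rw [h.inv.mul_mul_cancel]
    omega
  free := by
    rw [medialGraph_dual h.inv]
    exact h.free

end Duality

/-! ### Maps without 2-edge-cuts -/

section NoCut

variable {D : Type*} [Finite D] {P s : Perm D}

omit [Finite D] in
/-- A loop of the medial graph makes a 2-edge-cut, unless it is attached to the only vertex. -/
theorem NoCut.eq_of_loop (hc : PermConnected P s) (hs : FixFreeInvol s) (hn : NoCut P s) {x : D}
    (hx : P x = x ∨ P x = s x) : ∀ y, y = x ∨ y = s x := by
  -- the darts other than `x` at its vertex reduce to one, call it `z`
  obtain ⟨z, hz, hmem⟩ : ∃ z, (z = x ∨ z = s x) ∧ ∀ y, (y = x ∨ y = s x) → y ≠ z →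
      (P y = x ∨ P y = s x) := by
    refine ⟨s x, Or.inr rfl, ?_⟩
    rintro y (rfl | rfl) h
    · exact hx
    · exact absurd rfl h
  have hcl : ∀ y ∈ {y | y = x ∨ y = s x}, s y ∈ {y | y = x ∨ y = s x} := by
    rintro y (rfl | rfl)
    · exact Or.inr rfl
    · exact Or.inl (hs x).1
  by_cases hPz : P z = x ∨ P z = s x
  · have := hc {y | y = x ∨ y = s x} ⟨x, Or.inl rfl⟩ ?_ hcl
    · intro y
      have hy : y ∈ {y | y = x ∨ y = s x} := this ▸ Set.mem_univ y
      exact hy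
    · intro y hy
      by_cases hyz : y = z
      · exact hyz ▸ hPz
      · exact hmem y hy hyz
  · exact absurd ⟨hcl, hz, hPz, hmem⟩ (hn {y | y = x ∨ y = s x} z)

theorem NoCut.not_sameCycle (hg : Good P s) (hn : NoCut P s) {x : D} (hx : P x ≠ s x) :
    ¬ P.SameCycle x (s x) := by
  intro h
  have hg1 : x ≠ P⁻¹ (s x) := fun hh => hx (by rw [eq_inv_iff_eq] at hh; exact hh)
  obtain ⟨S, hS, _⟩ := exists_oneOut hg.inv hg.conn hg.planar hg1
    (h.trans ⟨-1, by simp⟩) (SameCycle.symm ⟨1, by simp [(hg.inv _).1]⟩)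
  exact hn S x hS

/-- In the absence of 2-edge-cuts there is a face of degree two in the medial map. -/
theorem NoCut.exists_bigon [Nonempty D] (hg : Good P s) (hn : NoCut P s)
    (h1 : ∀ x, P x ≠ x ∧ P x ≠ s x) :
    (∃ e, P (P e) = e) ∨ ∃ e, (P * s) ((P * s) e) = e := by
  have hs := hg.inv
  have hnot : ∀ x, ¬ P.SameCycle x (s x) := fun x => hn.not_sameCycle hg (h1 x).2
  obtain ⟨v, a, b, hv⟩ : ∃ v a b, ∀ x, (medialGraph P s).Adj v x → x = a ∨ x = b := by
    by_contra! hcon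
    have : Nonempty (Quotient (SameCycle.setoid s)) := ⟨medialVertex s (Classical.arbitrary D)⟩
    refine hg.free (hasMinor_of_three_le_degree _ rfl _ fun v a b => ?_)
    obtain ⟨x, k1, k2⟩ := hcon v a b
    exact ⟨x, k1, k2.1, k2.2⟩
  obtain ⟨e, rfl⟩ := medialVertex_surjective s v
  have out : ∀ x, medialVertex s x = medialVertex s e →
      medialVertex s (P x) = a ∨ medialVertex s (P x) = b := by
    intro x hx
    refine hv _ ?_
    rw [← hx]
    exact hs.adj (h1 x).1 (h1 x).2
  have inn : ∀ x, medialVertex s (P x) = medialVertex s e →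
      medialVertex s x = a ∨ medialVertex s x = b := by
    intro x hx
    refine hv _ ?_
    rw [← hx]
    exact (hs.adj (h1 x).1 (h1 x).2).symm
  have hes := hs.medialVertex_apply e
  -- the four neighbours of the vertex of `e`
  obtain ⟨g, hg0⟩ : ∃ g, P g = e := P.surjective e
  obtain ⟨g', hg'⟩ : ∃ g, P g = s e := P.surjective (s e)
  have k1 := out e rfl
  have k2 := out (s e) hes
  have k3 := inn g (by rw [hg0])
  have k4 := inn g' (by rw [hg', hes])
  have c13 : medialVertex s g = medialVertex s (P e) → P (P e) = e := by
    intro h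
    rcases hs.medialVertex_eq.1 h with h | h
    · rw [h, hg0]
    · exact absurd (SameCycle.trans (y := e) ⟨1, by simp [hg0]⟩ ⟨1, by simp [h]⟩) (hnot g)
  have c24 : medialVertex s g' = medialVertex s (P (s e)) → P (P (s e)) = s e := by
    intro h
    rcases hs.medialVertex_eq.1 h with h | h
    · rw [h, hg']
    · exact absurd (SameCycle.trans (y := s e) ⟨1, by simp [hg']⟩ ⟨1, by simp [h]⟩) (hnot g')
  have c14 : medialVertex s g' = medialVertex s (P e) → (P * s) ((P * s) (P e)) = P e := by
    intro h
    rcases hs.medialVertex_eq.1 h with h | h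
    · refine absurd (SameCycle.trans (y := P e) ⟨1, by simp⟩ ⟨1, ?_⟩) (hnot e)
      rw [zpow_one, h, hg']
    · simp only [mul_apply]
      rw [h, (hs g').1, hg', (hs e).1, h]
  have c23 : medialVertex s g = medialVertex s (P (s e)) →
      (P * s) ((P * s) (P (s e))) = P (s e) := by
    intro h
    rcases hs.medialVertex_eq.1 h with h | h
    · refine absurd (SameCycle.trans (y := P (s e)) ⟨1, by simp⟩ ⟨1, ?_⟩) (hnot (s e))
      rw [zpow_one, h, hg0, (hs e).1]
    · simp only [mul_apply]
      rw [h, (hs g).1, hg0, h]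
  by_cases e13 : medialVertex s g = medialVertex s (P e)
  · exact Or.inl ⟨e, c13 e13⟩
  by_cases e24 : medialVertex s g' = medialVertex s (P (s e))
  · exact Or.inl ⟨s e, c24 e24⟩
  by_cases e14 : medialVertex s g' = medialVertex s (P e)
  · exact Or.inr ⟨_, c14 e14⟩
  by_cases e23 : medialVertex s g = medialVertex s (P (s e))
  · exact Or.inr ⟨_, c23 e23⟩
  -- the two edges to the one neighbour are separated by those to the other
  exfalso
  have e12 : medialVertex s (P (s e)) = medialVertex s (P e) := by
    rcases k1 with k1 | k1 <;> rcases k2 with k2 | k2 <;> rcases k3 with k3 | k3 <;>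
      simp_all
  have e34 : medialVertex s g' = medialVertex s g := by
    rcases k1 with k1 | k1 <;> rcases k4 with k4 | k4 <;> rcases k3 with k3 | k3 <;>
      simp_all
  have h12 : s (P e) = P (s e) := by
    rcases hs.medialVertex_eq.1 e12 with h | h
    · exact absurd (P.injective h).symm (hs e).2
    · rw [h, (hs _).1]
  have h34 : s g' = g := by
    rcases hs.medialVertex_eq.1 e34 with h | h
    · rw [← h, hg0] at hg'
      exact absurd hg'.symm (hs e).2
    · exact h.symm
  have hgf : g ≠ P e := fun h => e13 (by rw [h])
  obtain ⟨S, hS, _⟩ := exists_oneOut hs hg.conn hg.planar hgf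
    (SameCycle.trans (y := e) ⟨1, by simp [hg0]⟩ ⟨1, by simp⟩)
    (SameCycle.trans (y := e) ⟨1, by simp [(hs g).1, hg0]⟩ ⟨1, by simp [h12]⟩)
  exact hn S _ hS

end NoCut

theorem cyc_eq_one {α : Type*} {f : Perm α} (a : α) (h : ∀ x, f.SameCycle a x) : cyc f = 1 := by
  unfold cyc
  rw [Nat.card_eq_one_iff_unique]
  refine ⟨⟨fun x y => ?_⟩, ⟨Quotient.mk _ a⟩⟩
  induction x using Quotient.inductionOn with | _ x => ?_
  induction y using Quotient.inductionOn with | _ y => ?_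
  exact Quotient.sound ((h x).symm.trans (h y))

/-- The situation in which `{e, P e}` is a cycle of `P` of length two, with different edges `e`
and `P e`: a face of degree two of the medial map. Contracting it means to delete `e` and `P e` and
to join the remaining halves of their edges. -/
structure Bigon {D : Type*} (P s : Perm D) (e : D) : Prop where
  back : P (P e) = e
  ne : P e ≠ e
  ne' : P e ≠ s e

namespace Bigon

variable {D : Type*} [Finite D] [DecidableEq D] {P s : Perm D} {e : D}

/-- The complement of the two darts of a bigon. -/
def rest (P : Perm D) (e : D) : Set D := {x | x ≠ e ∧ x ≠ P e}

omit [Finite D] [DecidableEq D] in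
theorem perm_closed (h : Bigon P s e) : ∀ x ∈ rest P e, P x ∈ rest P e := fun _ hx =>
  ⟨fun hh => hx.2 (P.injective (hh.trans h.back.symm)), fun hh => hx.1 (P.injective hh)⟩

/-- The edges after the contraction of a bigon, and one more edge `{e, P e}`. -/
def edges (P s : Perm D) (e : D) : Perm D := swap e (s (P e)) * s * swap e (s (P e))

variable (h : Bigon P s e) (hs : FixFreeInvol s)

include h hs

omit [Finite D] [DecidableEq D] in
theorem ne_s : s (P e) ≠ e := fun hh => h.ne' (by rw [← hh, (hs _).1, hh])

omit [Finite D] in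
theorem edges_self : edges P s e e = P e := by
  simp only [edges, mul_apply, swap_apply_left, (hs _).1]
  exact swap_apply_of_ne_of_ne h.ne (hs _).2.symm

omit [Finite D] in
theorem edges_apply : edges P s e (P e) = e := by
  simp only [edges, mul_apply]
  rw [swap_apply_of_ne_of_ne h.ne (hs _).2.symm, swap_apply_right]

omit [Finite D] in
theorem edges_s_self : edges P s e (s e) = s (P e) := by
  simp only [edges, mul_apply]
  rw [swap_apply_of_ne_of_ne (hs _).2 (fun hh => h.ne (s.injective hh).symm), (hs _).1,
    swap_apply_left]

omit [Finite D] in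
theorem edges_s_apply : edges P s e (s (P e)) = s e := by
  simp only [edges, mul_apply]
  rw [swap_apply_right]
  exact swap_apply_of_ne_of_ne (hs _).2 (fun hh => h.ne (s.injective hh).symm)

omit h [Finite D] in
theorem edges_of_ne {x : D} (h1 : x ≠ e) (h2 : x ≠ P e) (h3 : x ≠ s e) (h4 : x ≠ s (P e)) :
    edges P s e x = s x := by
  simp only [edges, mul_apply]
  rw [swap_apply_of_ne_of_ne h1 h4, swap_apply_of_ne_of_ne]
  · exact fun hh => h3 (by rw [← hh, (hs _).1])
  · exact fun hh => h2 (s.injective hh)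

omit [Finite D] in
theorem edges_closed : ∀ x ∈ rest P e, edges P s e x ∈ rest P e := by
  intro x hx
  have hne := h.ne_s hs
  by_cases h3 : x = s e
  · subst h3
    rw [h.edges_s_self hs]
    exact ⟨hne, (hs _).2⟩
  by_cases h4 : x = s (P e)
  · subst h4
    rw [h.edges_s_apply hs]
    exact ⟨(hs _).2, fun hh => h.ne' hh.symm⟩
  rw [edges_of_ne hs hx.1 hx.2 h3 h4]
  exact ⟨fun hh => h3 (by rw [← hh, (hs _).1]), fun hh => h4 (by rw [← hh, (hs _).1])⟩

omit h [Finite D] in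
theorem edges_fixFree : FixFreeInvol (edges P s e) := by
  intro x
  constructor
  · simp only [edges, mul_apply, swap_apply_self, (hs _).1]
  · intro hh
    simp only [edges, mul_apply] at hh
    rw [swap_apply_eq_iff] at hh
    exact (hs _).2 hh

omit [Finite D] [DecidableEq D] in
theorem s_mem : s e ∈ rest P e := ⟨(hs e).2, fun hh => h.ne' hh.symm⟩

omit [Finite D] [DecidableEq D] in
theorem s_apply_mem : s (P e) ∈ rest P e := ⟨h.ne_s hs, (hs _).2⟩

theorem connected (hc : PermConnected P s) :
    PermConnected (restrictPerm P h.perm_closed) (restrictPerm _ (h.edges_closed hs)) := by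
  intro A hA hP hE
  have hmem : ∀ x ∈ A, ∀ y (hy : y ∈ rest P e), y = edges P s e x → (⟨y, hy⟩ : rest P e) ∈ A := by
    rintro x hx y hy rfl
    exact hE x hx
  have := hc {x | (∃ hx : x ∈ rest P e, (⟨x, hx⟩ : rest P e) ∈ A) ∨
    ((x = e ∨ x = P e) ∧ ⟨s e, h.s_mem hs⟩ ∈ A)} ?_ ?_ ?_
  · ext x
    refine ⟨fun _ => trivial, fun _ => ?_⟩
    have hx : (x : D) ∈ _ := this ▸ Set.mem_univ (x : D)
    rcases hx with ⟨_, hx⟩ | ⟨hx | hx, _⟩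
    · exact hx
    · exact absurd hx x.2.1
    · exact absurd hx x.2.2
  · obtain ⟨a, ha⟩ := hA
    exact ⟨a, Or.inl ⟨a.2, ha⟩⟩
  · rintro x (⟨hx, hxA⟩ | ⟨rfl | rfl, hxA⟩)
    · exact Or.inl ⟨_, hP _ hxA⟩
    · exact Or.inr ⟨Or.inr rfl, hxA⟩
    · exact Or.inr ⟨Or.inl h.back, hxA⟩
  · rintro x (⟨hx, hxA⟩ | ⟨rfl | rfl, hxA⟩)
    · by_cases h3 : x = s e
      · subst h3
        exact Or.inr ⟨Or.inl (hs e).1, hxA⟩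
      by_cases h4 : x = s (P e)
      · subst h4
        refine Or.inr ⟨Or.inr (hs _).1, hmem _ hxA _ _ ?_⟩
        rw [h.edges_s_apply hs]
      have hsx := h.edges_closed hs x hx
      rw [edges_of_ne hs hx.1 hx.2 h3 h4] at hsx
      exact Or.inl ⟨hsx, hmem _ hxA _ _ (edges_of_ne hs hx.1 hx.2 h3 h4).symm⟩
    · exact Or.inl ⟨_, hxA⟩
    · exact Or.inl ⟨h.s_apply_mem hs, hmem _ hxA _ _ (h.edges_s_self hs).symm⟩

theorem planar (hp : Planar P s) :
    Planar (restrictPerm P h.perm_closed) (restrictPerm _ (h.edges_closed hs)) := by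
  have hPc := h.perm_closed
  have hEc := h.edges_closed hs
  have hPEc : ∀ x ∈ rest P e, (P * edges P s e) x ∈ rest P e := fun x hx => hPc _ (hEc x hx)
  have d1 := cyc_eq_restrict_add P hPc (compl_closed hPc)
  have d2 := cyc_eq_restrict_add _ hEc (compl_closed hEc)
  have d3 := cyc_eq_restrict_add _ hPEc (compl_closed hPEc)
  have hco : ∀ x, x ∈ (rest P e)ᶜ ↔ x = e ∨ x = P e := by
    intro x
    simp only [rest, Set.mem_compl_iff, Set.mem_ofPred_eq]
    tauto
  have he : e ∈ (rest P e)ᶜ := (hco e).2 (Or.inl rfl)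
  have hf : P e ∈ (rest P e)ᶜ := (hco _).2 (Or.inr rfl)
  have o1 : cyc (restrictPerm P (compl_closed hPc)) = 1 := by
    refine cyc_eq_one ⟨e, he⟩ ?_
    rintro ⟨x, hx⟩
    rcases (hco x).1 hx with rfl | rfl
    · exact SameCycle.refl _ _
    · exact ⟨1, by rw [zpow_one]; rfl⟩
  have o2 : cyc (restrictPerm _ (compl_closed hEc)) = 1 := by
    refine cyc_eq_one ⟨e, he⟩ ?_
    rintro ⟨x, hx⟩
    rcases (hco x).1 hx with rfl | rfl
    · exact SameCycle.refl _ _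
    · exact ⟨1, by rw [zpow_one]; exact Subtype.ext (h.edges_self hs)⟩
  have hcard2 : Nat.card ((rest P e)ᶜ : Set D) = 2 := by
    have : (rest P e)ᶜ = {e, P e} := by
      ext x
      exact hco x
    rw [this, Nat.card_coe_set_eq, Set.ncard_pair h.ne.symm]
  have o3 : cyc (restrictPerm _ (compl_closed hPEc)) = 2 := by
    have : restrictPerm _ (compl_closed hPEc) = 1 := by
      ext ⟨x, hx⟩
      rcases (hco x).1 hx with rfl | rfl
      · exact (congrArg P (h.edges_self hs)).trans h.back
      · exact congrArg P (h.edges_apply hs)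
    rw [this, cyc_one, hcard2]
  have c2 : cyc (edges P s e) = cyc s := by
    refine cyc_eq_of_equiv (swap e (s (P e))) fun x => ?_
    simp [edges]
  -- the faces gain the two fixed points `e` and `P e`
  have c3 : cyc (P * edges P s e) = cyc (P * s) + 2 := by
    have e1 : P * edges P s e = P * s * swap (s e) (P e) * swap e (s (P e)) := by
      have : edges P s e = s * swap (s e) (P e) * swap e (s (P e)) := by
        rw [edges, mul_swap_eq_swap_mul s (s e) (P e), (hs e).1]
      rw [this]
      simp only [mul_assoc]
    have hne : s e ≠ P e := h.ne'.symm
    have a1 := cyc_mul_swap_of_sameCycle (f := P * s) hne ⟨1, by simp [(hs e).1]⟩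
    have a2 := cyc_mul_swap_of_sameCycle (f := P * s * swap (s e) (P e)) (a := e) (b := s (P e))
      (h.ne_s hs).symm (SameCycle.symm ⟨1, by
        rw [zpow_one, mul_apply, swap_apply_of_ne_of_ne, mul_apply, (hs _).1, h.back]
        · exact fun hh => h.ne (s.injective hh)
        · exact (hs _).2⟩)
    rw [e1]
    omega
  have hcard : Nat.card (rest P e) + 2 = Nat.card D := by
    rw [← hcard2, ← Nat.card_sum]
    classical
    have := Fintype.ofFinite D
    exact Nat.card_congr (Equiv.Set.sumCompl _)
  unfold Planar at hp ⊢
  change _ + _ + cyc (restrictPerm _ hPEc) = _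
  omega

theorem noCut (hn : NoCut P s) :
    NoCut (restrictPerm P h.perm_closed) (restrictPerm _ (h.edges_closed hs)) := by
  intro A a hA
  have hmem : ∀ x ∈ A, ∀ y (hy : y ∈ rest P e), y = edges P s e x → (⟨y, hy⟩ : rest P e) ∈ A := by
    rintro x hx y hy rfl
    exact hA.closed x hx
  refine hn {x | (∃ hx : x ∈ rest P e, (⟨x, hx⟩ : rest P e) ∈ A) ∨
    ((x = e ∨ x = P e) ∧ ⟨s e, h.s_mem hs⟩ ∈ A)} a ⟨?_, Or.inl ⟨a.2, hA.mem⟩, ?_, ?_⟩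
  · rintro x (⟨hx, hxA⟩ | ⟨rfl | rfl, hxA⟩)
    · by_cases h3 : x = s e
      · subst h3
        exact Or.inr ⟨Or.inl (hs e).1, hxA⟩
      by_cases h4 : x = s (P e)
      · subst h4
        refine Or.inr ⟨Or.inr (hs _).1, hmem _ hxA _ _ ?_⟩
        rw [h.edges_s_apply hs]
      have hsx := h.edges_closed hs x hx
      rw [edges_of_ne hs hx.1 hx.2 h3 h4] at hsx
      exact Or.inl ⟨hsx, hmem _ hxA _ _ (edges_of_ne hs hx.1 hx.2 h3 h4).symm⟩
    · exact Or.inl ⟨_, hxA⟩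
    · exact Or.inl ⟨h.s_apply_mem hs, hmem _ hxA _ _ (h.edges_s_self hs).symm⟩
  · have hPa := h.perm_closed a a.2
    rintro (⟨hx, hxA⟩ | ⟨hx | hx, _⟩)
    · exact hA.out hxA
    · exact hPa.1 hx
    · exact hPa.2 hx
  · rintro x (⟨hx, hxA⟩ | ⟨rfl | rfl, hxA⟩) hne
    · exact Or.inl ⟨_, hA.stay _ hxA (fun hh => hne (congrArg Subtype.val hh))⟩
    · exact Or.inr ⟨Or.inr rfl, hxA⟩
    · exact Or.inr ⟨Or.inl h.back, hxA⟩

theorem free (hfree : ¬ (medialGraph P s).HasMinor (⊤ : SimpleGraph (Fin 4))) :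
    ¬ (medialGraph (restrictPerm P h.perm_closed)
      (restrictPerm _ (h.edges_closed hs))).HasMinor (⊤ : SimpleGraph (Fin 4)) := by
  classical
  set E := restrictPerm _ (h.edges_closed hs) with hE
  have hEi : FixFreeInvol E := (edges_fixFree hs).restrict _
  -- `g` contracts the vertices of `e` and of `P e`, which are adjacent, to the vertex `m`
  let m : Quotient (SameCycle.setoid E) := medialVertex E ⟨s e, h.s_mem hs⟩
  let g₀ : D → Quotient (SameCycle.setoid E) := fun x =>
    if hx : x ∈ rest P e then medialVertex E ⟨x, hx⟩ else m
  have hin : ∀ x (hx : x ∈ rest P e), g₀ x = medialVertex E ⟨x, hx⟩ := fun x hx => dif_pos hx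
  have hout : ∀ x, x ∉ rest P e → g₀ x = m := fun x hx => dif_neg hx
  have hm' : g₀ (s (P e)) = m := by
    rw [hin _ (h.s_apply_mem hs), ← hEi.medialVertex_apply]
    congr 1
    exact Subtype.ext (h.edges_s_apply hs)
  have hm : g₀ (s e) = m := hin _ (h.s_mem hs)
  have he : g₀ e = m := hout e fun hh => hh.1 rfl
  have hf : g₀ (P e) = m := hout _ fun hh => hh.2 rfl
  have hgs : ∀ x, g₀ (s x) = g₀ x := by
    intro x
    by_cases h1 : x = e
    · rw [h1, hm, he]
    by_cases h2 : x = P e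
    · rw [h2, hm', hf]
    by_cases h3 : x = s e
    · rw [h3, (hs e).1, hm, he]
    by_cases h4 : x = s (P e)
    · rw [h4, (hs _).1, hm', hf]
    have hx : x ∈ rest P e := ⟨h1, h2⟩
    have hsx := edges_of_ne hs h1 h2 h3 h4
    have hx' : s x ∈ rest P e := hsx ▸ h.edges_closed hs x hx
    rw [hin x hx, hin _ hx', ← hEi.medialVertex_apply ⟨x, hx⟩]
    congr 1
    exact Subtype.ext hsx.symm
  let g : Quotient (SameCycle.setoid s) → Quotient (SameCycle.setoid E) :=
    Quotient.lift g₀ (by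
      intro x y hxy
      rcases hs.sameCycle_iff.1 hxy with rfl | rfl
      · rfl
      · exact (hgs x).symm)
  have hg : ∀ x, g (medialVertex s x) = g₀ x := fun _ => rfl
  have hfib : ∀ x (hx : x ∈ rest P e), ∀ y, g₀ y = medialVertex E ⟨x, hx⟩ →
      medialVertex s y = medialVertex s x ∨
        (medialVertex E ⟨x, hx⟩ = m ∧ (medialVertex s y = medialVertex s e ∨
          medialVertex s y = medialVertex s (P e))) := by
    intro x hx y hy
    by_cases hyr : y ∈ rest P e
    · rw [hin y hyr, hEi.medialVertex_eq] at hy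
      rcases hy with hy | hy
      · left
        rw [show x = y from congrArg Subtype.val hy]
      · have hxy : x = edges P s e y := congrArg Subtype.val hy
        have hyx : medialVertex E ⟨x, hx⟩ = medialVertex E ⟨y, hyr⟩ := by
          rw [hy]
          exact hEi.medialVertex_apply _
        by_cases h3 : y = s e
        · right
          refine ⟨by rw [hyx, ← hin, h3, hm], Or.inl ?_⟩
          rw [h3, hs.medialVertex_apply]
        by_cases h4 : y = s (P e)
        · right
          refine ⟨by rw [hyx, ← hin, h4, hm'], Or.inr ?_⟩
          rw [h4, hs.medialVertex_apply]
        left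
        rw [hxy, edges_of_ne hs hyr.1 hyr.2 h3 h4, hs.medialVertex_apply]
    · right
      rw [hout y hyr] at hy
      refine ⟨hy.symm, ?_⟩
      by_contra hcon
      push Not at hcon
      exact hyr ⟨fun hh => hcon.1 (by rw [hh]), fun hh => hcon.2 (by rw [hh])⟩
  have hadj : (medialGraph P s).Adj (medialVertex s e) (medialVertex s (P e)) :=
    hs.adj h.ne h.ne'
  refine fun hmin => hfree (SimpleGraph.HasMinor.of_contraction g ?_ ?_ hmin)
  · intro w
    obtain ⟨⟨x, hx⟩, rfl⟩ := medialVertex_surjective E w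
    by_cases hxm : medialVertex E ⟨x, hx⟩ = m
    · rw [hxm]
      apply induce_connected_of_star (v := medialVertex s e)
      · exact he
      · intro v hv hne
        obtain ⟨y, rfl⟩ := medialVertex_surjective s v
        have hv' : g₀ y = medialVertex E ⟨s e, h.s_mem hs⟩ := hv
        rcases hfib _ _ y hv' with k | ⟨_, k | k⟩
        · rw [hs.medialVertex_apply] at k
          exact absurd k hne
        · exact absurd k hne
        · rw [k]
          exact hadj
    · apply induce_connected_of_star (v := medialVertex s x)
      · exact hin x hx
      · intro v hv hne
        obtain ⟨y, rfl⟩ := medialVertex_surjective s v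
        rcases hfib x hx y hv with k | ⟨k, _⟩
        · exact absurd k hne
        · exact absurd k hxm
  · have key : ∀ x : rest P e, g₀ (x : D) = medialVertex E x ∧
        g₀ (P x) = medialVertex E (restrictPerm P h.perm_closed x) :=
      fun x => ⟨hin x x.2, hin _ (h.perm_closed x x.2)⟩
    intro w w' hww
    rw [medialGraph_adj] at hww
    obtain ⟨hne, ⟨x, rfl, rfl⟩ | ⟨x, rfl, rfl⟩⟩ := hww
    · refine ⟨medialVertex s x, medialVertex s (P x), (key x).1, (key x).2, ?_, Or.inl ⟨x, rfl, rfl⟩⟩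
      intro hh
      exact hne ((key x).1.symm.trans ((congrArg g hh).trans (key x).2))
    · refine ⟨medialVertex s (P x), medialVertex s x, (key x).2, (key x).1, ?_, Or.inr ⟨x, rfl, rfl⟩⟩
      intro hh
      exact hne ((key x).2.symm.trans ((congrArg g hh).trans (key x).1))

theorem good (hg : Good P s) :
    Good (restrictPerm P h.perm_closed) (restrictPerm _ (h.edges_closed hs)) :=
  ⟨(edges_fixFree hs).restrict _, h.connected hs hg.conn, h.planar hs hg.planar,
    h.free hs hg.free⟩

end Bigon

theorem SimpleGraph.HasMinor.of_triangle_and_rest {V : Type*} {G : SimpleGraph V} {v a b : V}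
    {R : Set V} (hva : G.Adj v a) (hvb : G.Adj v b) (hab : G.Adj a b) (rv : v ∉ R) (ra : a ∉ R)
    (rb : b ∉ R) (hR : (G.induce R).Connected) (hv : ∃ r ∈ R, G.Adj v r)
    (ha : ∃ r ∈ R, G.Adj a r) (hb : ∃ r ∈ R, G.Adj b r) :
    G.HasMinor (⊤ : SimpleGraph (Fin 4)) := by
  have hsingle : ∀ u, (G.induce {u}).Connected := fun u =>
    induce_connected_of_star (v := u) rfl fun x hx hne => absurd hx hne
  obtain ⟨v', hv', hvv⟩ := hv
  obtain ⟨a', ha', haa⟩ := ha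
  obtain ⟨b', hb', hbb⟩ := hb
  refine ⟨![{v}, {a}, {b}, R], ?_, ?_, ?_⟩
  · intro i
    fin_cases i
    exacts [hsingle v, hsingle a, hsingle b, hR]
  · have d1 : ∀ u, u ∉ R → Disjoint {u} R := fun u hu => Set.disjoint_singleton_left.2 hu
    have d2 : ∀ u w : V, u ≠ w → Disjoint ({u} : Set V) {w} :=
      fun u w hu => Set.disjoint_singleton.2 hu
    intro i j hij
    fin_cases i <;> fin_cases j
    exacts [absurd rfl hij, d2 _ _ hva.ne, d2 _ _ hvb.ne, d1 _ rv,
      d2 _ _ hva.ne', absurd rfl hij, d2 _ _ hab.ne, d1 _ ra,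
      d2 _ _ hvb.ne', d2 _ _ hab.ne', absurd rfl hij, d1 _ rb,
      (d1 _ rv).symm, (d1 _ ra).symm, (d1 _ rb).symm, absurd rfl hij]
  · intro i j hij
    fin_cases i <;> fin_cases j
    exacts [absurd rfl hij.ne, ⟨v, rfl, a, rfl, hva⟩, ⟨v, rfl, b, rfl, hvb⟩, ⟨v, rfl, _, hv', hvv⟩,
      ⟨a, rfl, v, rfl, hva.symm⟩, absurd rfl hij.ne, ⟨a, rfl, b, rfl, hab⟩, ⟨a, rfl, _, ha', haa⟩,
      ⟨b, rfl, v, rfl, hvb.symm⟩, ⟨b, rfl, a, rfl, hab.symm⟩, absurd rfl hij.ne,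
      ⟨b, rfl, _, hb', hbb⟩, ⟨_, hv', v, rfl, hvv.symm⟩, ⟨_, ha', a, rfl, haa.symm⟩,
      ⟨_, hb', b, rfl, hbb.symm⟩, absurd rfl hij.ne]

/-- A bigon of `P` in a map without 2-edge-cuts cannot be contracted to a map all of whose faces
`P * s` are bigons, unless all vertices were bigons as well: the two vertices at the bigon, one
neighbour of the contracted vertex, and all the rest make up a minor `K₄`. -/
theorem Bigon.fixFreeInvol {D : Type*} [Finite D] [DecidableEq D] {P s : Perm D} {e : D}
    (h : Bigon P s e) (hg : Good P s) (hn : NoCut P s) (h1 : ∀ x, P x ≠ x ∧ P x ≠ s x)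
    (hE : FixFreeInvol (restrictPerm P h.perm_closed *
      restrictPerm _ (h.edges_closed hg.inv))) : FixFreeInvol P := by
  have hs := hg.inv
  have hE' : ∀ x ∈ Bigon.rest P e, P (Bigon.edges P s e (P (Bigon.edges P s e x))) = x :=
    fun x hx => congrArg Subtype.val (hE ⟨x, hx⟩).1
  have hEne : ∀ x ∈ Bigon.rest P e, P (Bigon.edges P s e x) ≠ x :=
    fun x hx hh => (hE ⟨x, hx⟩).2 (Subtype.ext hh)
  set f := P e with hf
  have hfe : P f = e := h.back
  have e1 := h.edges_s_self hs
  have e2 := h.edges_s_apply hs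
  rw [← hf] at e1 e2
  obtain ⟨x, hx⟩ : ∃ x, P (s f) = x := ⟨_, rfl⟩
  obtain ⟨y, hy⟩ : ∃ y, P (s e) = y := ⟨_, rfl⟩
  have hmse := h.s_mem hs
  have hmsf := h.s_apply_mem hs
  have hxm : x ∈ Bigon.rest P e := hx ▸ h.perm_closed _ hmsf
  have hym : y ∈ Bigon.rest P e := hy ▸ h.perm_closed _ hmse
  have hxe : x ≠ s e := fun hh => hEne _ hmse (by rw [e1, hx, hh])
  have hyf : y ≠ s f := fun hh => hEne _ hmsf (by rw [e2, hy, hh])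
  have hxf : x ≠ s f := fun hh => (h1 (s f)).1 (hx.trans hh)
  have hye : y ≠ s e := fun hh => (h1 (s e)).1 (hy.trans hh)
  have hPx : P (s x) = s e := by
    have := hE' _ hmse
    rwa [e1, hx, Bigon.edges_of_ne hs hxm.1 hxm.2 hxe hxf] at this
  have hPy : P (s y) = s f := by
    have := hE' _ hmsf
    rwa [e2, hy, Bigon.edges_of_ne hs hym.1 hym.2 hye hyf] at this
  have hef : e ≠ f := h.ne.symm
  by_cases hxy : y = s x
  · -- only two edges were left after the contraction
    have hsy : s y = x := by rw [hxy, (hs x).1]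
    rw [hsy] at hPy
    rw [← hxy] at hPx
    have hall := hg.conn {z | P (P z) = z ∧ (z = e ∨ z = s e ∨ z = f ∨ z = s f ∨ z = x ∨ z = y)}
      ⟨e, hfe, Or.inl rfl⟩ ?_ ?_
    · intro z
      have hz : z ∈ {z | P (P z) = z ∧ _} := hall ▸ Set.mem_univ z
      exact ⟨hz.1, (h1 z).1⟩
    · rintro z ⟨k1, k2⟩
      refine ⟨by rw [k1], ?_⟩
      rcases k2 with rfl | rfl | rfl | rfl | rfl | rfl
      · exact Or.inr (Or.inr (Or.inl rfl))
      · exact Or.inr (Or.inr (Or.inr (Or.inr (Or.inr hy))))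
      · exact Or.inl hfe
      · exact Or.inr (Or.inr (Or.inr (Or.inr (Or.inl hx))))
      · exact Or.inr (Or.inr (Or.inr (Or.inl hPy)))
      · exact Or.inr (Or.inl hPx)
    · have key : ∀ z, (z = e ∨ z = s e ∨ z = f ∨ z = s f ∨ z = x ∨ z = y) → P (P z) = z := by
        rintro z (rfl | rfl | rfl | rfl | rfl | rfl)
        · exact hfe
        · rw [hy, hPx]
        · rw [hfe]
        · rw [hx, hPy]
        · rw [hPy, hx]
        · rw [hPx, hy]
      rintro z ⟨k1, k2⟩
      have hz : s z = e ∨ s z = s e ∨ s z = f ∨ s z = s f ∨ s z = x ∨ s z = y := by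
        rcases k2 with rfl | rfl | rfl | rfl | rfl | rfl
        · exact Or.inr (Or.inl rfl)
        · exact Or.inl (hs _).1
        · exact Or.inr (Or.inr (Or.inr (Or.inl rfl)))
        · exact Or.inr (Or.inr (Or.inl (hs _).1))
        · exact Or.inr (Or.inr (Or.inr (Or.inr (Or.inr hxy.symm))))
        · exact Or.inr (Or.inr (Or.inr (Or.inr (Or.inl hsy))))
      exact ⟨key _ hz, hz⟩
  exfalso
  have hyx : y ≠ x := fun hh => (hs e).2 (by
    rw [← hx, ← hy] at hh
    exact absurd (s.injective (P.injective hh)) hef)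
  set v := medialVertex s e with hv
  set a := medialVertex s f with ha
  set b := medialVertex s x with hb
  have hva : v ≠ a := fun hh => by
    rcases hs.medialVertex_eq.1 hh with k | k
    · exact hef k.symm
    · exact h.ne' k
  have hvb : v ≠ b := fun hh => by
    rcases hs.medialVertex_eq.1 hh with k | k
    · exact hxm.1 k
    · exact hxe k
  have hab : a ≠ b := fun hh => by
    rcases hs.medialVertex_eq.1 hh with k | k
    · exact hxm.2 k
    · exact hxf k
  have hc : medialVertex s y ≠ v ∧ medialVertex s y ≠ a ∧ medialVertex s y ≠ b := by
    refine ⟨fun hh => ?_, fun hh => ?_, fun hh => ?_⟩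
    · rcases hs.medialVertex_eq.1 hh.symm with k | k
      · exact hym.1 k
      · exact hye k
    · rcases hs.medialVertex_eq.1 hh.symm with k | k
      · exact hym.2 k
      · exact hyf k
    · rcases hs.medialVertex_eq.1 hh.symm with k | k
      · exact hyx k
      · exact hxy k
  have adj_of : ∀ z, medialVertex s z ≠ medialVertex s (P z) →
      (medialGraph P s).Adj (medialVertex s z) (medialVertex s (P z)) :=
    fun z hz => ⟨hz, Or.inl ⟨z, rfl, rfl⟩⟩
  have hse := hs.medialVertex_apply e
  have hsf := hs.medialVertex_apply f
  have hsx := hs.medialVertex_apply x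
  have hsy := hs.medialVertex_apply y
  let R : Set (Quotient (SameCycle.setoid s)) := {u | u ≠ v ∧ u ≠ a ∧ u ≠ b}
  have hmemR : ∀ z, medialVertex s z ∈ R ↔
      z ≠ e ∧ z ≠ s e ∧ z ≠ f ∧ z ≠ s f ∧ z ≠ x ∧ z ≠ s x := by
    intro z
    have k1 : medialVertex s z = v ↔ z = e ∨ z = s e := by
      rw [eq_comm, hv, hs.medialVertex_eq]
    have k2 : medialVertex s z = a ↔ z = f ∨ z = s f := by
      rw [eq_comm, ha, hs.medialVertex_eq]
    have k3 : medialVertex s z = b ↔ z = x ∨ z = s x := by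
      rw [eq_comm, hb, hs.medialVertex_eq]
    change (_ ≠ v ∧ _ ≠ a ∧ _ ≠ b) ↔ _
    rw [Ne, Ne, Ne, k1, k2, k3]
    simp only [not_or, and_assoc, ne_eq]
  -- a part of the rest which is closed under adjacency contains the vertex of `y`, for otherwise
  -- at most the edge into `s x` leads out of it
  have hyC : ∀ C ⊆ R, C.Nonempty → (∀ u ∈ C, ∀ w ∈ R, (medialGraph P s).Adj u w → w ∈ C) →
      medialVertex s y ∈ C := by
    intro C hCR ⟨c, hcC⟩ hcl
    by_contra hyC
    have hclosed : ∀ z ∈ {z | medialVertex s z ∈ C}, s z ∈ {z | medialVertex s z ∈ C} := by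
      intro z hz
      change medialVertex s (s z) ∈ C
      rw [hs.medialVertex_apply]
      exact hz
    have hstep : ∀ z, medialVertex s z ∈ C → P z ≠ s x → medialVertex s (P z) ∈ C := by
      intro z hz hzx
      by_cases heq : medialVertex s z = medialVertex s (P z)
      · rwa [← heq]
      refine hcl _ hz _ ?_ (adj_of z heq)
      have hzR := (hmemR z).1 (hCR hz)
      rw [hmemR]
      refine ⟨fun k => hzR.2.2.1 (P.injective (k.trans hfe.symm)),
        fun k => hzR.2.2.2.2.2 (P.injective (k.trans hPx.symm)),
        fun k => hzR.1 (P.injective (k.trans hf)), fun k => ?_,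
        fun k => hzR.2.2.2.1 (P.injective (k.trans hx.symm)), hzx⟩
      have : z = s y := P.injective (k.trans hPy.symm)
      rw [this, hsy] at hz
      exact hyC hz
    obtain ⟨z₀, hz₀⟩ := P.surjective (s x)
    have hsxC : medialVertex s (s x) ∉ C := fun k => (hCR k).2.2 hsx
    by_cases hz₀C : medialVertex s z₀ ∈ C
    · refine hn {z | medialVertex s z ∈ C} z₀ ⟨hclosed, hz₀C, ?_, ?_⟩
      · rw [hz₀]
        exact hsxC
      · intro z hz hne
        exact hstep z hz fun k => hne (P.injective (k.trans hz₀.symm))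
    · obtain ⟨z, rfl⟩ := medialVertex_surjective s c
      have := hg.conn {z | medialVertex s z ∈ C} ⟨z, hcC⟩
        (fun z hz => hstep z hz fun k => hz₀C (by
          rw [← P.injective (k.trans hz₀.symm)]
          exact hz)) hclosed
      have hmem : s x ∈ {z | medialVertex s z ∈ C} := this ▸ Set.mem_univ _
      exact hsxC hmem
  have hRconn : ∀ A ⊆ R, A.Nonempty →
      (∀ u ∈ A, ∀ w ∈ R, (medialGraph P s).Adj u w → w ∈ A) → A = R := by
    intro A hAR hA hcl
    have hyA := hyC A hAR hA hcl
    refine hAR.antisymm fun w hw => ?_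
    by_contra hwA
    exact (hyC (R \ A) Set.sdiff_subset ⟨w, hw, hwA⟩ fun u hu w hw huw =>
      ⟨hw, fun hwA => hu.2 (hcl w hwA u hu.1 huw.symm)⟩).2 hyA
  have hyR : medialVertex s y ∈ R := hc
  have hPxR : medialVertex s (P x) ∈ R := by
    rw [hmemR]
    exact ⟨fun k => hxm.2 (P.injective (k.trans hfe.symm)),
      fun k => (hs x).2 (P.injective (hPx.trans k.symm)),
      fun k => hxm.1 (P.injective (k.trans hf)),
      fun k => hxy (by rw [P.injective (k.trans hPy.symm), (hs y).1]),
      (h1 x).1, (h1 x).2⟩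
  have avb : (medialGraph P s).Adj v b := by
    have := adj_of (s x) (by rw [hsx, hPx, hse]; exact hvb.symm)
    rw [hsx, hPx, hse] at this
    exact this.symm
  have aab : (medialGraph P s).Adj a b := by
    have := adj_of (s f) (by rw [hsf, hx]; exact hab)
    rwa [hsf, hx] at this
  have avr : (medialGraph P s).Adj v (medialVertex s y) := by
    have := adj_of (s e) (by rw [hse, hy]; exact hc.1.symm)
    rwa [hse, hy] at this
  have aar : (medialGraph P s).Adj a (medialVertex s y) := by
    have := adj_of (s y) (by rw [hsy, hPy, hsf]; exact hc.2.1)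
    rw [hsy, hPy, hsf] at this
    exact this.symm
  have abr : (medialGraph P s).Adj b (medialVertex s (P x)) := adj_of x hPxR.2.2.symm
  exact hg.free (SimpleGraph.HasMinor.of_triangle_and_rest (adj_of e hva) avb aab
    (fun k => k.1 rfl) (fun k => k.2.1 rfl) (fun k => k.2.2 rfl)
    (induce_connected_iff.2 ⟨⟨_, hyR⟩, hRconn⟩) ⟨_, hyR, avr⟩ ⟨_, hyR, aar⟩ ⟨_, hPxR, abr⟩)

/-- A good map without 2-edge-cuts is a cycle (each vertex has degree two) or dual to a cycle (each
face has degree two). -/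
theorem NoCut.fixFreeInvol_or (n : ℕ) {D : Type*} [Finite D] (hcard : Nat.card D = n) [Nonempty D]
    {P s : Perm D} (hg : Good P s) (hn : NoCut P s) :
    FixFreeInvol P ∨ FixFreeInvol (P * s) := by
  classical
  induction n using Nat.strong_induction_on generalizing D with | _ n ih => ?_
  have hs := hg.inv
  by_cases h1 : ∀ x, P x ≠ x ∧ P x ≠ s x
  -- contract the bigon and use the induction hypothesis for the smaller map
  · have main : ∀ P : Perm D, Good P s → NoCut P s → (∀ x, P x ≠ x ∧ P x ≠ s x) →
        ∀ e, P (P e) = e → FixFreeInvol P ∨ FixFreeInvol (P * s) := by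
      intro P hg hn h1 e he
      have h : Bigon P s e := ⟨he, (h1 e).1, (h1 e).2⟩
      have : Nonempty (Bigon.rest P e) := ⟨⟨s e, h.s_mem hs⟩⟩
      have hlt : Nat.card (Bigon.rest P e) < n := by
        rw [← hcard]
        exact Finite.card_subtype_lt (x := e) fun k => k.1 rfl
      left
      rcases ih _ hlt rfl (h.good hs hg) (h.noCut hs hn) with k | k
      · intro x
        refine ⟨?_, (h1 x).1⟩
        by_cases hx : x ∈ Bigon.rest P e
        · exact congrArg Subtype.val (k ⟨x, hx⟩).1
        · have : x = e ∨ x = P e := by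
            by_contra hcon
            push Not at hcon
            exact hx hcon
          rcases this with rfl | rfl
          · exact he
          · rw [he]
      · exact h.fixFreeInvol hg hn h1 k
    rcases hn.exists_bigon hg h1 with ⟨e, he⟩ | ⟨e, he⟩
    · exact main P hg hn h1 e he
    -- the bigon is a face: pass to the dual map
    · have := main (P * s) hg.dual (hn.dual hs) (fun x => ?_) e he
      · rwa [hs.mul_mul_cancel, or_comm] at this
      · have := h1 (s x)
        rw [(hs x).1] at this
        exact this.symm
  · push Not at h1
    obtain ⟨x, hx⟩ := h1
    -- a loop of the medial graph: it has only one vertex, by the absence of cuts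
    have hall := hn.eq_of_loop hg.conn hs (x := x) (by tauto)
    have hallP : ∀ y, P y = x ∨ P y = s x := fun y => hall _
    by_cases hPx : P x = x
    · have hPs : P (s x) = s x :=
        (hallP (s x)).resolve_left fun k => (hs x).2 (P.injective (k.trans hPx.symm))
      right
      have hP1 : P * s = s := Equiv.ext fun y => by
        rcases hall (s y) with k | k <;> rw [mul_apply, k] <;> assumption
      rw [hP1]
      exact hs
    · left
      have hPx' := (hallP x).resolve_left hPx
      have hPs : P (s x) = x :=
        (hallP (s x)).resolve_right fun k => (hs x).2 (P.injective (k.trans hPx'.symm))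
      have hP1 : P = s := Equiv.ext fun y => by
        rcases hall y with rfl | rfl
        · exact hPx'
        · rw [hPs, (hs _).1]
      rw [hP1]
      exact hs

/-! ### Substitution of maps into the corners of a map -/

/-- A map with two free ends: `none` stands for the outside, so that `P none` is the first and the
element sent to `none` is the last dart. In terms of the medial graph, this is a 4-regular map one of
whose edges has been cut open. The empty map (an edge without vertices) is allowed. -/
structure Leg where
  D : Type
  P : Perm (Option D)
  s : Perm D

/-- The corner of a map just after `d`, opened up. -/
noncomputable def openPerm {D : Type*} (P : Perm D) (d : D) : Perm (Option D) :=
  open Classical in Equiv.optionCongr P * swap none (some d)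

section openPerm

variable {D : Type*} {P : Perm D} {d : D}

theorem openPerm_none : openPerm P d none = some (P d) := by
  simp [openPerm]

theorem openPerm_root : openPerm P d (some d) = none := by
  simp [openPerm]

theorem openPerm_of_ne {x : D} (h : x ≠ d) : openPerm P d (some x) = some (P x) := by
  simp [openPerm, Equiv.swap_apply_def, h]

theorem cyc_optionCongr [Finite D] (P : Perm D) : cyc (Equiv.optionCongr P) = cyc P + 1 := by
  have h1 : cyc (1 : Perm Unit) = 1 := by
    rw [cyc_one]
    simp
  rw [← h1]
  refine cyc_eq_add (i := some) (j := fun _ => none) (Option.some_injective D)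
    (fun _ _ _ => rfl) (by simp) ?_ (fun _ => rfl) (fun _ => rfl)
  rintro (_ | x)
  · exact Or.inr ⟨(), rfl⟩
  · exact Or.inl ⟨x, rfl⟩

theorem cyc_openPerm [Finite D] (P : Perm D) (d : D) : cyc (openPerm P d) = cyc P := by
  classical
  have : ¬ Perm.SameCycle (Equiv.optionCongr P) none (some d) := by
    intro h
    have := h.mem_of_closed (A := {none}) (by simp) rfl
    simp at this
  have h := cyc_mul_swap_of_not this
  rw [cyc_optionCongr] at h
  have e : openPerm P d = Equiv.optionCongr P * swap none (some d) := by
    unfold openPerm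
    congr
  rw [e]
  omega

theorem openPerm_mul (s : Perm D) :
    openPerm P d * Equiv.optionCongr s = openPerm (P * s) (s⁻¹ d) := by
  classical
  ext1 x
  rw [mul_apply]
  rcases x with _ | x
  · simp [openPerm_none]
  · by_cases hx : s x = d
    · have : x = s⁻¹ d := by rw [← hx]; simp
      rw [← this, openPerm_root]
      simp [hx, openPerm_root]
    · have : x ≠ s⁻¹ d := fun h => hx (by rw [h]; simp)
      rw [openPerm_of_ne this]
      simp [openPerm_of_ne hx]

end openPerm

namespace Leg

/-- The leg obtained from a rooted map by opening the corner at the root. -/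
noncomputable abbrev ofRooted {D : Type} (P s : Perm D) (d : D) : Leg := ⟨D, openPerm P d, s⟩

/-- Finiteness, connectedness and planarity of a leg. -/
structure Good (L : Leg) : Prop where
  fin : Finite L.D
  inv : FixFreeInvol L.s
  conn : ∀ A : Set (Option L.D), none ∈ A → (∀ x ∈ A, L.P x ∈ A) →
    (∀ x, some x ∈ A → some (L.s x) ∈ A) → A = Set.univ
  planar : cyc L.P + cyc L.s + cyc (L.P * Equiv.optionCongr L.s) = Nat.card L.D + 2

theorem good_ofRooted {D : Type} [Finite D] {P s : Perm D} (d : D) (hs : FixFreeInvol s)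
    (hc : PermConnected P s) (hp : Planar P s) : (ofRooted P s d).Good where
  fin := ‹_›
  inv := hs
  conn := by
    intro A hnone hP hsA
    have hd : some (P d) ∈ A := openPerm_none (P := P) (d := d) ▸ hP none hnone
    have := hc {x | some x ∈ A} ⟨P d, hd⟩ (fun x hx => ?_) hsA
    · ext x
      refine ⟨fun _ => trivial, fun _ => ?_⟩
      rcases x with _ | x
      · exact hnone
      · exact this.ge trivial
    · by_cases hxd : x = d
      · subst hxd
        exact hd
      · change some (P x) ∈ A
        rw [← openPerm_of_ne (P := P) hxd]
        exact hP _ hx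
  planar := by
    change cyc (openPerm P d) + cyc s + cyc (openPerm P d * Equiv.optionCongr s) = Nat.card D + 2
    rw [openPerm_mul, cyc_openPerm, cyc_openPerm]
    exact hp

section Asm

variable {K : Type} (p t : Perm K) {X : K → Type}

/-- The permutation `p` of `K`, acting on the elements `none` only. -/
def linkPerm (X : K → Type) : Perm (Σ e, Option (X e)) where
  toFun
    | ⟨e, none⟩ => ⟨p e, none⟩
    | ⟨e, some x⟩ => ⟨e, some x⟩
  invFun
    | ⟨e, none⟩ => ⟨p.symm e, none⟩
    | ⟨e, some x⟩ => ⟨e, some x⟩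
  left_inv := by
    rintro ⟨e, _ | x⟩
    · simp
      congr
      simp
    · rfl
  right_inv := by
    rintro ⟨e, _ | x⟩
    · simp
      congr
      simp
    · rfl

/-- The permutations `R e` of the fibres, with the cycles through the elements `none` linked to
each other according to `p`. -/
def linked (R : ∀ e, Perm (Option (X e))) : Perm (Σ e, Option (X e)) :=
  linkPerm p X * Equiv.sigmaCongrRight R

variable {p} {R : ∀ e, Perm (Option (X e))}

theorem linked_of_none {e : K} {x : Option (X e)} (h : R e x = none) :
    linked p R ⟨e, x⟩ = ⟨p e, none⟩ := by
  change linkPerm p X ⟨e, R e x⟩ = _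
  rw [h]
  rfl

theorem linked_of_ne {e : K} {x : Option (X e)} (h : R e x ≠ none) :
    linked p R ⟨e, x⟩ = ⟨e, R e x⟩ := by
  change linkPerm p X ⟨e, R e x⟩ = _
  obtain ⟨y, hy⟩ := Option.ne_none_iff_exists'.1 h
  rw [hy]
  rfl

theorem sameCycle_linked_of_pow {e : K} (n : ℕ) :
    ∀ x : Option (X e), (R e ^ (n + 1)) x = none → (linked p R).SameCycle ⟨e, x⟩ ⟨p e, none⟩ := by
  induction n with
  | zero =>
    intro x hx
    rw [zero_add, pow_one] at hx
    exact ⟨1, by rw [zpow_one, linked_of_none hx]⟩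
  | succ n ih =>
    intro x hx
    by_cases h : R e x = none
    · exact ⟨1, by rw [zpow_one, linked_of_none h]⟩
    · rw [pow_succ, mul_apply] at hx
      exact SameCycle.trans ⟨1, by rw [zpow_one, linked_of_ne h]⟩ (ih _ hx)

theorem sameCycle_linked [∀ e, Finite (X e)] {e : K} {x : Option (X e)}
    (h : (R e).SameCycle x none) : (linked p R).SameCycle ⟨e, x⟩ ⟨p e, none⟩ := by
  obtain ⟨n, hn⟩ := h.exists_nat_pow_eq
  have hpos := orderOf_pos (R e)
  refine sameCycle_linked_of_pow (n + (orderOf (R e) - 1)) x ?_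
  rw [add_assoc, Nat.sub_add_cancel hpos, pow_add, pow_orderOf_eq_one, mul_one, hn]

theorem sameCycle_linked_none [∀ e, Finite (X e)] {e : K} {x : Option (X e)}
    (h : (R e).SameCycle x none) : (linked p R).SameCycle ⟨e, x⟩ ⟨e, none⟩ :=
  (sameCycle_linked h).trans (sameCycle_linked (SameCycle.refl _ _)).symm

theorem cyc_linked [Fintype K] [∀ e, Finite (X e)] :
    cyc (linked p R) + Fintype.card K = cyc p + ∑ e, cyc (R e) := by
  classical
  let T := Quotient (SameCycle.setoid p) ⊕
    Σ e, {q : Quotient (SameCycle.setoid (R e)) // q ≠ Quotient.mk _ none}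
  -- the invariant of the cycles
  let Φ : (Σ e, Option (X e)) → T := fun y =>
    if h : (R y.1).SameCycle y.2 none then Sum.inl (Quotient.mk _ y.1)
    else Sum.inr ⟨y.1, Quotient.mk _ y.2, fun hh => h (Quotient.exact hh)⟩
  have hpos : ∀ e x, (R e).SameCycle x none → Φ ⟨e, x⟩ = Sum.inl (Quotient.mk _ e) :=
    fun e x h => dif_pos h
  have hneg : ∀ e x (h : ¬ (R e).SameCycle x none), Φ ⟨e, x⟩ =
      Sum.inr ⟨e, Quotient.mk _ x, fun hh => h (Quotient.exact hh)⟩ := fun e x h => dif_neg h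
  have hstep : ∀ y, Φ (linked p R y) = Φ y := by
    rintro ⟨e, x⟩
    by_cases hx : R e x = none
    · rw [linked_of_none hx, hpos _ _ (SameCycle.refl _ _),
        hpos e x ⟨1, by rw [zpow_one, hx]⟩]
      exact congrArg Sum.inl (Quotient.sound (SameCycle.symm ⟨1, by simp⟩))
    · rw [linked_of_ne hx]
      have hxx : (R e).SameCycle (R e x) x := SameCycle.symm ⟨1, by simp⟩
      by_cases h : (R e).SameCycle x none
      · rw [hpos _ _ h, hpos _ _ (hxx.trans h)]
      · rw [hneg _ _ h, hneg _ _ (fun hh => h (hxx.symm.trans hh))]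
        congr 2
        exact Subtype.ext (Quotient.sound hxx)
  have hinv : ∀ y z, (linked p R).SameCycle y z → Φ y = Φ z := by
    intro y z h
    have := sameCycle_of_semiconj (f := linked p R) (g := (1 : Perm T)) (j := Φ) hstep h
    simpa using this
  have hF : Function.Bijective
      (Quotient.lift (s := SameCycle.setoid (linked p R)) Φ fun y z h => hinv y z h) := by
    constructor
    · intro a b hab
      induction a using Quotient.inductionOn with | _ y => ?_
      induction b using Quotient.inductionOn with | _ z => ?_
      obtain ⟨e, x⟩ := y
      obtain ⟨e', x'⟩ := z
      have hab : Φ ⟨e, x⟩ = Φ ⟨e', x'⟩ := hab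
      refine Quotient.sound ?_
      by_cases h : (R e).SameCycle x none <;> by_cases h' : (R e').SameCycle x' none
      · rw [hpos _ _ h, hpos _ _ h'] at hab
        have hee : p.SameCycle e e' := Quotient.exact (Sum.inl_injective hab)
        have key := sameCycle_of_semiconj (f := p) (g := 1)
          (j := fun e => Quotient.mk (SameCycle.setoid (linked p R)) ⟨e, none⟩)
          (fun e => Quotient.sound (sameCycle_linked (SameCycle.refl _ _)).symm) hee
        have key' : (linked p R).SameCycle ⟨e, none⟩ ⟨e', none⟩ :=
          Quotient.exact (by simpa using key)
        exact ((sameCycle_linked_none h).trans key').trans (sameCycle_linked_none h').symm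
      · rw [hpos _ _ h, hneg _ _ h'] at hab
        cases hab
      · rw [hneg _ _ h, hpos _ _ h'] at hab
        cases hab
      · rw [hneg _ _ h, hneg _ _ h'] at hab
        have hab := Sum.inr_injective hab
        obtain ⟨rfl, hab⟩ := Sigma.mk.inj_iff.1 hab
        have hxx : (R e).SameCycle x x' := Quotient.exact (congrArg Subtype.val (eq_of_heq hab))
        have hpow : ∀ n : ℕ, (linked p R).SameCycle ⟨e, x⟩ ⟨e, (R e ^ n) x⟩ := by
          intro n
          induction n with
          | zero => exact SameCycle.refl _ _
          | succ n ih =>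
            have hne : R e ((R e ^ n) x) ≠ none := fun hh =>
              h ⟨(n + 1 : ℕ), by rw [zpow_natCast, pow_succ', mul_apply, hh]⟩
            exact SameCycle.trans ih ⟨1, by
              rw [zpow_one, linked_of_ne hne, pow_succ', mul_apply]⟩
        obtain ⟨n, rfl⟩ := hxx.exists_nat_pow_eq
        exact hpow n
    · rintro (q | ⟨e, q, hq⟩)
      · induction q using Quotient.inductionOn with | _ e => ?_
        exact ⟨Quotient.mk _ ⟨e, none⟩, hpos _ _ (SameCycle.refl _ _)⟩
      · induction q using Quotient.inductionOn with | _ x => ?_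
        exact ⟨Quotient.mk _ ⟨e, x⟩, hneg _ _ fun h => hq (Quotient.sound h)⟩
  have hcard : cyc (linked p R) = Nat.card T := Nat.card_eq_of_bijective _ hF
  rw [hcard, Nat.card_sum, Nat.card_sigma, add_assoc]
  congr 1
  rw [Fintype.card_eq_sum_ones, ← Finset.sum_add_distrib]
  exact Finset.sum_congr rfl fun e _ => card_ne_add_one _

/-- The edges of an assembled map. -/
def asmS (L : K → Leg) : Perm (Σ e, Option (L e).D) :=
  linkPerm t (fun e => (L e).D) * Equiv.sigmaCongrRight fun e => Equiv.optionCongr (L e).s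

/-- The leg obtained from the map `p`, `t` with root corner `r` by inserting the leg `L e` at the
corner after `e`, for each `e`. The element `none` of the `e`-th block is the dart `e` itself. -/
noncomputable abbrev asm (p t : Perm K) (r : K) (L : K → Leg) : Leg :=
  ofRooted (linked p fun e => (L e).P) (asmS t L) ⟨r, none⟩

variable {t} {L : K → Leg}

@[simp]
theorem asmS_none (e : K) : asmS t L ⟨e, none⟩ = ⟨t e, none⟩ := rfl

@[simp]
theorem asmS_some (e : K) (x : (L e).D) : asmS t L ⟨e, some x⟩ = ⟨e, some ((L e).s x)⟩ := rfl

theorem asmS_fixFree (ht : FixFreeInvol t) (hL : ∀ e, FixFreeInvol (L e).s) :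
    FixFreeInvol (asmS t L) := by
  rintro ⟨e, _ | x⟩
  · rw [asmS_none, asmS_none, (ht e).1]
    exact ⟨rfl, fun h => (ht e).2 (Sigma.mk.inj_iff.1 h).1⟩
  · rw [asmS_some, asmS_some, (hL e x).1]
    refine ⟨rfl, fun h => (hL e x).2 ?_⟩
    exact Option.some_injective _ (eq_of_heq (Sigma.mk.inj_iff.1 h).2)

theorem asm_connected [Finite K] (hc : PermConnected p t) (hL : ∀ e, (L e).Good) :
    PermConnected (linked p fun e => (L e).P) (asmS t L) := by
  have := fun e => (hL e).fin
  rintro A ⟨⟨e₀, x₀⟩, ha⟩ hP hs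
  have hblock : ∀ e, (⟨e, none⟩ : Σ e, Option (L e).D) ∈ A →
      (∀ x, (⟨e, x⟩ : Σ e, Option (L e).D) ∈ A) := by
    intro e he x
    have := (hL e).conn {x | (⟨e, x⟩ : Σ e, Option (L e).D) ∈ A} he ?_ ?_
    · exact this.ge trivial
    · intro x hx
      by_cases hnone : (L e).P x = none
      · rw [hnone]
        exact he
      · have := hP _ hx
        rwa [linked_of_ne hnone] at this
    · exact fun x hx => hs _ hx
  have hback : (⟨e₀, none⟩ : Σ e, Option (L e).D) ∈ A := by
    -- otherwise the part of the block that is not in `A` is closed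
    by_contra hn
    have := (hL e₀).conn {x | (⟨e₀, x⟩ : Σ e, Option (L e).D) ∉ A} hn ?_ ?_
    · exact (this.ge (trivial : x₀ ∈ Set.univ)) ha
    · intro x hx
      by_cases hnone : (L e₀).P x = none
      · rw [hnone]
        exact hn
      · have := compl_closed hP _ hx
        rwa [linked_of_ne hnone] at this
    · exact fun x hx => compl_closed hs _ hx
  have hK := hc {e | (⟨e, none⟩ : Σ e, Option (L e).D) ∈ A} ⟨e₀, hback⟩ ?_ fun e he => hs _ he
  · ext ⟨e, x⟩
    exact ⟨fun _ => trivial, fun _ => hblock e (hK.ge trivial) x⟩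
  · intro e he
    have := hP _ (hblock e he ((L e).P⁻¹ none))
    rwa [linked_of_none (by simp)] at this

theorem linked_mul_asmS : cyc (linked p (fun e => (L e).P) * asmS t L) =
    cyc (linked (t * p) fun e => (L e).P * Equiv.optionCongr (L e).s) := by
  have e1 : linked p (fun e => (L e).P) * asmS t L =
      linked p (fun e => (L e).P * Equiv.optionCongr (L e).s) * linkPerm t fun e => (L e).D := by
    ext1 y
    obtain ⟨e, _ | x⟩ := y <;> rfl
  have e2 : linkPerm t (fun e => (L e).D) *
      linked p (fun e => (L e).P * Equiv.optionCongr (L e).s) =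
      linked (t * p) fun e => (L e).P * Equiv.optionCongr (L e).s := by
    unfold linked
    rw [← mul_assoc]
    congr 1
    ext1 y
    obtain ⟨e, _ | x⟩ := y <;> rfl
  rw [e1, cyc_mul_comm, e2]

theorem asm_planar [Finite K] (hp : Planar p t) (hL : ∀ e, (L e).Good) :
    Planar (linked p fun e => (L e).P) (asmS t L) := by
  have := fun e => (hL e).fin
  have := Fintype.ofFinite K
  have c1 := cyc_linked (p := p) (R := fun e => (L e).P)
  have c2 := cyc_linked (p := t * p) (R := fun e => (L e).P * Equiv.optionCongr (L e).s)
  have c3 := cyc_linked (p := t) (R := fun e => Equiv.optionCongr (L e).s)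
  simp only [cyc_optionCongr, Finset.sum_add_distrib, ← Fintype.card_eq_sum_ones] at c3
  have c4 : ∑ e, cyc (L e).P + ∑ e, cyc (L e).s + ∑ e, cyc ((L e).P * Equiv.optionCongr (L e).s) =
      ∑ e, Nat.card (L e).D + 2 * Fintype.card K := by
    rw [← Finset.sum_add_distrib, ← Finset.sum_add_distrib,
      Finset.sum_congr rfl fun e _ => (hL e).planar, Finset.sum_add_distrib, Finset.sum_const,
      smul_eq_mul, mul_comm, Finset.card_univ]
  have c5 : Nat.card (Σ e, Option (L e).D) = ∑ e, Nat.card (L e).D + Fintype.card K := by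
    rw [Nat.card_sigma, Fintype.card_eq_sum_ones, ← Finset.sum_add_distrib]
    exact Finset.sum_congr rfl fun e _ => Finite.card_option
  have c6 := cyc_mul_comm t p
  have c7 : Nat.card K = Fintype.card K := Nat.card_eq_fintype_card
  unfold Planar at hp ⊢
  rw [linked_mul_asmS, c5]
  change _ + cyc (linked t fun e => Equiv.optionCongr (L e).s) + _ = _
  omega

theorem asm_good [Finite K] {r : K} (ht : FixFreeInvol t) (hc : PermConnected p t)
    (hp : Planar p t) (hL : ∀ e, (L e).Good) : (asm p t r L).Good := by
  have := fun e => (hL e).fin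
  exact good_ofRooted _ (asmS_fixFree ht fun e => (hL e).inv) (asm_connected hc hL)
    (asm_planar hp hL)

end Asm

end Leg

/-! ### Rings, and codes of maps -/

theorem FixFreeInvol.two_mul_cyc {D : Type*} [Finite D] {s : Perm D} (hs : FixFreeInvol s) :
    2 * cyc s = Nat.card D := by
  classical
  have := Fintype.ofFinite (Quotient (SameCycle.setoid s))
  have h := Nat.card_congr (Equiv.sigmaFiberEquiv (medialVertex s))
  rw [← h, Nat.card_sigma, Finset.sum_congr rfl (g := fun _ => 2), Finset.sum_const, smul_eq_mul,
    Finset.card_univ, mul_comm]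
  · rw [cyc, Nat.card_eq_fintype_card]
  · intro v _
    obtain ⟨x, rfl⟩ := medialVertex_surjective s v
    have : {y | medialVertex s y = medialVertex s x} = {x, s x} := by
      ext y
      exact eq_comm.trans hs.medialVertex_eq
    change Nat.card ({y | medialVertex s y = medialVertex s x} : Set D) = 2
    rw [this, Nat.card_coe_set_eq, Set.ncard_pair (hs x).2.symm]

/-- The edges of the cycle of length `k + 1`: the darts of the edge `i` are `(i, false)` and
`(i, true)`. -/
def ringFlip (k : ℕ) : Perm (Fin (k + 1) × Bool) where
  toFun x := (x.1, !x.2)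
  invFun x := (x.1, !x.2)
  left_inv x := by simp
  right_inv x := by simp

/-- The vertices of the cycle of length `k + 1` (for `κ = true`) and of its dual, the bond with
`k + 1` edges (for `κ = false`). In both cases the medial graph is the ring in which the vertex `i`
is joined to `i - 1` and `i + 1` by two edges each. -/
def ringPerm (κ : Bool) (k : ℕ) : Perm (Fin (k + 1) × Bool) where
  toFun x := (if x.2 then x.1 + 1 else x.1 - 1, xor κ x.2)
  invFun x := (if xor κ x.2 then x.1 - 1 else x.1 + 1, xor κ x.2)
  left_inv := by rintro ⟨i, _ | _⟩ <;> cases κ <;> simp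
  right_inv := by rintro ⟨i, _ | _⟩ <;> cases κ <;> simp

theorem ringFlip_fixFree (k : ℕ) : FixFreeInvol (ringFlip k) := by
  rintro ⟨i, b⟩
  exact ⟨by simp [ringFlip], by simp [ringFlip]⟩

theorem ringPerm_true_fixFree (k : ℕ) : FixFreeInvol (ringPerm true k) := by
  rintro ⟨i, _ | _⟩ <;> simp [ringPerm]

theorem ringPerm_false_mul_fixFree (k : ℕ) : FixFreeInvol (ringPerm false k * ringFlip k) := by
  rintro ⟨i, _ | _⟩ <;> simp [ringPerm, ringFlip]

theorem fin_induction {k : ℕ} {A : Set (Fin (k + 1))} {i : Fin (k + 1)} (hi : i ∈ A)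
    (h : ∀ j ∈ A, j + 1 ∈ A) : A = Set.univ := by
  have hn : ∀ n : ℕ, i + n • (1 : Fin (k + 1)) ∈ A := by
    intro n
    induction n with
    | zero => simpa
    | succ n ih =>
      have := h _ ih
      rwa [add_assoc, ← succ_nsmul] at this
  ext j
  refine ⟨fun _ => trivial, fun _ => ?_⟩
  have := hn (j - i : Fin (k + 1))
  have h1 : ((j - i : Fin (k + 1)) : ℕ) • (1 : Fin (k + 1)) = j - i := by
    open Fin.NatCast in rw [nsmul_one, Fin.cast_val_eq_self]
  rwa [h1, add_sub_cancel] at this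

theorem cyc_ringPerm_false (k : ℕ) : cyc (ringPerm false k) = 2 := by
  have key : ∀ f : Perm (Fin (k + 1)), (∀ i, f i = i + 1) → cyc f = 1 := by
    intro f hf
    refine cyc_eq_one 0 fun x => ?_
    have := fin_induction (A := {i | f.SameCycle 0 i}) (i := 0) (SameCycle.refl _ _)
      fun j hj => SameCycle.trans hj ⟨1, by simp [hf]⟩
    exact this.ge trivial
  have h1 : cyc (Equiv.addRight (1 : Fin (k + 1))) = 1 := key _ fun i => rfl
  have h2 : cyc ((Equiv.addRight (1 : Fin (k + 1))) : Perm _)⁻¹ = 1 := by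
    rw [cyc_inv, h1]
  have : cyc (ringPerm false k) = cyc (Equiv.addRight (1 : Fin (k + 1))) +
      cyc ((Equiv.addRight (1 : Fin (k + 1))) : Perm _)⁻¹ := by
    refine cyc_eq_add (i := fun i => (i, true)) (j := fun i => (i, false)) ?_ ?_ (by simp) ?_ ?_ ?_
    · exact fun a b h => congrArg Prod.fst h
    · exact fun a b h => congrArg Prod.fst h
    · rintro ⟨i, _ | _⟩
      · exact Or.inr ⟨i, rfl⟩
      · exact Or.inl ⟨i, rfl⟩
    · intro i
      simp [ringPerm]
    · intro i
      simp [ringPerm, sub_eq_add_neg]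
  omega

theorem ring_connected (κ : Bool) (k : ℕ) : PermConnected (ringPerm κ k) (ringFlip k) := by
  rintro A ⟨⟨i, b⟩, hA⟩ hP hs
  have hflip : ∀ i b, (i, b) ∈ A → ∀ c, (i, c) ∈ A := by
    intro i b h c
    by_cases hbc : b = c
    · exact hbc ▸ h
    · have := hs _ h
      rwa [show ringFlip k (i, b) = (i, c) from Prod.ext rfl (by cases b <;> cases c <;> simp_all [ringFlip])] at this
  have := fin_induction (A := {i | (i, true) ∈ A}) (i := i) (hflip i b hA true) fun j hj =>
    hflip _ _ (hP _ hj) true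
  ext ⟨j, c⟩
  exact ⟨fun _ => trivial, fun _ => hflip j true (this.ge trivial) c⟩

theorem ringPerm_false_eq (k : ℕ) : ringPerm false k = (ringPerm true k * ringFlip k)⁻¹ := by
  rw [eq_inv_iff_mul_eq_one]
  ext1 ⟨i, b⟩
  cases b <;> simp [ringPerm, ringFlip]

theorem ring_planar (κ : Bool) (k : ℕ) : Planar (ringPerm κ k) (ringFlip k) := by
  have h1 := (ringFlip_fixFree k).two_mul_cyc
  have h2 := (ringPerm_true_fixFree k).two_mul_cyc
  have h3 := (ringPerm_false_mul_fixFree k).two_mul_cyc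
  have h4 := cyc_ringPerm_false k
  have h5 := cyc_inv (ringPerm true k * ringFlip k)
  rw [← ringPerm_false_eq] at h5
  unfold Planar
  cases κ <;> omega

/-- The shapes `(κ, k)` of the rings with `k + 1` vertices. The ring with two vertices is
self-dual, and represented by `κ = true` only. -/
abbrev RingShape := {q : Bool × ℕ // q ≠ (false, 1)}

/-- Codes of rooted `K₄`-minor-free maps: a ring, together with the codes of the maps which are
inserted at its corners. -/
inductive Code : Type
  | leaf : Code
  | node (q : RingShape) (ch : Fin (q.1.2 + 1) × Bool → Code) : Code

/-- The map described by a code, opened at its root. -/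
noncomputable def Code.leg : Code → Leg
  | leaf => ⟨Empty, 1, 1⟩
  | node q ch => Leg.asm (ringPerm q.1.1 q.1.2) (ringFlip q.1.2) (0, false) fun e => (ch e).leg

theorem Code.leg_good (c : Code) : c.leg.Good := by
  induction c with
  | leaf =>
    refine ⟨inferInstanceAs (Finite Empty), fun x => x.elim, ?_, ?_⟩
    · intro A hA _ _
      ext x
      rcases x with _ | x
      · exact iff_of_true hA trivial
      · exact x.elim
    · change cyc (1 : Perm (Option Empty)) + cyc (1 : Perm Empty) +
        cyc ((1 : Perm (Option Empty)) * Equiv.optionCongr (1 : Perm Empty)) = Nat.card Empty + 2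
      have : Equiv.optionCongr (1 : Perm Empty) = (1 : Perm (Option Empty)) := by
        ext1 x
        rcases x with _ | x
        · rfl
        · exact x.elim
      rw [this, mul_one, cyc_one, cyc_one]
      simp
  | node q ch ih =>
    exact Leg.asm_good (ringFlip_fixFree _) (ring_connected _ _) (ring_planar _ _) ih

/-- The number of vertices of the 4-regular map (or of edges of the map) described by a code. -/
def Code.size : Code → ℕ
  | leaf => 0
  | node q ch => q.1.2 + 1 + ∑ e, (ch e).size

theorem Code.card_leg (c : Code) : Nat.card c.leg.D = 2 * c.size := by
  induction c with
  | leaf =>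
    change Nat.card Empty = 2 * 0
    simp
  | node q ch ih =>
    have := fun e => (ch e).leg_good.fin
    change Nat.card (Σ e, Option (ch e).leg.D) = 2 * (q.1.2 + 1 + ∑ e, (ch e).size)
    rw [Nat.card_sigma]
    simp only [Finite.card_option, ih, Finset.sum_add_distrib, ← Finset.mul_sum]
    simp
    ring

/-! ### Maps described by codes have no minor `K₄` -/

/-- The position of an element relative to the vertices of a leg, `inr b` being the outside. -/
def Leg.place {D V : Type} (vert : D → V) (b : Bool) : Option D → V ⊕ Bool
  | none => Sum.inr b
  | some x => Sum.inl (vert x)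

/-- Two vertices or ends of a leg are equal, or one is a parent of the other, or they are the two
ends. -/
def Leg.Covered {V : Type} (par₁ par₂ : V → V ⊕ Bool) (a b : V ⊕ Bool) : Prop :=
  a = b ∨ (∃ c d, a = Sum.inr c ∧ b = Sum.inr d) ∨
    (∃ v, a = Sum.inl v ∧ (b = par₁ v ∨ b = par₂ v)) ∨
    ∃ v, b = Sum.inl v ∧ (a = par₁ v ∨ a = par₂ v)

theorem Leg.Covered.symm {V : Type} {par₁ par₂ : V → V ⊕ Bool} {a b : V ⊕ Bool}
    (h : Leg.Covered par₁ par₂ a b) : Leg.Covered par₁ par₂ b a := by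
  rcases h with rfl | ⟨c, d, rfl, rfl⟩ | h | h
  · exact Or.inl rfl
  · exact Or.inr (Or.inl ⟨d, c, rfl, rfl⟩)
  · exact Or.inr (Or.inr (Or.inr h))
  · exact Or.inr (Or.inr (Or.inl h))

/-- A certificate that the medial graph of a leg, with an edge added between its two ends
`inr false` and `inr true`, has treewidth at most two: the vertices can be removed in order of
increasing rank, and each of them has at most two remaining neighbours, its parents, which are
adjacent or equal. -/
structure Leg.Certificate (L : Leg) where
  V : Type
  fin : Finite V
  vert : L.D → V
  vert_surjective : Function.Surjective vert
  vert_eq : ∀ x y, vert x = vert y ↔ y = x ∨ y = L.s x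
  rank : V → ℕ
  par₁ : V → V ⊕ Bool
  par₂ : V → V ⊕ Bool
  rank₁ : ∀ v w, par₁ v = Sum.inl w → rank v < rank w
  rank₂ : ∀ v w, par₂ v = Sum.inl w → rank v < rank w
  parents : ∀ v, Leg.Covered par₁ par₂ (par₁ v) (par₂ v)
  edges : ∀ x, Leg.Covered par₁ par₂ (Leg.place vert false x) (Leg.place vert true (L.P x))

/-- Closing a leg at a vertex whose parents are the ends, the two ends are identified with that
vertex. -/
theorem Leg.Certificate.not_hasMinor {D : Type} [Finite D] {P s : Perm D} {d : D}
    (hs : FixFreeInvol s)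
    (T : (Leg.ofRooted P s d).Certificate) (h₁ : ∃ b, T.par₁ (T.vert d) = Sum.inr b)
    (h₂ : ∃ b, T.par₂ (T.vert d) = Sum.inr b) :
    ¬ (medialGraph P s).HasMinor (⊤ : SimpleGraph (Fin 4)) := by
  classical
  have := T.fin
  obtain ⟨M, hM⟩ : ∃ M, ∀ v, T.rank v < M := by
    obtain ⟨M, hM⟩ := Set.finite_range T.rank |>.bddAbove
    exact ⟨M + 1, fun v => Nat.lt_succ_of_le (hM ⟨v, rfl⟩)⟩
  have hvs : ∀ x y, T.vert x = T.vert y ↔ medialVertex s x = medialVertex s y := fun x y =>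
    (T.vert_eq x y).trans hs.medialVertex_eq.symm
  let φ : Quotient (SameCycle.setoid s) → T.V := Quotient.lift T.vert fun x y h =>
    (hvs x y).2 (Quotient.sound h)
  have hφ : ∀ x, φ (medialVertex s x) = T.vert x := fun x => rfl
  have hφb : Function.Bijective φ := by
    constructor
    · intro a b hab
      obtain ⟨x, rfl⟩ := medialVertex_surjective s a
      obtain ⟨y, rfl⟩ := medialVertex_surjective s b
      exact (hvs x y).1 hab
    · intro v
      obtain ⟨x, rfl⟩ := T.vert_surjective v
      exact ⟨medialVertex s x, rfl⟩
  let Φ := Equiv.ofBijective φ hφb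
  -- `τ` moves the two ends to the vertex of the root, which becomes the last vertex
  let τ : T.V ⊕ Bool → T.V := Sum.elim id fun _ => T.vert d
  let rk : T.V → ℕ := fun v => if v = T.vert d then M else T.rank v
  have hrk : ∀ v, rk v ≤ M := by
    intro v
    simp only [rk]
    split_ifs
    · exact le_rfl
    · exact (hM v).le
  have hcov : ∀ a b, Covered T.par₁ T.par₂ a b → τ a = τ b ∨
      τ b = τ (T.par₁ (τ a)) ∨ τ b = τ (T.par₂ (τ a)) ∨
      τ a = τ (T.par₁ (τ b)) ∨ τ a = τ (T.par₂ (τ b)) := by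
    rintro a b (rfl | ⟨c, d, rfl, rfl⟩ | ⟨v, rfl, rfl | rfl⟩ | ⟨v, rfl, rfl | rfl⟩)
    · exact Or.inl rfl
    · exact Or.inl rfl
    · exact Or.inr (Or.inl rfl)
    · exact Or.inr (Or.inr (Or.inl rfl))
    · exact Or.inr (Or.inr (Or.inr (Or.inl rfl)))
    · exact Or.inr (Or.inr (Or.inr (Or.inr rfl)))
  have hedge : ∀ x, Covered T.par₁ T.par₂ (Sum.inl (T.vert x)) (Sum.inl (T.vert (P x))) ∨
      ∃ b, x = d ∧ Covered T.par₁ T.par₂ (Sum.inr b) (Sum.inl (T.vert (P x))) := by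
    intro x
    by_cases hx : x = d
    · right
      refine ⟨false, hx, ?_⟩
      have := T.edges none
      rw [hx]
      change Covered _ _ _ (place _ _ (openPerm P d none)) at this
      rwa [openPerm_none] at this
    · left
      have := T.edges (some x)
      change Covered _ _ _ (place _ _ (openPerm P d (some x))) at this
      rwa [openPerm_of_ne hx] at this
  have hedge' : ∀ x, T.vert x = T.vert (P x) ∨
      T.vert (P x) = τ (T.par₁ (T.vert x)) ∨ T.vert (P x) = τ (T.par₂ (T.vert x)) ∨
      T.vert x = τ (T.par₁ (T.vert (P x))) ∨ T.vert x = τ (T.par₂ (T.vert (P x))) := by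
    intro x
    rcases hedge x with h | ⟨b, hx, h⟩
    · exact hcov _ _ h
    · rw [show T.vert x = T.vert d from congrArg _ hx]
      exact hcov _ _ h
  have hrank : ∀ (par : T.V → T.V ⊕ Bool), (∀ v w, par v = Sum.inl w → T.rank v < T.rank w) →
      (∃ b, par (T.vert d) = Sum.inr b) → ∀ v, τ (par v) ≠ v → rk v < rk (τ (par v)) := by
    intro par hpar hd v hv
    have hvd : v ≠ T.vert d := by
      rintro rfl
      obtain ⟨b, hb⟩ := hd
      rw [hb] at hv
      exact hv rfl
    rcases hw : par v with w | b
    · simp only [τ, Sum.elim_inl, id, rk, if_neg hvd]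
      split_ifs
      · exact hM v
      · exact hpar _ _ hw
    · simp only [τ, Sum.elim_inr, rk, if_neg hvd, if_true]
      exact hM v
  refine not_hasMinor_of_parents _ (fun q => rk (Φ q)) (fun q => Φ.symm (τ (T.par₁ (Φ q))))
    (fun q => Φ.symm (τ (T.par₂ (Φ q)))) ?_ ?_ ?_ ?_
  · intro u w huw
    simp only [Equiv.eq_symm_apply]
    rw [medialGraph_adj] at huw
    obtain ⟨hne, ⟨x, rfl, rfl⟩ | ⟨x, rfl, rfl⟩⟩ := huw
    · rcases hedge' x with h | h | h | h | h
      · exact absurd ((hvs _ _).1 h) hne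
      · exact Or.inl h
      · exact Or.inr (Or.inl h)
      · exact Or.inr (Or.inr (Or.inl h))
      · exact Or.inr (Or.inr (Or.inr h))
    · rcases hedge' x with h | h | h | h | h
      · exact absurd ((hvs _ _).1 h).symm hne
      · exact Or.inr (Or.inr (Or.inl h))
      · exact Or.inr (Or.inr (Or.inr h))
      · exact Or.inl h
      · exact Or.inr (Or.inl h)
  · intro q hq
    rw [Ne, Equiv.symm_apply_eq] at hq
    rw [Equiv.apply_symm_apply]
    exact hrank _ T.rank₁ h₁ _ hq
  · intro q hq
    rw [Ne, Equiv.symm_apply_eq] at hq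
    rw [Equiv.apply_symm_apply]
    exact hrank _ T.rank₂ h₂ _ hq
  · intro q _ _
    simp only [Equiv.apply_symm_apply, EmbeddingLike.apply_eq_iff_eq]
    rcases hcov _ _ (T.parents (Φ q)) with h | h | h | h | h
    · exact Or.inl h
    · exact Or.inr (Or.inr (Or.inr (Or.inl h)))
    · exact Or.inr (Or.inr (Or.inr (Or.inr h)))
    · exact Or.inr (Or.inl h)
    · exact Or.inr (Or.inr (Or.inl h))

section RingCertificate

variable {k : ℕ} {X : Type}

/-- The first parent of a vertex of a ring: the next vertex, or the first end. -/
def ringPar₁ (k : ℕ) (X : Type) (i : Fin (k + 1)) : (Fin (k + 1) ⊕ X) ⊕ Bool :=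
  if i = 0 ∨ i = Fin.last k then Sum.inr false else Sum.inl (Sum.inl (i + 1))

/-- The second parent of a vertex of a ring: the root vertex, or the second end. -/
def ringPar₂ (k : ℕ) (X : Type) (i : Fin (k + 1)) : (Fin (k + 1) ⊕ X) ⊕ Bool :=
  if i = 0 then Sum.inr true else Sum.inl (Sum.inl 0)

theorem Fin.last_add_one' (k : ℕ) : Fin.last k + 1 = 0 := by
  simp

theorem ring_parents_covered (q₁ q₂ : X → (Fin (k + 1) ⊕ X) ⊕ Bool) (i : Fin (k + 1)) :
    Leg.Covered (Sum.elim (ringPar₁ k X) q₁) (Sum.elim (ringPar₂ k X) q₂)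
      (ringPar₁ k X i) (ringPar₂ k X i) := by
  by_cases h0 : i = 0
  · exact Or.inr (Or.inl ⟨false, true, if_pos (Or.inl h0), if_pos h0⟩)
  by_cases hl : i = Fin.last k
  · refine Or.inr (Or.inr (Or.inr ⟨Sum.inl 0, if_neg h0, Or.inl ?_⟩))
    simp [ringPar₁, hl]
  · refine Or.inr (Or.inr (Or.inl ⟨Sum.inl (i + 1), if_neg (by tauto), Or.inr ?_⟩))
    have h1 : i + 1 ≠ 0 := by
      intro h
      rw [← Fin.last_add_one' k] at h
      exact hl (add_right_cancel h)
    simp [ringPar₂, h0, h1]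

theorem ring_succ_covered (q₁ q₂ : X → (Fin (k + 1) ⊕ X) ⊕ Bool) (i : Fin (k + 1)) :
    Leg.Covered (Sum.elim (ringPar₁ k X) q₁) (Sum.elim (ringPar₂ k X) q₂)
      (Sum.inl (Sum.inl i)) (Sum.inl (Sum.inl (i + 1))) := by
  by_cases hl : i = Fin.last k
  · rw [hl, Fin.last_add_one']
    by_cases h0 : Fin.last k = 0
    · rw [h0]
      exact Or.inl rfl
    · exact Or.inr (Or.inr (Or.inl ⟨_, rfl, Or.inr (if_neg h0).symm⟩))
  by_cases h0 : i = 0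
  · rw [h0, zero_add]
    by_cases h1 : (1 : Fin (k + 1)) = 0
    · rw [h1]
      exact Or.inl rfl
    · exact Or.inr (Or.inr (Or.inr ⟨_, rfl, Or.inr (if_neg h1).symm⟩))
  · exact Or.inr (Or.inr (Or.inl ⟨_, rfl, Or.inl (if_neg (by tauto)).symm⟩))

theorem ring_step_covered (q₁ q₂ : X → (Fin (k + 1) ⊕ X) ⊕ Bool) (κ : Bool) (e) :
    Leg.Covered (Sum.elim (ringPar₁ k X) q₁) (Sum.elim (ringPar₂ k X) q₂)
      (Sum.inl (Sum.inl e.1)) (Sum.inl (Sum.inl (ringPerm κ k e).1)) := by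
  obtain ⟨i, _ | _⟩ := e
  · have := (ring_succ_covered q₁ q₂ (i - 1)).symm
    rwa [sub_add_cancel] at this
  · exact ring_succ_covered q₁ q₂ i

theorem ring_entry_covered (q₁ q₂ : X → (Fin (k + 1) ⊕ X) ⊕ Bool) (κ : Bool) :
    Leg.Covered (Sum.elim (ringPar₁ k X) q₁) (Sum.elim (ringPar₂ k X) q₂)
      (Sum.inr false) (Sum.inl (Sum.inl (ringPerm κ k (0, false)).1)) := by
  refine Or.inr (Or.inr (Or.inr ⟨_, rfl, Or.inl ?_⟩))
  have : (ringPerm κ k (0, false)).1 = Fin.last k := by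
    change 0 - 1 = Fin.last k
    rw [sub_eq_iff_eq_add, Fin.last_add_one']
  rw [this]
  simp [ringPar₁]

end RingCertificate

namespace Leg.Certificate

variable {κ : Bool} {k : ℕ} {L : Fin (k + 1) × Bool → Leg} (T : ∀ e, (L e).Certificate)

/-- The vertices of a ring with legs. -/
abbrev RingV : Type := Fin (k + 1) ⊕ Σ e, (T e).V

/-- The places in a ring with legs that correspond to the places of the `e`-th leg. -/
def ringPlace (κ : Bool) (e : Fin (k + 1) × Bool) : (T e).V ⊕ Bool → RingV T ⊕ Bool
  | Sum.inl v => Sum.inl (Sum.inr ⟨e, v⟩)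
  | Sum.inr false => if e = (0, false) then Sum.inr false else Sum.inl (Sum.inl e.1)
  | Sum.inr true => Sum.inl (Sum.inl (ringPerm κ k e).1)

/-- The first parent in a ring with legs. -/
def ringP₁ (κ : Bool) : RingV T → RingV T ⊕ Bool :=
  Sum.elim (ringPar₁ k _) fun v => ringPlace T κ v.1 ((T v.1).par₁ v.2)

/-- The second parent in a ring with legs. -/
def ringP₂ (κ : Bool) : RingV T → RingV T ⊕ Bool :=
  Sum.elim (ringPar₂ k _) fun v => ringPlace T κ v.1 ((T v.1).par₂ v.2)

/-- The vertex of a dart in a ring with legs. -/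
def ringVert : (Σ e, Option (L e).D) → RingV T
  | ⟨e, none⟩ => Sum.inl e.1
  | ⟨e, some x⟩ => Sum.inr ⟨e, (T e).vert x⟩

theorem ringPlace_covered (e : Fin (k + 1) × Bool) {a b : (T e).V ⊕ Bool}
    (h : Covered (T e).par₁ (T e).par₂ a b) :
    Covered (ringP₁ T κ) (ringP₂ T κ) (ringPlace T κ e a) (ringPlace T κ e b) := by
  have hUW : Covered (ringP₁ T κ) (ringP₂ T κ) (ringPlace T κ e (Sum.inr false))
      (ringPlace T κ e (Sum.inr true)) := by
    by_cases he : e = (0, false)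
    · rw [he]
      exact ring_entry_covered _ _ κ
    · change Covered _ _ (if e = (0, false) then Sum.inr false else Sum.inl (Sum.inl e.1)) _
      rw [if_neg he]
      exact ring_step_covered _ _ κ e
  rcases h with rfl | ⟨c, d, rfl, rfl⟩ | ⟨v, rfl, rfl | rfl⟩ | ⟨v, rfl, rfl | rfl⟩
  · exact Or.inl rfl
  · cases c <;> cases d
    · exact Or.inl rfl
    · exact hUW
    · exact hUW.symm
    · exact Or.inl rfl
  · exact Or.inr (Or.inr (Or.inl ⟨Sum.inr ⟨e, v⟩, rfl, Or.inl rfl⟩))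
  · exact Or.inr (Or.inr (Or.inl ⟨Sum.inr ⟨e, v⟩, rfl, Or.inr rfl⟩))
  · exact Or.inr (Or.inr (Or.inr ⟨Sum.inr ⟨e, v⟩, rfl, Or.inl rfl⟩))
  · exact Or.inr (Or.inr (Or.inr ⟨Sum.inr ⟨e, v⟩, rfl, Or.inr rfl⟩))

theorem exists_rank_lt : ∃ M, ∀ e v, (T e).rank v < M := by
  have := fun e => (T e).fin
  obtain ⟨M, hM⟩ := (Set.finite_range fun v : Σ e, (T e).V => (T v.1).rank v.2).bddAbove
  exact ⟨M + 1, fun e v => Nat.lt_succ_of_le (hM ⟨⟨e, v⟩, rfl⟩)⟩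

/-- The rank in a ring with legs: the root vertex is removed last, preceded by the other vertices of
the ring, preceded by those of the legs. -/
noncomputable def ringRank : RingV T → ℕ :=
  Sum.elim (fun i => (exists_rank_lt T).choose + if i = 0 then k + 1 else i)
    fun v => (T v.1).rank v.2

theorem ringRank_lt {e : Fin (k + 1) × Bool} {v w} {p : (T e).V ⊕ Bool}
    (hp : ∀ u, p = Sum.inl u → (T e).rank v < (T e).rank u)
    (h : ringPlace T κ e p = Sum.inl w) : ringRank T (Sum.inr ⟨e, v⟩) < ringRank T w := by
  have hM := (exists_rank_lt T).choose_spec e v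
  have hcore : ∀ i, ringRank T (Sum.inr ⟨e, v⟩) < ringRank T (Sum.inl i) := by
    intro i
    change (T e).rank v < _ + _
    omega
  rcases p with u | _ | _
  · obtain rfl := Sum.inl_injective h
    exact hp u rfl
  · change (if e = (0, false) then Sum.inr false else Sum.inl (Sum.inl e.1)) = _ at h
    split_ifs at h
    obtain rfl := Sum.inl_injective h
    exact hcore _
  · obtain rfl := Sum.inl_injective h
    exact hcore _

theorem ringRank_core_lt {i : Fin (k + 1)} {w}
    (h : ringPar₁ k _ i = Sum.inl w ∨ ringPar₂ k _ i = Sum.inl w) :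
    ringRank T (Sum.inl i) < ringRank T w := by
  have hi := i.2
  have h0 : i ≠ 0 := by
    rintro rfl
    simp [ringPar₁, ringPar₂] at h
  have key : ∀ j : Fin (k + 1), j = i + 1 ∨ j = 0 → i ≠ Fin.last k ∨ j = 0 →
      ringRank T (Sum.inl i) < ringRank T (Sum.inl j) := by
    intro j hj hjl
    change _ + (if i = 0 then k + 1 else (i : ℕ)) < _ + (if j = 0 then k + 1 else (j : ℕ))
    rw [if_neg h0]
    split_ifs with hj0
    · omega
    · rcases hj with rfl | hj
      · have : ((i + 1 : Fin (k + 1)) : ℕ) = i + 1 := by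
          rw [Fin.val_add_one, if_neg (by tauto)]
        omega
      · exact absurd hj hj0
  rcases h with h | h
  · unfold ringPar₁ at h
    split_ifs at h with h1
    obtain rfl := Sum.inl_injective h
    exact key _ (Or.inl rfl) (Or.inl (by tauto))
  · unfold ringPar₂ at h
    rw [if_neg h0] at h
    obtain rfl := Sum.inl_injective h
    exact key _ (Or.inr rfl) (Or.inr rfl)

/-- The certificate of a ring with legs. -/
noncomputable def ring (κ : Bool) :
    (Leg.asm (ringPerm κ k) (ringFlip k) (0, false) L).Certificate where
  V := RingV T
  fin := by
    have := fun e => (T e).fin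
    infer_instance
  vert := ringVert T
  vert_surjective := by
    rintro (i | ⟨e, v⟩)
    · exact ⟨⟨(i, false), none⟩, rfl⟩
    · obtain ⟨x, rfl⟩ := (T e).vert_surjective v
      exact ⟨⟨e, some x⟩, rfl⟩
  vert_eq := by
    rintro ⟨e, _ | x⟩ ⟨e', _ | x'⟩
    · change Sum.inl e.1 = Sum.inl e'.1 ↔ (⟨e', none⟩ : Σ e, Option (L e).D) = ⟨e, none⟩ ∨
        (⟨e', none⟩ : Σ e, Option (L e).D) = ⟨ringFlip k e, none⟩
      have hinj : ∀ a b, (⟨a, none⟩ : Σ e, Option (L e).D) = ⟨b, none⟩ ↔ a = b :=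
        fun a b => ⟨fun h => congrArg Sigma.fst h, fun h => h ▸ rfl⟩
      rw [hinj, hinj, Sum.inl.injEq]
      obtain ⟨i, b⟩ := e
      obtain ⟨i', b'⟩ := e'
      change i = i' ↔ (i', b') = (i, b) ∨ (i', b') = (i, !b)
      cases b <;> cases b' <;> simp [eq_comm]
    · refine iff_of_false (fun h => by cases h) ?_
      rintro (h | h) <;> cases h
    · refine iff_of_false (fun h => by cases h) ?_
      rintro (h | h) <;> cases h
    · change Sum.inr (⟨e, (T e).vert x⟩ : Σ e, (T e).V) = Sum.inr ⟨e', (T e').vert x'⟩ ↔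
        (⟨e', some x'⟩ : Σ e, Option (L e).D) = ⟨e, some x⟩ ∨
        (⟨e', some x'⟩ : Σ e, Option (L e).D) = ⟨e, some ((L e).s x)⟩
      rw [Sum.inr.injEq]
      by_cases he : e = e'
      · subst he
        simp [(T e).vert_eq x x']
      · simp [he, Ne.symm he]
  rank := ringRank T
  par₁ := ringP₁ T κ
  par₂ := ringP₂ T κ
  rank₁ := by
    rintro (i | ⟨e, v⟩) w h
    · exact ringRank_core_lt T (Or.inl h)
    · exact ringRank_lt T ((T e).rank₁ v) h
  rank₂ := by
    rintro (i | ⟨e, v⟩) w h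
    · exact ringRank_core_lt T (Or.inr h)
    · exact ringRank_lt T ((T e).rank₂ v) h
  parents := by
    rintro (i | ⟨e, v⟩)
    · exact ring_parents_covered _ _ i
    · exact ringPlace_covered T e ((T e).parents v)
  edges := by
    -- the source of an edge of the linked map, as a place in the leg at the corner `e`
    have hplace : ∀ e (x : Option (L e).D), (⟨e, x⟩ : Σ e, Option (L e).D) ≠ ⟨(0, false), none⟩ →
        place (ringVert T) false (some ⟨e, x⟩) = ringPlace T κ e (place (T e).vert false x) := by
      rintro e (_ | x) hx
      · refine (if_neg ?_).symm
        rintro rfl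
        exact hx rfl
      · rfl
    -- the target of an edge of the linked map, as a place in the same leg
    have hplace' : ∀ e (x : Option (L e).D), place (ringVert T) true
        (some (linked (ringPerm κ k) (fun e => (L e).P) ⟨e, x⟩)) =
        ringPlace T κ e (place (T e).vert true ((L e).P x)) := by
      intro e x
      by_cases hx : (L e).P x = none
      · rw [linked_of_none hx, hx]
        rfl
      · rw [linked_of_ne hx]
        obtain ⟨y, hy⟩ := Option.ne_none_iff_exists'.1 hx
        rw [hy]
        rfl
    intro x
    change Covered _ _ _ (place _ true
      (openPerm (linked (ringPerm κ k) fun e => (L e).P) ⟨(0, false), none⟩ x))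
    rcases x with _ | ⟨e, x⟩
    · rw [openPerm_none, hplace']
      exact ringPlace_covered T (0, false) ((T (0, false)).edges none)
    · by_cases hx : (⟨e, x⟩ : Σ e, Option (L e).D) = ⟨(0, false), none⟩
      · rw [hx, openPerm_root]
        exact Or.inr (Or.inr (Or.inl ⟨Sum.inl 0, rfl, Or.inr rfl⟩))
      · rw [openPerm_of_ne hx, hplace', hplace e x hx]
        exact ringPlace_covered T e ((T e).edges x)

end Leg.Certificate

/-- The certificate of the leg of a code. -/
noncomputable def Code.certificate : (c : Code) → c.leg.Certificate
  | leaf => {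
      V := Empty
      fin := inferInstance
      vert := id
      vert_surjective := fun x => x.elim
      vert_eq := fun x => x.elim
      rank := fun x => x.elim
      par₁ := fun x => x.elim
      par₂ := fun x => x.elim
      rank₁ := fun x => x.elim
      rank₂ := fun x => x.elim
      parents := fun x => x.elim
      edges := by
        rintro (_ | x)
        · exact Or.inr (Or.inl ⟨false, true, rfl, rfl⟩)
        · exact x.elim }
  | node q ch => Leg.Certificate.ring (fun e => (ch e).certificate) q.1.1

namespace Code

variable (q : RingShape) (ch : Fin (q.1.2 + 1) × Bool → Code)

/-- The darts of the map described by a code with ring `q` and children `ch`. -/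
abbrev Dart : Type := Σ e, Option (ch e).leg.D

/-- The vertex permutation of the map described by a code. -/
noncomputable def perm : Perm (Dart q ch) := Leg.linked (ringPerm q.1.1 q.1.2) fun e => (ch e).leg.P

/-- The edges of the map described by a code. -/
noncomputable def flip : Perm (Dart q ch) := Leg.asmS (ringFlip q.1.2) fun e => (ch e).leg

/-- The root of the map described by a code. -/
def root : Dart q ch := ⟨(0, false), none⟩

theorem leg_node : (node q ch).leg = Leg.ofRooted (perm q ch) (flip q ch) (root q ch) := rfl

instance : Finite (Dart q ch) := by
  have := fun e => (ch e).leg_good.fin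
  infer_instance

theorem good : Good (perm q ch) (flip q ch) where
  inv := Leg.asmS_fixFree (ringFlip_fixFree _) fun e => (ch e).leg_good.inv
  conn := Leg.asm_connected (ring_connected _ _) fun e => (ch e).leg_good
  planar := Leg.asm_planar (ring_planar _ _) fun e => (ch e).leg_good
  free := by
    refine Leg.Certificate.not_hasMinor (d := root q ch)
      (Leg.asmS_fixFree (ringFlip_fixFree _) fun e => (ch e).leg_good.inv)
      (Leg.Certificate.ring (fun e => (ch e).certificate) q.1.1) ⟨false, ?_⟩ ⟨true, ?_⟩
    · change ringPar₁ _ _ 0 = _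
      exact if_pos (Or.inl rfl)
    · change ringPar₂ _ _ 0 = _
      exact if_pos rfl

end Code

/-! ### A map determines its code -/

/-- Isomorphism of legs. -/
def Leg.Isomorphic (L L' : Leg) : Prop :=
  ∃ f : L.D ≃ L'.D, (∀ x, L'.P (x.map f) = (L.P x).map f) ∧ ∀ x, f (L.s x) = L'.s (f x)

/-- An element `x` is cut off from `d` by a 2-edge-cut of the medial graph. -/
def CutOff {D : Type*} (P s : Perm D) (d x : D) : Prop :=
  ∃ S e, OneOut P s S e ∧ x ∈ S ∧ d ∉ S

theorem OneOut.image {D D' : Type*} {P s : Perm D} {P' s' : Perm D'} {S : Set D} {e : D}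
    (h : OneOut P s S e) {f : D → D'} (hf : Function.Injective f) (hP : ∀ x, f (P x) = P' (f x))
    (hs : ∀ x, f (s x) = s' (f x)) : OneOut P' s' (f '' S) (f e) where
  closed := by
    rintro _ ⟨x, hx, rfl⟩
    exact ⟨s x, h.closed x hx, hs x⟩
  mem := ⟨e, h.mem, rfl⟩
  out := by
    rw [← hP, hf.mem_set_image]
    exact h.out
  stay := by
    rintro _ ⟨x, hx, rfl⟩ hne
    rw [← hP, hf.mem_set_image]
    exact h.stay x hx fun hh => hne (congrArg f hh)

theorem CutOff.map {D D' : Type*} {P s : Perm D} {P' s' : Perm D'} {d x : D}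
    (h : CutOff P s d x) (f : D ≃ D') (hP : ∀ x, f (P x) = P' (f x))
    (hs : ∀ x, f (s x) = s' (f x)) : CutOff P' s' (f d) (f x) := by
  obtain ⟨S, e, hS, hx, hd⟩ := h
  exact ⟨f '' S, f e, hS.image f.injective hP hs, ⟨x, hx, rfl⟩, by rwa [f.injective.mem_set_image]⟩

theorem cutOff_iff {D D' : Type*} {P s : Perm D} {P' s' : Perm D'} {d x : D} (f : D ≃ D')
    (hP : ∀ x, f (P x) = P' (f x)) (hs : ∀ x, f (s x) = s' (f x)) :
    CutOff P' s' (f d) (f x) ↔ CutOff P s d x := by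
  refine ⟨fun h => ?_, fun h => h.map f hP hs⟩
  have := h.map f.symm (fun y => ?_) (fun y => ?_) (P' := P) (s' := s)
  · simpa using this
  · rw [Equiv.symm_apply_eq, hP, Equiv.apply_symm_apply]
  · rw [Equiv.symm_apply_eq, hs, Equiv.apply_symm_apply]

theorem Leg.Good.P_none {L : Leg} (hL : L.Good) [Nonempty L.D] : L.P none ≠ none := by
  intro h
  obtain ⟨x⟩ := ‹Nonempty L.D›
  have := hL.conn {none} rfl (fun y hy => hy ▸ h) (fun y hy => by cases hy)
  have hx : some x ∈ ({none} : Set (Option L.D)) := this ▸ trivial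
  cases hx

section Block

variable {K : Type} {p t : Perm K} {L : K → Leg}

/-- The inner darts of a leg are cut off from the rest. -/
theorem Leg.exists_oneOut_block (hL : ∀ e, (L e).Good) {e : K} (x : (L e).D) :
    ∃ o : (L e).D, OneOut (Leg.linked p fun e => (L e).P) (Leg.asmS t L)
      {y | ∃ z, y = ⟨e, some z⟩} ⟨e, some o⟩ := by
  have : Nonempty (L e).D := ⟨x⟩
  have hne : (L e).P⁻¹ none ≠ none := by
    rw [Ne, inv_eq_iff_eq]
    exact fun h => (hL e).P_none h.symm
  obtain ⟨o, ho⟩ := Option.ne_none_iff_exists'.1 hne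
  have ho' : (L e).P (some o) = none := by
    rw [← ho]
    simp
  refine ⟨o, ?_, ⟨o, rfl⟩, ?_, ?_⟩
  · rintro _ ⟨z, rfl⟩
    exact ⟨_, rfl⟩
  · rintro ⟨z, hz⟩
    rw [linked_of_none ho'] at hz
    have := congrArg (fun y : Σ e, Option (L e).D => y.2.isNone) hz
    simp at this
  · rintro _ ⟨z, rfl⟩ hz
    have hz' : (L e).P (some z) ≠ none := by
      rw [← ho']
      intro h
      have := (L e).P.injective h
      cases this
      exact hz rfl
    obtain ⟨w, hw⟩ := Option.ne_none_iff_exists'.1 hz'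
    exact ⟨w, by rw [linked_of_ne hz', hw]⟩

theorem Leg.exists_out_block [∀ e, Finite (L e).D] {e : K}
    {S : Set (Σ e, Option (L e).D)} (h : (⟨e, none⟩ : Σ e, Option (L e).D) ∈ S)
    (h' : (⟨p e, none⟩ : Σ e, Option (L e).D) ∉ S) :
    ∃ x, (⟨e, x⟩ : Σ e, Option (L e).D) ∈ S ∧ Leg.linked p (fun e => (L e).P) ⟨e, x⟩ ∉ S := by
  by_contra! hcon
  have hcl : ∀ x ∈ {x | (⟨e, x⟩ : Σ e, Option (L e).D) ∈ S},
      (L e).P x ∈ {x | (⟨e, x⟩ : Σ e, Option (L e).D) ∈ S} := by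
    intro x hx
    by_cases hnone : (L e).P x = none
    · rw [hnone]
      exact h
    · have := hcon x hx
      rwa [linked_of_ne hnone] at this
  have := hcon _ (inv_mem_of_closed hcl h)
  rw [linked_of_none (by simp)] at this
  exact h' this

end Block

namespace Code

variable {q : RingShape} {ch : Fin (q.1.2 + 1) × Bool → Code}

/-- The darts of the ring are those which are not cut off from the root by a 2-edge-cut. -/
theorem cutOff_iff_ne_none {y : Dart q ch} :
    CutOff (perm q ch) (flip q ch) (root q ch) y ↔ y.2 ≠ none := by
  have := fun e => (ch e).leg_good.fin
  constructor
  · rintro ⟨S, o, hS, hy, hd⟩ hnone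
    obtain ⟨⟨i, b⟩, x⟩ := y
    obtain rfl : x = none := hnone
    have hflip : ∀ i b, (⟨(i, b), none⟩ : Dart q ch) ∈ S → ∀ c, (⟨(i, c), none⟩ : Dart q ch) ∈ S := by
      intro i b h c
      have h2 : (⟨(i, !b), none⟩ : Dart q ch) ∈ S := hS.closed _ h
      cases b <;> cases c <;> assumption
    have hZ : ∃ j, (⟨(j, true), none⟩ : Dart q ch) ∈ S ∧ (⟨(j + 1, true), none⟩ : Dart q ch) ∉ S := by
      by_contra! hcon
      have := fin_induction (A := {j | (⟨(j, true), none⟩ : Dart q ch) ∈ S}) (hflip i b hy true) hcon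
      exact hd (hflip 0 true (this.ge trivial) false)
    have hZ' : ∃ j, (⟨(j, true), none⟩ : Dart q ch) ∉ S ∧ (⟨(j + 1, true), none⟩ : Dart q ch) ∈ S := by
      by_contra! hcon
      have := fin_induction (A := {j | (⟨(j, true), none⟩ : Dart q ch) ∉ S})
        (fun h => hd (hflip 0 true h false)) hcon
      exact (this.ge (trivial : i ∈ Set.univ)) (hflip i b hy true)
    obtain ⟨j, h1, h2⟩ := hZ
    obtain ⟨j', h1', h2'⟩ := hZ'
    -- the set is left at both ends of an arc of the ring
    obtain ⟨x, hx, hx'⟩ := Leg.exists_out_block (p := ringPerm q.1.1 q.1.2)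
      (L := fun e => (ch e).leg) (e := (j, true)) h1 fun h => h2 (hflip _ _ h true)
    obtain ⟨x', hy, hy'⟩ := Leg.exists_out_block (p := ringPerm q.1.1 q.1.2)
      (L := fun e => (ch e).leg) (e := (j' + 1, false)) (hflip _ _ h2' false) (by
        intro h
        have h3 : (⟨(j' + 1 - 1, true), none⟩ : Dart q ch) ∈ S := hflip _ _ h true
        rw [add_sub_cancel_right] at h3
        exact h1' h3)
    have e1 : _ = o := by_contra fun hne => hx' (hS.stay _ hx hne)
    have e2 : _ = o := by_contra fun hne => hy' (hS.stay _ hy hne)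
    have := congrArg (fun y => y.1.2) (e1.trans e2.symm)
    cases this
  · rintro hy
    obtain ⟨e, y⟩ := y
    have hy : y ≠ none := hy
    obtain ⟨x, rfl⟩ := Option.ne_none_iff_exists'.1 hy
    obtain ⟨o, ho⟩ := Leg.exists_oneOut_block (p := ringPerm q.1.1 q.1.2) (t := ringFlip q.1.2)
      (fun e => (ch e).leg_good) x
    refine ⟨_, _, ho, ⟨x, rfl⟩, ?_⟩
    rintro ⟨z, hz⟩
    have := congrArg Sigma.fst hz
    cases this
    cases eq_of_heq (Sigma.mk.inj_iff.1 hz).2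

/-- An isomorphism of the maps of two codes comes from isomorphisms of the rings and of the legs. -/
theorem exists_of_iso {q' : RingShape} {ch' : Fin (q'.1.2 + 1) × Bool → Code}
    (f : Dart q ch ≃ Dart q' ch') (hP : ∀ x, f (perm q ch x) = perm q' ch' (f x))
    (hs : ∀ x, f (flip q ch x) = flip q' ch' (f x)) (hr : f (root q ch) = root q' ch') :
    ∃ g : Fin (q.1.2 + 1) × Bool ≃ Fin (q'.1.2 + 1) × Bool,
      (∀ e, g (ringPerm q.1.1 q.1.2 e) = ringPerm q'.1.1 q'.1.2 (g e)) ∧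
      (∀ e, g (ringFlip q.1.2 e) = ringFlip q'.1.2 (g e)) ∧ g (0, false) = (0, false) ∧
      ∀ e, Leg.Isomorphic (ch e).leg (ch' (g e)).leg := by
  have := fun e => (ch e).leg_good.fin
  -- the elements of the legs are those cut off from the root, and isomorphisms preserve this
  have hcore : ∀ y, (f y).2 = none ↔ y.2 = none := by
    intro y
    have := cutOff_iff (P := perm q ch) (s := flip q ch) (d := root q ch) (x := y) f hP hs
    rw [hr, cutOff_iff_ne_none, cutOff_iff_ne_none] at this
    exact not_iff_not.1 this
  let g₀ : Fin (q.1.2 + 1) × Bool → Fin (q'.1.2 + 1) × Bool := fun e => (f ⟨e, none⟩).1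
  have hg₀ : ∀ e, f ⟨e, none⟩ = ⟨g₀ e, none⟩ := fun e =>
    Sigma.ext rfl (heq_of_eq ((hcore ⟨e, none⟩).2 rfl))
  have hg₀b : Function.Bijective g₀ := by
    constructor
    · intro a b hab
      have : f ⟨a, none⟩ = f ⟨b, none⟩ := by rw [hg₀, hg₀, hab]
      exact congrArg Sigma.fst (f.injective this)
    · intro e'
      obtain ⟨⟨e, x⟩, hy⟩ := f.surjective ⟨e', none⟩
      obtain rfl : x = none := (hcore ⟨e, x⟩).1 (by rw [hy])
      exact ⟨e, congrArg Sigma.fst hy⟩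
  -- a leg is connected to its corner, so it is mapped to the leg at the image of that corner
  have hblock : ∀ e x, (f ⟨e, x⟩).1 = g₀ e := by
    intro e x
    have := (ch e).leg_good.conn {x | (f ⟨e, x⟩).1 = g₀ e} rfl ?_ ?_
    · exact this.ge trivial
    · intro x hx
      by_cases hnone : (ch e).leg.P x = none
      · rw [hnone]
        rfl
      · have h1 : perm q ch ⟨e, x⟩ = ⟨e, (ch e).leg.P x⟩ := Leg.linked_of_ne hnone
        have h2 := hP ⟨e, x⟩
        rw [h1] at h2
        change (f ⟨e, (ch e).leg.P x⟩).1 = g₀ e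
        have h3 := (hcore ⟨e, (ch e).leg.P x⟩).not.2 hnone
        rw [h2] at h3 ⊢
        rcases hfx : f ⟨e, x⟩ with ⟨e', x'⟩
        have hx : (f ⟨e, x⟩).1 = g₀ e := hx
        rw [hfx] at h3 hx
        by_cases hx' : (ch' e').leg.P x' = none
        · have : perm q' ch' ⟨e', x'⟩ = ⟨_, none⟩ := Leg.linked_of_none hx'
          rw [this] at h3
          exact absurd rfl h3
        · have : perm q' ch' ⟨e', x'⟩ = ⟨e', _⟩ := Leg.linked_of_ne hx'
          rw [this]
          exact hx
    · intro x hx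
      change (f (flip q ch ⟨e, some x⟩)).1 = g₀ e
      rw [hs]
      have hx : (f ⟨e, some x⟩).1 = g₀ e := hx
      have h3 := (hcore ⟨e, some x⟩).not.2 (by simp)
      rcases hfx : f ⟨e, some x⟩ with ⟨e', x'⟩
      rw [hfx] at hx h3
      have h3 : x' ≠ none := h3
      obtain ⟨x', rfl⟩ := Option.ne_none_iff_exists'.1 h3
      exact hx
  have hF : ∀ e, ∃ F : (ch e).leg.D ≃ (ch' (g₀ e)).leg.D, ∀ x : Option (ch e).leg.D,
      f ⟨e, x⟩ = ⟨g₀ e, x.map F⟩ := by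
    intro e
    have h1 : ∀ x : (ch e).leg.D, ∃ x' : (ch' (g₀ e)).leg.D, f ⟨e, some x⟩ = ⟨g₀ e, some x'⟩ := by
      intro x
      have h3 := (hcore ⟨e, some x⟩).not.2 (by simp)
      have h4 := hblock e (some x)
      rcases hfx : f ⟨e, some x⟩ with ⟨e', x'⟩
      rw [hfx] at h3 h4
      have h3 : x' ≠ none := h3
      obtain ⟨x', rfl⟩ := Option.ne_none_iff_exists'.1 h3
      obtain rfl : e' = g₀ e := h4
      exact ⟨x', rfl⟩
    choose F hF using h1
    refine ⟨Equiv.ofBijective F ⟨?_, ?_⟩, ?_⟩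
    · intro a b hab
      have : f ⟨e, some a⟩ = f ⟨e, some b⟩ := by rw [hF, hF, hab]
      have := f.injective this
      exact Option.some_injective _ (eq_of_heq (Sigma.mk.inj_iff.1 this).2)
    · intro x'
      obtain ⟨⟨e', x⟩, hy⟩ := f.surjective ⟨g₀ e, some x'⟩
      have : e' = e := hg₀b.1 (by rw [← hblock e' x, hy])
      subst this
      have hx : x ≠ none := (hcore ⟨e', x⟩).not.1 (by rw [hy]; simp)
      obtain ⟨x, rfl⟩ := Option.ne_none_iff_exists'.1 hx
      refine ⟨x, ?_⟩
      rw [hF] at hy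
      exact Option.some_injective _ (eq_of_heq (Sigma.mk.inj_iff.1 hy).2)
    · rintro (_ | x)
      · exact hg₀ e
      · exact hF x
  choose F hF using hF
  -- the map leaves a leg at corresponding elements, and then follows the rings
  have hnone : ∀ e (x : Option (ch e).leg.D), (ch e).leg.P x = none →
      (ch' (g₀ e)).leg.P (x.map (F e)) = none ∧
      g₀ (ringPerm q.1.1 q.1.2 e) = ringPerm q'.1.1 q'.1.2 (g₀ e) := by
    intro e x hx
    have h1 : perm q ch ⟨e, x⟩ = ⟨_, none⟩ := Leg.linked_of_none hx
    have h2 := hP ⟨e, x⟩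
    rw [h1, hg₀, hF] at h2
    by_cases hx' : (ch' (g₀ e)).leg.P (x.map (F e)) = none
    · have h3 : perm q' ch' ⟨g₀ e, _⟩ = ⟨_, none⟩ := Leg.linked_of_none hx'
      rw [h3] at h2
      exact ⟨hx', congrArg Sigma.fst h2⟩
    · have h3 : perm q' ch' ⟨g₀ e, _⟩ = ⟨g₀ e, _⟩ := Leg.linked_of_ne hx'
      rw [h3] at h2
      have := congrArg (fun y : Dart q' ch' => y.2.isNone) h2
      simp at this
      exact absurd this hx'
  refine ⟨Equiv.ofBijective g₀ hg₀b, ?_, ?_, congrArg Sigma.fst hr, fun e => ⟨F e, ?_, ?_⟩⟩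
  · intro e
    exact (hnone e ((ch e).leg.P⁻¹ none) (by simp)).2
  · intro e
    have := hs ⟨e, none⟩
    rw [hg₀] at this
    exact congrArg Sigma.fst this
  · intro x
    by_cases hx : (ch e).leg.P x = none
    · rw [hx]
      exact (hnone e x hx).1
    · have h1 : perm q ch ⟨e, x⟩ = ⟨e, _⟩ := Leg.linked_of_ne hx
      have h2 := hP ⟨e, x⟩
      rw [h1, hF, hF] at h2
      by_cases hx' : (ch' (g₀ e)).leg.P (x.map (F e)) = none
      · have h3 : perm q' ch' ⟨g₀ e, _⟩ = ⟨_, none⟩ := Leg.linked_of_none hx'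
        rw [h3] at h2
        have := congrArg (fun y : Dart q' ch' => y.2.isNone) h2
        simp at this
        exact absurd this hx
      · have h3 : perm q' ch' ⟨g₀ e, _⟩ = ⟨g₀ e, _⟩ := Leg.linked_of_ne hx'
        rw [h3] at h2
        exact (eq_of_heq (Sigma.mk.inj_iff.1 h2).2).symm
  · intro x
    have h2 := hs ⟨e, some x⟩
    change f ⟨e, some _⟩ = _ at h2
    rw [hF, hF] at h2
    exact Option.some_injective _ (eq_of_heq (Sigma.mk.inj_iff.1 h2).2)

end Code

theorem ringShape_eq {κ κ' : Bool} {k k' : ℕ} (hq : (κ, k) ≠ (false, 1)) (hq' : (κ', k') ≠ (false, 1))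
    (g : Fin (k + 1) × Bool ≃ Fin (k' + 1) × Bool)
    (h : ∀ e, g (ringPerm κ k e) = ringPerm κ' k' (g e)) : κ = κ' ∧ k = k' := by
  have hk : k = k' := by
    have := Fintype.card_congr g
    simpa using this
  subst hk
  refine ⟨?_, rfl⟩
  -- the two kinds of ring are distinguished by the order of `ringPerm`
  have key : ∀ g : Fin (k + 1) × Bool ≃ Fin (k + 1) × Bool, (false, k) ≠ (false, 1) →
      ¬ ∀ e, g (ringPerm true k e) = ringPerm false k (g e) := by
    intro g hk h
    have h1 : ∀ e, ringPerm false k (ringPerm false k e) = e := by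
      intro e
      obtain ⟨e, rfl⟩ := g.surjective e
      rw [← h, ← h, (ringPerm_true_fixFree k e).1]
    have h2 : ∀ e, ringPerm false k e ≠ e := by
      intro e
      obtain ⟨e, rfl⟩ := g.surjective e
      rw [← h, Ne, g.injective.eq_iff]
      exact (ringPerm_true_fixFree k e).2
    have h3 : (0 + 1 + 1 : Fin (k + 1)) = 0 := congrArg Prod.fst (h1 (0, true))
    have h4 : k ≠ 1 := fun hh => hk (by rw [hh])
    rcases k with _ | _ | k
    · exact h2 (0, true) (Prod.ext (Fin.ext (by omega)) rfl)
    · exact h4 rfl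
    · rw [zero_add, Fin.ext_iff, Fin.val_add, Fin.val_one', Fin.val_zero] at h3
      rw [Nat.mod_eq_of_lt (by omega : 1 < k + 1 + 1 + 1), Nat.mod_eq_of_lt (by omega)] at h3
      omega
  cases κ <;> cases κ'
  · rfl
  · refine absurd (fun e => ?_) (key g.symm hq)
    rw [Equiv.symm_apply_eq, h, Equiv.apply_symm_apply]
  · exact absurd h (key g hq')
  · rfl

theorem Leg.Isomorphic.card_eq {L L' : Leg} (h : L.Isomorphic L') : Nat.card L.D = Nat.card L'.D :=
  Nat.card_congr h.choose

/-- An isomorphism of legs obtained by opening maps is an isomorphism of rooted maps. -/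
theorem Leg.Isomorphic.of_ofRooted {D D' : Type} {P s : Perm D} {P' s' : Perm D'} {d : D} {d' : D'}
    (h : (Leg.ofRooted P s d).Isomorphic (Leg.ofRooted P' s' d')) :
    ∃ f : D ≃ D', (∀ x, f (P x) = P' (f x)) ∧ (∀ x, f (s x) = s' (f x)) ∧ f d = d' := by
  obtain ⟨f, hP, hs⟩ := h
  have hP : ∀ x : Option D, openPerm P' d' (x.map f) = (openPerm P d x).map f := hP
  have hd : f d = d' := by
    by_contra hne
    have := hP (some d)
    rw [openPerm_root, Option.map_some, openPerm_of_ne hne] at this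
    cases this
  refine ⟨f, fun x => ?_, hs, hd⟩
  by_cases hx : x = d
  · have := hP none
    rw [openPerm_none, Option.map_none, openPerm_none] at this
    rw [hx, hd]
    exact (Option.some_injective _ this).symm
  · have hx' : f x ≠ d' := fun h => hx (f.injective (h.trans hd.symm))
    have := hP (some x)
    rw [openPerm_of_ne hx, Option.map_some, openPerm_of_ne hx'] at this
    exact (Option.some_injective _ this).symm

/-- Codes of isomorphic legs are equal. -/
theorem Code.eq_of_isomorphic (c : Code) : ∀ c' : Code, c.leg.Isomorphic c'.leg → c = c' := by
  induction c with
  | leaf =>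
    intro c' h
    cases c' with
    | leaf => rfl
    | node q ch =>
      have := h.card_eq
      rw [card_leg, card_leg] at this
      simp only [size] at this
      omega
  | node q ch ih =>
    intro c' h
    cases c' with
    | leaf =>
      have := h.card_eq
      rw [card_leg, card_leg] at this
      simp only [size] at this
      omega
    | node q' ch' =>
      rw [leg_node, leg_node] at h
      obtain ⟨f, hP, hs, hr⟩ := h.of_ofRooted
      obtain ⟨g, gp, gt, gr, gL⟩ := exists_of_iso f hP hs hr
      have hqq : q = q' := by
        obtain ⟨h1, h2⟩ := ringShape_eq q.2 q'.2 g gp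
        exact Subtype.ext (Prod.ext h1 h2)
      subst hqq
      have hg := ring_connected q.1.1 q.1.2 {e | g e = e} ⟨_, gr⟩
        (fun e he => by rw [Set.mem_ofPred_eq, gp, show g e = e from he])
        (fun e he => by rw [Set.mem_ofPred_eq, gt, show g e = e from he])
      congr 1
      funext e
      have := ih e _ (gL e)
      rwa [show g e = e from hg.ge (trivial : e ∈ Set.univ)] at this

/-! ### Every map has a code -/

/-- The part `T` of a map is a copy of the leg `L`, together with the dart `a` in place of `none`:
`P` enters the copy from `a`, and leaves it towards `b`. -/
def Leg.Fits {D : Type*} (P s : Perm D) (L : Leg) (a b : D) (T : Set D) : Prop :=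
  ∃ j : Option L.D → D, Function.Injective j ∧ Set.range j = T ∧ j none = a ∧
    (∀ x, j (some (L.s x)) = s (j (some x))) ∧ (∀ x, L.P x = none → P (j x) = b) ∧
    ∀ x, L.P x ≠ none → P (j x) = j (L.P x)

theorem Leg.exists_equiv_of_fits {D : Type*} {P s : Perm D} {K : Type} {p t : Perm K} {L : K → Leg}
    {N : K → D} {T : K → Set D} (hN : ∀ e, N (t e) = s (N e))
    (hfit : ∀ e, Leg.Fits P s (L e) (N e) (N (p e)) (T e))
    (hdisj : ∀ e e' z, z ∈ T e → z ∈ T e' → e = e') (huniv : ∀ z, ∃ e, z ∈ T e) :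
    ∃ J : (Σ e, Option (L e).D) ≃ D, (∀ y, J (Leg.linked p (fun e => (L e).P) y) = P (J y)) ∧
      (∀ y, J (Leg.asmS t L y) = s (J y)) ∧ ∀ e, J ⟨e, none⟩ = N e := by
  choose j hinj hrange hnone hs hout hin using hfit
  refine ⟨Equiv.ofBijective (fun y => j y.1 y.2) ⟨?_, ?_⟩, ?_, ?_, hnone⟩
  · rintro ⟨e, x⟩ ⟨e', x'⟩ h
    have h : j e x = j e' x' := h
    have h1 : j e x ∈ T e := hrange e ▸ Set.mem_range_self x
    have h2 : j e x ∈ T e' := h ▸ hrange e' ▸ Set.mem_range_self x'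
    obtain rfl := hdisj e e' _ h1 h2
    rw [hinj e h]
  · intro z
    obtain ⟨e, he⟩ := huniv z
    rw [← hrange] at he
    obtain ⟨x, hx⟩ := he
    exact ⟨⟨e, x⟩, hx⟩
  · rintro ⟨e, x⟩
    change j _ _ = P (j e x)
    by_cases hx : (L e).P x = none
    · rw [linked_of_none hx, hout e x hx]
      exact hnone _
    · rw [linked_of_ne hx, hin e x hx]
  · rintro ⟨e, _ | x⟩
    · change j (t e) none = s (j e none)
      rw [hnone, hnone, hN]
    · exact hs e x

theorem Leg.fits_leaf {D : Type*} (P s : Perm D) (a : D) :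
    Leg.Fits P s Code.leaf.leg a (P a) {a} := by
  refine ⟨fun _ => a, ?_, Set.range_const, rfl, fun x => x.elim, fun _ _ => rfl, ?_⟩
  · rintro (_ | x) (_ | y) _
    · rfl
    · exact y.elim
    · exact x.elim
    · exact x.elim
  · rintro (_ | x) hx
    · exact absurd rfl hx
    · exact x.elim

theorem Leg.fits_ofRooted {D : Type*} {P s : Perm D} {D₁ : Type} {P₁ s₁ : Perm D₁} {d₁ : D₁}
    {J : D₁ → D} {f : D} (hJ : Function.Injective J) (hf : ∀ y, J y ≠ f)
    (hP : ∀ y, y ≠ d₁ → J (P₁ y) = P (J y)) (hPf : J (P₁ d₁) = P f)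
    (hs : ∀ y, J (s₁ y) = s (J y)) :
    Leg.Fits P s (Leg.ofRooted P₁ s₁ d₁) f (P (J d₁)) (insert f (Set.range J)) := by
  refine ⟨fun x : Option D₁ => x.elim f J, ?_, ?_, rfl, hs, ?_, ?_⟩
  · rintro (_ | x) (_ | y) hxy
    · rfl
    · exact (hf y hxy.symm).elim
    · exact (hf x hxy).elim
    · rw [hJ hxy]
  · ext z
    constructor
    · rintro ⟨_ | y, rfl⟩
      · exact Or.inl rfl
      · exact Or.inr ⟨y, rfl⟩
    · rintro (rfl | ⟨y, rfl⟩)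
      · exact ⟨none, rfl⟩
      · exact ⟨some y, rfl⟩
  · intro (x : Option D₁) (hx : openPerm P₁ d₁ x = none)
    obtain rfl : x = some d₁ := (openPerm P₁ d₁).injective (hx.trans openPerm_root.symm)
    rfl
  · intro (x : Option D₁) (hx : openPerm P₁ d₁ x ≠ none)
    change P (x.elim f J) = (openPerm P₁ d₁ x).elim f J
    rcases x with _ | y
    · rw [openPerm_none]
      exact hPf.symm
    · have hy : y ≠ d₁ := by
        rintro rfl
        exact hx openPerm_root
      rw [openPerm_of_ne hy]
      exact (hP y hy).symm

/-- A connected planar map all of whose vertices have degree two is a cycle. -/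
theorem exists_ring {D : Type*} [Finite D] {P s : Perm D} (hP : FixFreeInvol P)
    (hs : FixFreeInvol s) (hc : PermConnected P s) (hp : Planar P s) (d : D) :
    ∃ (k : ℕ) (N : Fin (k + 1) × Bool → D), Function.Bijective N ∧ N (0, false) = d ∧
      (∀ e, N (ringFlip k e) = s (N e)) ∧ ∀ e, N (ringPerm true k e) = P (N e) := by
  set Q := P * s with hQ
  have hQs : ∀ x, P (s x) = Q x := fun x => rfl
  have hpos : 0 < Function.minimalPeriod Q d :=
    Function.minimalPeriod_pos_of_mem_periodicPts
      (Function.mem_periodicPts.2 ⟨orderOf Q, orderOf_pos Q, by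
        rw [Function.IsPeriodicPt, Function.IsFixedPt, ← Equiv.Perm.coe_pow, pow_orderOf_eq_one]
        rfl⟩)
  obtain ⟨k, hk⟩ : ∃ k, Function.minimalPeriod Q d = k + 1 := ⟨_, (Nat.succ_pred_eq_of_pos hpos).symm⟩
  have hper : Q^[k + 1] d = d := hk ▸ Function.iterate_minimalPeriod
  -- planarity excludes that the orbit of `Q` is everything
  have hcyc : cyc Q = 2 := by
    have h1 := hP.two_mul_cyc
    have h2 := hs.two_mul_cyc
    unfold Planar at hp
    rw [← hQ] at hp
    have h3 : 0 < Nat.card D := Nat.card_pos_iff.2 ⟨⟨d⟩, inferInstance⟩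
    omega
  let O : Fin (k + 1) → D := fun i => Q^[i] d
  have hO : ∀ i, O (i + 1) = Q (O i) := by
    intro i
    change Q^[((i + 1 : Fin (k + 1)) : ℕ)] d = Q (Q^[i] d)
    rw [← Function.iterate_succ_apply' Q, Fin.val_add_one]
    split_ifs with h
    · rw [h, Fin.val_last, Nat.succ_eq_add_one, hper]
      rfl
    · rfl
  have hOinj : Function.Injective O := by
    intro i j hij
    have := Function.iterate_injOn_Iio_minimalPeriod (f := Q) (x := d)
      (show (i : ℕ) ∈ Set.Iio _ by rw [hk]; exact i.2)
      (show (j : ℕ) ∈ Set.Iio _ by rw [hk]; exact j.2) hij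
    exact Fin.ext this
  have hOcl : ∀ x ∈ Set.range O, Q x ∈ Set.range O := by
    rintro _ ⟨i, rfl⟩
    exact ⟨i + 1, hO i⟩
  have hsQ : ∀ x, Q (s (Q x)) = s x := by
    intro x
    rw [← hQs, (hs _).1, ← hQs, (hP _).1]
  have hsep : ∀ i j, s (O i) ≠ O j := by
    intro i j hij
    -- otherwise the orbit of `Q` is closed under everything
    have hscl : ∀ x ∈ Set.range O, s x ∈ Set.range O := by
      have : ∀ n : Fin (k + 1), s (O n) ∈ Set.range O := by
        have := fin_induction (A := {n | s (O n) ∈ Set.range O}) (i := i) ⟨j, hij.symm⟩ ?_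
        · exact fun n => this.ge trivial
        · intro n hn
          change s (O (n + 1)) ∈ Set.range O
          rw [hO]
          refine (mem_iff_of_closed hOcl).1 ?_
          rw [hsQ]
          exact hn
      rintro _ ⟨n, rfl⟩
      exact this n
    have hPcl : ∀ x ∈ Set.range O, P x ∈ Set.range O := by
      intro x hx
      have := hOcl _ (hscl x hx)
      rwa [← hQs, (hs x).1] at this
    have huniv := hc (Set.range O) ⟨O 0, 0, rfl⟩ hPcl hscl
    have : cyc Q = 1 := by
      refine cyc_eq_one d fun x => ?_
      obtain ⟨i, rfl⟩ : x ∈ Set.range O := huniv ▸ Set.mem_univ x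
      exact ⟨(i : ℕ), by rw [zpow_natCast, Equiv.Perm.coe_pow]⟩
    omega
  let N : Fin (k + 1) × Bool → D := fun e => if e.2 then s (O e.1) else O e.1
  have hNt : ∀ i, N (i, true) = s (O i) := fun i => rfl
  have hNf : ∀ i, N (i, false) = O i := fun i => rfl
  have hflip : ∀ e, N (ringFlip k e) = s (N e) := by
    rintro ⟨i, _ | _⟩
    · rfl
    · exact ((hs _).1).symm
  have hring : ∀ e, N (ringPerm true k e) = P (N e) := by
    rintro ⟨i, _ | _⟩
    · change N (i - 1, true) = P (N (i, false))
      rw [hNt, hNf, ← sub_add_cancel i 1, add_sub_cancel_right, hO, ← hQs, (hP _).1]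
    · change N (i + 1, false) = P (N (i, true))
      rw [hNt, hNf, hO, hQs]
  refine ⟨k, N, ⟨?_, ?_⟩, rfl, hflip, hring⟩
  · rintro ⟨i, _ | _⟩ ⟨j, _ | _⟩ h
    · exact Prod.ext (hOinj h) rfl
    · exact absurd h.symm (hsep _ _)
    · exact absurd h (hsep _ _)
    · exact Prod.ext (hOinj (s.injective h)) rfl
  · rw [← Set.range_eq_univ]
    refine hc _ ⟨_, (0, false), rfl⟩ ?_ ?_
    · rintro _ ⟨e, rfl⟩
      exact ⟨_, hring e⟩
    · rintro _ ⟨e, rfl⟩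
      exact ⟨_, hflip e⟩

/-- A map whose medial graph has no 2-edge-cut is a ring. -/
theorem NoCut.exists_ring {D : Type*} [Finite D] {P s : Perm D} (hg : Good P s) (hn : NoCut P s)
    (d : D) : ∃ (q : RingShape) (N : Fin (q.1.2 + 1) × Bool → D), Function.Bijective N ∧
      N (0, false) = d ∧ (∀ e, N (ringFlip q.1.2 e) = s (N e)) ∧
      ∀ e, N (ringPerm q.1.1 q.1.2 e) = P (N e) := by
  have : Nonempty D := ⟨d⟩
  by_cases hP : FixFreeInvol P
  · obtain ⟨k, N, hN⟩ := _root_.exists_ring hP hg.inv hg.conn hg.planar d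
    exact ⟨⟨(true, k), by simp⟩, N, hN⟩
  · have hQ := (hn.fixFreeInvol_or _ rfl hg).resolve_left hP
    obtain ⟨k, N, hN, hd, ht, hp⟩ := _root_.exists_ring hQ hg.inv hg.dual.conn hg.dual.planar d
    have hp' : ∀ e, N (ringPerm true k (ringFlip k e)) = P (N e) := by
      intro e
      rw [hp, ht, mul_apply, (hg.inv _).1]
    have hk : (false, k) ≠ (false, 1) := by
      intro hk
      obtain rfl : k = 1 := congrArg Prod.snd hk
      refine hP fun x => ?_
      obtain ⟨e, rfl⟩ := hN.2 x
      rw [← hp', ← hp', hN.1.eq_iff, Ne, hN.1.eq_iff]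
      revert e
      simp only [ringPerm, ringFlip]
      decide
    -- the dual ring runs in the opposite direction
    let σ : Fin (k + 1) × Bool ≃ Fin (k + 1) × Bool := Equiv.prodCongr (Equiv.neg _) (Equiv.refl _)
    refine ⟨⟨(false, k), hk⟩, N ∘ σ, hN.comp σ.bijective, ?_, ?_, ?_⟩
    · change N (-0, false) = d
      rw [neg_zero, hd]
    · intro e
      exact ht (σ e)
    · intro e
      change _ = P (N (σ e))
      rw [← hp']
      refine congrArg N ?_
      obtain ⟨i, _ | _⟩ := e
      · exact Prod.ext (neg_sub' i 1 |>.trans (by change -i - -1 = -i + 1; simp)) rfl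
      · exact Prod.ext (by change -(i + 1) = -i - 1; rw [neg_add', sub_eq_add_neg]) rfl

/-- A 2-edge-cut of one of the two parts of a map cut in two is one of the map itself. -/
theorem OneOut.union {D : Type*} [Finite D] [DecidableEq D] {P s : Perm D} {S B : Set D} {e f o : D}
    (h : OneOut P s S e) (h' : OneOut P s Sᶜ f) (hB : OneOut (P * swap e f) s B o) (hBS : B ⊆ Sᶜ)
    (hf : f ∈ B ∨ (P * swap e f) f ∈ B) : ∃ o, OneOut P s (S ∪ B) o := by
  have hPe : (P * swap e f) f = P e := by rw [mul_apply, swap_apply_right]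
  have hPf : P f ∈ S := not_not.1 h'.out
  have hP : ∀ x ∈ B, x ≠ f → (P * swap e f) x = P x := by
    intro x hx hxf
    rw [mul_apply, swap_apply_of_ne_of_ne (by rintro rfl; exact hBS hx h.mem) hxf]
  have hcl : ∀ x ∈ S ∪ B, s x ∈ S ∪ B := fun x hx => hx.imp (h.closed x) (hB.closed x)
  by_cases hfo : f = o
  · subst hfo
    refine ⟨e, hcl, Or.inl h.mem, ?_, ?_⟩
    · rintro (hh | hh)
      · exact h.out hh
      · exact hB.out (hPe ▸ hh)
    · rintro x (hx | hx) hxe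
      · exact Or.inl (h.stay x hx hxe)
      · by_cases hxf : x = f
        · exact Or.inl (hxf ▸ hPf)
        · exact Or.inr (hP x hx hxf ▸ hB.stay x hx hxf)
  · have hfB : P e ∈ B := by
      rw [← hPe]
      exact hf.elim (fun hf => hB.stay f hf hfo) id
    refine ⟨o, hcl, Or.inr hB.mem, ?_, ?_⟩
    · rintro (hh | hh)
      · exact h'.stay o (hBS hB.mem) (Ne.symm hfo) hh
      · exact hB.out (hP o hB.mem (Ne.symm hfo) ▸ hh)
    · rintro x (hx | hx) hxo
      · by_cases hxe : x = e
        · exact Or.inr (hxe ▸ hfB)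
        · exact Or.inl (h.stay x hx hxe)
      · by_cases hxf : x = f
        · exact Or.inl (hxf ▸ hPf)
        · exact Or.inr (hP x hx hxf ▸ hB.stay x hx hxo)

/-- Every rooted connected planar `K₄`-minor-free map has a code. -/
theorem exists_code (n : ℕ) {D : Type} [Finite D] (hcard : Nat.card D = n) {P s : Perm D}
    (hg : Good P s) (d : D) : ∃ (q : RingShape) (ch : Fin (q.1.2 + 1) × Bool → Code)
      (J : Code.Dart q ch ≃ D), (∀ y, J (Code.perm q ch y) = P (J y)) ∧
      (∀ y, J (Code.flip q ch y) = s (J y)) ∧ J (Code.root q ch) = d := by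
  classical
  induction n using Nat.strong_induction_on generalizing D with
  | _ n ih =>
  by_cases hn : NoCut P s
  · obtain ⟨q, N, hN, hd, ht, hp⟩ := hn.exists_ring hg d
    obtain ⟨J, hJ, hJs, hJN⟩ := Leg.exists_equiv_of_fits (P := P) (s := s)
      (p := ringPerm q.1.1 q.1.2) (t := ringFlip q.1.2) (L := fun _ => Code.leaf.leg) (N := N)
      (T := fun e => {N e}) ht (fun e => by rw [hp]; exact Leg.fits_leaf P s _)
      (fun e e' z h h' => hN.1 (h.symm.trans h')) (fun z => by
        obtain ⟨e, rfl⟩ := hN.2 z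
        exact ⟨e, rfl⟩)
    exact ⟨q, fun _ => Code.leaf, J, hJ, hJs, (hJN _).trans hd⟩
  -- a maximal part that can be cut off from the root
  obtain ⟨S, ⟨⟨e, he⟩, hdS⟩, hmax⟩ :
      ∃ S, Maximal (fun S => (∃ e, OneOut P s S e) ∧ d ∉ S) S := by
    have hne : {S : Set D | (∃ e, OneOut P s S e) ∧ d ∉ S}.Nonempty := by
      unfold NoCut at hn
      push Not at hn
      obtain ⟨S, e, he⟩ := hn
      by_cases hdS : d ∈ S
      · exact ⟨Sᶜ, he.exists_compl, fun h => h hdS⟩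
      · exact ⟨S, ⟨e, he⟩, hdS⟩
    exact (Set.toFinite _).exists_maximal hne
  obtain ⟨f, hf⟩ := he.exists_compl
  have he' : OneOut P s Sᶜᶜ e := by rwa [compl_compl]
  have hlt : ∀ A : Set D, A ≠ Set.univ → Nat.card A < n := by
    intro A hA
    rw [← hcard, Nat.card_coe_set_eq, ← Set.ncard_univ]
    exact Set.ncard_lt_ncard (Set.ssubset_univ_iff.2 hA)
  have hS1 : Nat.card S < n := hlt _ fun h => hdS (h ▸ trivial)
  have hS0 : Nat.card (Sᶜ : Set D) < n := hlt _ fun h => (h.ge (trivial : e ∈ Set.univ)) he.mem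
  obtain ⟨q₁, ch₁, J₁, hP₁, hs₁, hr₁⟩ := ih _ hS1 rfl (he.good hf hg) ⟨e, he.mem⟩
  obtain ⟨q, ch, J, hP, hs, hr⟩ := ih _ hS0 rfl (hf.good he' hg) ⟨d, hdS⟩
  have hPf : (P * swap e f) f = P e := by rw [mul_apply, swap_apply_right]
  have hP₁' : ∀ y, (J₁ (Code.perm q₁ ch₁ y) : D) = (P * swap e f) (J₁ y) := fun y =>
    congrArg Subtype.val (hP₁ y)
  have hs₁' : ∀ y, (J₁ (Code.flip q₁ ch₁ y) : D) = s (J₁ y) := fun y =>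
    congrArg Subtype.val (hs₁ y)
  have hP' : ∀ y, (J (Code.perm q ch y) : D) = (P * swap e f) (J y) := by
    intro y
    rw [swap_comm]
    exact congrArg Subtype.val (hP y)
  have hs' : ∀ y, (J (Code.flip q ch y) : D) = s (J y) := fun y => congrArg Subtype.val (hs y)
  obtain ⟨⟨e₀, x₀⟩, hx₀⟩ := J.surjective ⟨f, hf.mem⟩
  have hx₀' : (J ⟨e₀, x₀⟩ : D) = f := congrArg Subtype.val hx₀
  -- by maximality, the cut-off part is attached at a bare corner of the ring of the rest
  have hempty : IsEmpty (ch e₀).leg.D := by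
    by_contra hne
    rw [not_isEmpty_iff] at hne
    obtain ⟨o, ho⟩ := Leg.exists_oneOut_block (p := ringPerm q.1.1 q.1.2) (t := ringFlip q.1.2)
      (fun e => (ch e).leg_good) hne.some
    have hB := ho.image (f := fun y => (J y : D)) (Subtype.val_injective.comp J.injective) hP' hs'
    set B := (fun y => (J y : D)) '' {y | ∃ z, y = (⟨e₀, some z⟩ : Code.Dart q ch)} with hBdef
    have hBS : B ⊆ Sᶜ := by
      rintro _ ⟨y, _, rfl⟩
      exact (J y).2
    have hfB : f ∈ B ∨ (P * swap e f) f ∈ B := by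
      rcases x₀ with _ | x
      · right
        obtain ⟨z, hz⟩ := Option.ne_none_iff_exists'.1 (ch e₀).leg_good.P_none
        refine ⟨⟨e₀, some z⟩, ⟨z, rfl⟩, ?_⟩
        have h1 : Code.perm q ch ⟨e₀, none⟩ = ⟨e₀, _⟩ :=
          Leg.linked_of_ne (ch e₀).leg_good.P_none
        have h2 := hP' ⟨e₀, none⟩
        rw [h1, hx₀', hz] at h2
        exact h2
      · exact Or.inl ⟨_, ⟨x, rfl⟩, hx₀'⟩
    have hdB : d ∉ B := by
      rintro ⟨_, ⟨z, rfl⟩, hz⟩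
      have : J (⟨e₀, some z⟩ : Code.Dart q ch) = J (Code.root q ch) := by
        rw [hr]
        exact Subtype.ext hz
      have := congrArg (fun y : Code.Dart q ch => y.2.isNone) (J.injective this)
      simp [Code.root] at this
    have := hmax ⟨he.union hf hB hBS hfB, fun h => h.elim hdS hdB⟩ Set.subset_union_left
    exact hBS hB.mem (this (Or.inr hB.mem))
  obtain rfl : x₀ = none := by
    rcases x₀ with _ | x
    · rfl
    · exact hempty.elim x
  have hne_f : ∀ e' x, e' ≠ e₀ → (J ⟨e', x⟩ : D) ≠ f := by
    intro e' x hne h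
    have := J.injective (Subtype.ext (h.trans hx₀'.symm))
    exact hne (congrArg Sigma.fst this)
  let T : Fin (q.1.2 + 1) × Bool → Set D := fun e' =>
    if e' = e₀ then insert f S else Set.range fun x => (J ⟨e', x⟩ : D)
  have hT : ∀ e' x, e' ≠ e₀ → (J ⟨e', x⟩ : D) ∈ T e' := by
    intro e' x hne
    simp only [T, if_neg hne]
    exact ⟨x, rfl⟩
  have hT₀ : T e₀ = insert f S := if_pos rfl
  have hTne : ∀ e' z, z ∈ T e' → e' ≠ e₀ → ∃ x, z = J ⟨e', x⟩ := by
    intro e' z hz hne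
    simp only [T, if_neg hne] at hz
    obtain ⟨x, rfl⟩ := hz
    exact ⟨x, rfl⟩
  have hTdisj : ∀ e' z, z ∈ T e₀ → z ∈ T e' → e' = e₀ := by
    intro e' z hz hz'
    by_contra hne
    obtain ⟨x, rfl⟩ := hTne e' z hz' hne
    rw [hT₀] at hz
    exact hz.elim (hne_f e' x hne) (J ⟨e', x⟩).2
  have hfit : ∀ e', Leg.Fits P s (Function.update ch e₀ (Code.node q₁ ch₁) e').leg
      (J ⟨e', none⟩) (J ⟨ringPerm q.1.1 q.1.2 e', none⟩) (T e') := by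
    intro e'
    by_cases hee : e' = e₀
    · subst hee
      rw [Function.update_self, hT₀, hx₀']
      have hb : (J ⟨ringPerm q.1.1 q.1.2 e', none⟩ : D) = P e := by
        have h1 : Code.perm q ch ⟨e', none⟩ = ⟨_, none⟩ := Leg.linked_of_none (by
          rcases hh : (ch e').leg.P none with _ | x
          · rfl
          · exact hempty.elim x)
        have h2 := hP' ⟨e', none⟩
        rwa [h1, hx₀', hPf] at h2
      rw [hb]
      have hb₁ : P e = P (J₁ (Code.root q₁ ch₁)) := by rw [hr₁]
      have hT₁ : insert f S = insert f (Set.range fun y => (J₁ y : D)) := by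
        congr 1
        ext z
        constructor
        · intro hz
          obtain ⟨y, hy⟩ := J₁.surjective ⟨z, hz⟩
          exact ⟨y, congrArg Subtype.val hy⟩
        · rintro ⟨y, rfl⟩
          exact (J₁ y).2
      rw [hb₁, hT₁]
      refine Leg.fits_ofRooted (P₁ := Code.perm q₁ ch₁) (s₁ := Code.flip q₁ ch₁)
        (d₁ := Code.root q₁ ch₁) (J := fun y => (J₁ y : D))
        (Subtype.val_injective.comp J₁.injective) ?_ ?_ ?_ hs₁'
      · intro y hy
        exact hf.mem (hy ▸ (J₁ y).2)
      · intro y hy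
        rw [hP₁', mul_apply, swap_apply_of_ne_of_ne]
        · intro h
          exact hy (J₁.injective (Subtype.ext (h.trans (congrArg Subtype.val hr₁).symm)))
        · intro h
          exact hf.mem (h ▸ (J₁ y).2)
      · rw [hP₁', hr₁, mul_apply, swap_apply_left]
    · rw [Function.update_of_ne hee]
      have hPP : ∀ x, P (J ⟨e', x⟩) = J (Code.perm q ch ⟨e', x⟩) := by
        intro x
        rw [hP', mul_apply, swap_apply_of_ne_of_ne _ (hne_f e' x hee)]
        intro h
        exact (J ⟨e', x⟩).2 (h ▸ he.mem)
      refine ⟨fun x => J ⟨e', x⟩, ?_, (if_neg hee).symm, rfl, fun x => hs' ⟨e', some x⟩, ?_, ?_⟩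
      · intro x y hxy
        have := J.injective (Subtype.ext hxy)
        exact eq_of_heq (Sigma.mk.inj_iff.1 this).2
      · intro x hx
        rw [hPP]
        exact congrArg (fun y => (J y : D)) (Leg.linked_of_none hx)
      · intro x hx
        rw [hPP]
        exact congrArg (fun y => (J y : D)) (Leg.linked_of_ne hx)
  have hTdisj' : ∀ a b z, z ∈ T a → z ∈ T b → a = b := by
    intro a b z ha hb
    by_cases haa : a = e₀
    · subst haa
      exact (hTdisj b z ha hb).symm
    by_cases hbb : b = e₀
    · subst hbb
      exact hTdisj a z hb ha
    obtain ⟨x, rfl⟩ := hTne a z ha haa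
    obtain ⟨y, hy⟩ := hTne b _ hb hbb
    exact congrArg Sigma.fst (J.injective (Subtype.ext hy))
  have hTuniv : ∀ z, ∃ a, z ∈ T a := by
    intro z
    by_cases hz : z ∈ S
    · exact ⟨e₀, hT₀ ▸ Or.inr hz⟩
    · obtain ⟨⟨e', x⟩, hy⟩ := J.surjective ⟨z, hz⟩
      obtain rfl : (J ⟨e', x⟩ : D) = z := congrArg Subtype.val hy
      by_cases hee : e' = e₀
      · subst hee
        refine ⟨e', hT₀ ▸ Or.inl ?_⟩
        rcases x with _ | x
        · exact hx₀'
        · exact hempty.elim x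
      · exact ⟨e', hT e' x hee⟩
  obtain ⟨J', hJ', hJs', hJN'⟩ := Leg.exists_equiv_of_fits (P := P) (s := s)
    (p := ringPerm q.1.1 q.1.2) (t := ringFlip q.1.2) (N := fun e' => (J ⟨e', none⟩ : D))
    (fun e' => hs' ⟨e', none⟩) hfit hTdisj' hTuniv
  exact ⟨q, Function.update ch e₀ (Code.node q₁ ch₁), J', hJ', hJs',
    (hJN' _).trans (congrArg Subtype.val hr)⟩

/-! ### Four-regular maps as medial maps -/

theorem mul_cyc_of_minimalPeriod {D : Type*} [Finite D] {f : Perm D} {m : ℕ}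
    (hf : ∀ x, Function.minimalPeriod f x = m) : m * cyc f = Nat.card D := by
  classical
  have := Fintype.ofFinite (Quotient (SameCycle.setoid f))
  have h := Nat.card_congr (Equiv.sigmaFiberEquiv (Quotient.mk (SameCycle.setoid f)))
  rw [← h, Nat.card_sigma, Finset.sum_congr rfl (g := fun _ => m), Finset.sum_const, smul_eq_mul,
    Finset.card_univ, mul_comm]
  · rw [cyc, Nat.card_eq_fintype_card]
  · intro v _
    induction v using Quotient.inductionOn with | _ x => ?_
    have : {y | Quotient.mk (SameCycle.setoid f) y = Quotient.mk _ x} =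
        (fun n => f^[n] x) '' Set.Iio m := by
      ext y
      constructor
      · intro hy
        have hy : f.SameCycle x y := (Quotient.exact hy).symm
        obtain ⟨n, rfl⟩ := hy.exists_nat_pow_eq
        refine ⟨n % m, Nat.mod_lt _ ?_, ?_⟩
        · rw [← hf x]
          exact Function.minimalPeriod_pos_of_mem_periodicPts
            (Function.mem_periodicPts.2 ⟨orderOf f, orderOf_pos f, by
              rw [Function.IsPeriodicPt, Function.IsFixedPt, ← Equiv.Perm.coe_pow,
                pow_orderOf_eq_one]
              rfl⟩)
        · change f^[n % m] x = (f ^ n) x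
          rw [← hf x, Function.iterate_mod_minimalPeriod_eq, Equiv.Perm.coe_pow]
      · rintro ⟨n, _, rfl⟩
        exact Quotient.sound (SameCycle.symm ⟨n, by rw [zpow_natCast, Equiv.Perm.coe_pow]⟩)
    change Nat.card ({y | Quotient.mk (SameCycle.setoid f) y = Quotient.mk _ x} : Set D) = m
    rw [this, Nat.card_coe_set_eq, Set.InjOn.ncard_image, ← Nat.card_coe_set_eq]
    · simp
    · rw [← hf x]
      exact Function.iterate_injOn_Iio_minimalPeriod

theorem minimalPeriod_eq_four {D : Type*} {f : D → D} {x : D} :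
    Function.minimalPeriod f x = 4 ↔ f (f (f (f x))) = x ∧ f (f x) ≠ x := by
  constructor
  · intro h
    constructor
    · have := Function.iterate_minimalPeriod (f := f) (x := x)
      rwa [h] at this
    · intro h2
      have : Function.IsPeriodicPt f 2 x := h2
      have := this.minimalPeriod_dvd
      rw [h] at this
      omega
  · rintro ⟨h1, h2⟩
    exact Function.minimalPeriod_eq_prime_pow (p := 2) (k := 1) h2 h1

theorem induce_fibre_connected {V W : Type*} {G : SimpleGraph V} (e : V ≃ W) (w : W) :
    (G.induce (e ⁻¹' {w})).Connected := by
  rw [induce_connected_iff]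
  refine ⟨⟨e.symm w, e.apply_symm_apply w⟩, fun A hA ⟨a, ha⟩ _ => hA.antisymm fun y hy => ?_⟩
  rwa [e.injective (hy.trans (hA ha).symm)]

namespace CombMap

variable {D : Type*} {M : CombMap D}

theorem fixFreeInvol_opp (M : CombMap D) : FixFreeInvol M.opp := fun x => ⟨M.opp_opp x, M.opp_ne x⟩

theorem isConnected_iff [Finite D] : M.IsConnected ↔ PermConnected M.rot M.opp := by
  constructor
  · rintro h A ⟨a, ha⟩ hr ho
    have key : ∀ g ∈ Subgroup.closure {M.rot, M.opp}, ∀ x, x ∈ A ↔ g x ∈ A := by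
      intro g hg
      induction hg using Subgroup.closure_induction with
      | mem g hg =>
        rcases hg with rfl | rfl
        · exact fun x => (mem_iff_of_closed hr).symm
        · exact fun x => (mem_iff_of_closed ho).symm
      | one => exact fun x => Iff.rfl
      | mul g g' _ _ h h' => exact fun x => (h' x).trans (h _)
      | inv g _ h => exact fun x => by simpa using (h (g⁻¹ x)).symm
    ext y
    refine ⟨fun _ => trivial, fun _ => ?_⟩
    obtain ⟨g, hg, rfl⟩ := h a y
    exact (key g hg a).1 ha
  · intro h x y
    have := h {y | ∃ g ∈ Subgroup.closure {M.rot, M.opp}, g x = y} ⟨x, 1, one_mem _, rfl⟩ ?_ ?_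
    · exact this.ge (trivial : y ∈ Set.univ)
    · rintro _ ⟨g, hg, rfl⟩
      exact ⟨M.rot * g, mul_mem (Subgroup.subset_closure (Or.inl rfl)) hg, rfl⟩
    · rintro _ ⟨g, hg, rfl⟩
      exact ⟨M.opp * g, mul_mem (Subgroup.subset_closure (Or.inr rfl)) hg, rfl⟩

/-- The half-edges of a spherical 4-regular map can be coloured such that the colours alternate
along edges and around vertices. (The colour of a half-edge is that of the face to one side of it.)
Otherwise the double cover would be a connected map with too large an Euler characteristic. -/
theorem exists_colouring [Finite D] (hc : M.IsConnected) (hs : M.IsSpherical)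
    (h4 : M.IsFourRegular) :
    ∃ col : D → Bool, (∀ x, col (M.rot x) = !col x) ∧ ∀ x, col (M.opp x) = !col x := by
  let lift : Perm D → Perm (D × Bool) := fun f => Equiv.prodCongr f Equiv.boolNot
  have hlift : ∀ f x b, lift f (x, b) = (f x, !b) := fun f x b => rfl
  -- the numbers of vertices, edges and faces of the double cover: faces lift to two copies, since
  -- `rot * opp` does not change the colour
  have hnc : ¬ PermConnected (lift M.rot) (lift M.opp) := by
    intro h
    have h1 := h.euler_le
    have h2 : 2 * cyc (lift M.opp) = Nat.card (D × Bool) := by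
      refine FixFreeInvol.two_mul_cyc ?_
      rintro ⟨x, b⟩
      rw [hlift, hlift, M.opp_opp, Bool.not_not]
      exact ⟨rfl, fun hh => M.opp_ne x (congrArg Prod.fst hh)⟩
    have h3 : 4 * cyc (lift M.rot) = Nat.card (D × Bool) := by
      refine mul_cyc_of_minimalPeriod ?_
      rintro ⟨x, b⟩
      have := minimalPeriod_eq_four.1 (h4 x)
      rw [minimalPeriod_eq_four]
      simp only [hlift, Bool.not_not]
      exact ⟨Prod.ext this.1 rfl, fun hh => this.2 (congrArg Prod.fst hh)⟩
    have h4' : 4 * cyc M.rot = Nat.card D := mul_cyc_of_minimalPeriod h4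
    have h5 : 2 * cyc M.opp = Nat.card D := M.fixFreeInvol_opp.two_mul_cyc
    have h6 : cyc (lift M.rot * lift M.opp) = cyc (M.rot * M.opp) + cyc (M.rot * M.opp) := by
      refine cyc_eq_add (i := fun x => (x, true)) (j := fun x => (x, false))
        (fun x y hxy => congrArg Prod.fst hxy) (fun x y hxy => congrArg Prod.fst hxy)
        (by simp) ?_ (fun x => rfl) (fun x => rfl)
      rintro ⟨x, _ | _⟩
      · exact Or.inr ⟨x, rfl⟩
      · exact Or.inl ⟨x, rfl⟩
    have h7 : cyc M.rot + cyc (M.rot * M.opp) = cyc M.opp + 2 := hs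
    have h8 : Nat.card (D × Bool) = Nat.card D * 2 := by
      rw [Nat.card_prod]
      simp
    omega
  rw [isConnected_iff] at hc
  unfold PermConnected at hnc
  push Not at hnc
  obtain ⟨A, ⟨⟨a, b⟩, ha⟩, hr, ho, hne⟩ := hnc
  -- `A` is a component of the double cover; it is the graph of a colouring
  have hsome : ∀ x, ∃ b, (x, b) ∈ A := by
    have := hc {x | ∃ b, (x, b) ∈ A} ⟨a, b, ha⟩ (fun x ⟨b, hx⟩ => ⟨_, hr _ hx⟩)
      (fun x ⟨b, hx⟩ => ⟨_, ho _ hx⟩)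
    exact fun x => this.ge (trivial : x ∈ Set.univ)
  have hone : ∀ x b, (x, b) ∈ A → (x, !b) ∉ A := by
    intro x₀ b₀ hx₀ hx₀'
    refine hne ?_
    have := hc {x | ∀ b, (x, b) ∈ A} ⟨x₀, fun b => ?_⟩ ?_ ?_
    · ext ⟨x, b⟩
      exact ⟨fun _ => trivial, fun _ => this.ge (trivial : x ∈ Set.univ) b⟩
    · cases b <;> cases b₀ <;> assumption
    · intro x hx b
      have := hr _ (hx !b)
      rwa [hlift, Bool.not_not] at this
    · intro x hx b
      have := ho _ (hx !b)
      rwa [hlift, Bool.not_not] at this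
  choose col hcol using hsome
  have huniq : ∀ x b, (x, b) ∈ A → col x = b := by
    intro x b hb
    by_contra hcb
    have : b = !col x := by
      revert hcb
      cases b <;> cases col x <;> simp
    exact hone _ _ (hcol x) (this ▸ hb)
  exact ⟨col, fun x => huniq _ _ (hr _ (hcol x)), fun x => huniq _ _ (ho _ (hcol x))⟩

end CombMap

/-- The map `M` is the medial map of the map with vertices `P` and edges `s`. The half-edges of `M`
are of the form `h x` or `M.opp (h x)`; they correspond to the two sides of a corner. -/
structure IsMedial {D D' : Type*} (M : CombMap D) (P s : Perm D') (h : D' → D) : Prop where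
  inj : Function.Injective h
  perm : ∀ x, M.rot (M.opp (h x)) = h (P x)
  flip : ∀ x, M.rot (M.rot (h x)) = h (s x)
  cover : ∀ y, y ∈ Set.range h ↔ M.opp y ∉ Set.range h

namespace IsMedial

variable {D D' : Type*} {M : CombMap D} {P s : Perm D'} {h : D' → D} (H : IsMedial M P s h)
include H

theorem rot (x : D') : M.rot (h x) = M.opp (h (P⁻¹ (s x))) := by
  apply M.rot.injective
  rw [H.perm, H.flip]
  simp

theorem cases (y : D) : (∃ x, h x = y) ∨ ∃ x, M.opp (h x) = y := by
  by_cases hy : y ∈ Set.range h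
  · exact Or.inl hy
  · rw [H.cover, not_not] at hy
    obtain ⟨x, hx⟩ := hy
    exact Or.inr ⟨x, by rw [hx, M.opp_opp]⟩

theorem ne (x x' : D') : h x ≠ M.opp (h x') := by
  intro hx
  exact (H.cover (h x')).1 ⟨x', rfl⟩ ⟨x, hx⟩

theorem rot_mem_iff (y : D) : M.rot y ∈ Set.range h ↔ y ∉ Set.range h := by
  rcases H.cases y with ⟨x, rfl⟩ | ⟨x, rfl⟩
  · rw [H.rot]
    refine iff_of_false ?_ (not_not.2 ⟨x, rfl⟩)
    rintro ⟨z, hz⟩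
    exact H.ne _ _ hz
  · rw [H.perm]
    refine iff_of_true ⟨_, rfl⟩ ?_
    rintro ⟨z, hz⟩
    exact H.ne _ _ hz

theorem opp_injective : Function.Injective fun x => M.opp (h x) := M.opp.injective.comp H.inj

theorem finite [Finite D] : Finite D' := Finite.of_injective h H.inj

theorem card [Finite D] : Nat.card D = 2 * Nat.card D' := by
  have := H.finite
  rw [two_mul, ← Nat.card_sum]
  refine (Nat.card_eq_of_bijective (Sum.elim h fun x => M.opp (h x)) ⟨?_, ?_⟩).symm
  · exact H.inj.sumElim H.opp_injective fun x y => H.ne x y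
  · intro y
    rcases H.cases y with ⟨x, rfl⟩ | ⟨x, rfl⟩
    · exact ⟨Sum.inl x, rfl⟩
    · exact ⟨Sum.inr x, rfl⟩

theorem isFourRegular_iff : M.IsFourRegular ↔ FixFreeInvol s := by
  have key : ∀ x, Function.minimalPeriod M.rot (h x) = 4 ↔ s (s x) = x ∧ s x ≠ x := by
    intro x
    rw [minimalPeriod_eq_four, H.flip, H.flip, H.inj.eq_iff, Ne, H.inj.eq_iff]
  refine ⟨fun h4 x => (key x).1 (h4 _), fun hs y => ?_⟩
  rcases H.cases y with ⟨x, rfl⟩ | ⟨x, rfl⟩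
  · exact (key x).2 (hs x)
  · have := (key (P x)).2 (hs _)
    rw [← H.perm, minimalPeriod_eq_four] at this
    rw [minimalPeriod_eq_four]
    exact ⟨M.rot.injective this.1, fun hh => this.2 (congrArg _ hh)⟩

theorem isConnected_iff [Finite D] : M.IsConnected ↔ PermConnected P s := by
  have := H.finite
  rw [CombMap.isConnected_iff]
  constructor
  · rintro hc A ⟨a, ha⟩ hP hs
    have hPi : ∀ x ∈ A, P⁻¹ x ∈ A := fun x hx => inv_mem_of_closed hP hx
    have := hc {y | ∃ x ∈ A, y = h x ∨ y = M.opp (h x)} ⟨h a, a, ha, Or.inl rfl⟩ ?_ ?_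
    · ext x
      refine ⟨fun _ => trivial, fun _ => ?_⟩
      obtain ⟨z, hz, hx | hx⟩ := this.ge (trivial : h x ∈ Set.univ)
      · have hxz : x = z := H.inj hx
        rwa [hxz]
      · exact (H.ne _ _ hx).elim
    · rintro _ ⟨x, hx, rfl | rfl⟩
      · exact ⟨_, hPi _ (hs _ hx), Or.inr (H.rot x)⟩
      · exact ⟨_, hP _ hx, Or.inl (H.perm x)⟩
    · rintro _ ⟨x, hx, rfl | rfl⟩
      · exact ⟨x, hx, Or.inr rfl⟩
      · exact ⟨x, hx, Or.inl (M.opp_opp _)⟩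
  · rintro hc A ⟨a, ha⟩ hr ho
    have := hc {x | h x ∈ A} ?_ (fun x hx => ?_) (fun x hx => ?_)
    · ext y
      refine ⟨fun _ => trivial, fun _ => ?_⟩
      rcases H.cases y with ⟨x, rfl⟩ | ⟨x, rfl⟩
      · exact this.ge (trivial : x ∈ Set.univ)
      · exact ho _ (this.ge (trivial : x ∈ Set.univ))
    · rcases H.cases a with ⟨x, rfl⟩ | ⟨x, rfl⟩
      · exact ⟨x, ha⟩
      · refine ⟨x, ?_⟩
        have := ho _ ha
        rwa [M.opp_opp] at this
    · have := hr _ (ho _ hx)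
      rwa [H.perm] at this
    · have := hr _ (hr _ hx)
      rwa [H.flip] at this

theorem sameCycle_iff (hs : FixFreeInvol s) {x x' : D'} :
    M.rot.SameCycle (h x) (h x') ↔ s.SameCycle x x' := by
  constructor
  · rintro ⟨n, hn⟩
    have h2 : ∀ n : ℤ, (M.rot ^ (2 * n)) (h x) = h ((s ^ n) x) := by
      have key : ∀ x, h (s x) = (M.rot ^ (2 : ℤ)) (h x) := fun x => (H.flip x).symm
      intro n
      rw [zpow_mul]
      generalize M.rot ^ (2 : ℤ) = g at key
      have hnat : ∀ n : ℕ, ∀ x, (g ^ n) (h x) = h ((s ^ n) x) := by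
        intro n
        induction n with
        | zero => exact fun x => rfl
        | succ n ih =>
          intro x
          rw [pow_succ, pow_succ, mul_apply, mul_apply, ← key, ih]
      obtain ⟨n, rfl | rfl⟩ := n.eq_nat_or_neg
      · exact hnat n x
      · rw [zpow_neg, zpow_neg, inv_eq_iff_eq, zpow_natCast, zpow_natCast, hnat]
        simp
    rcases Int.even_or_odd' n with ⟨m, rfl | rfl⟩
    · rw [h2] at hn
      exact ⟨m, H.inj hn⟩
    · rw [add_comm, zpow_add, mul_apply, h2, zpow_one] at hn
      have := (H.rot_mem_iff (h ((s ^ m) x))).1 (hn ▸ ⟨x', rfl⟩)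
      exact (this ⟨_, rfl⟩).elim
  · rw [hs.sameCycle_iff]
    rintro (rfl | rfl)
    · exact SameCycle.refl _ _
    · exact ⟨2, H.flip x⟩

/-- The vertices of the medial map. -/
theorem exists_vertex_equiv (hs : FixFreeInvol s) :
    ∃ φ : Quotient (SameCycle.setoid s) ≃ M.Vertex, ∀ x, φ (medialVertex s x) = M.vertexOf (h x) := by
  let φ : Quotient (SameCycle.setoid s) → M.Vertex := Quotient.lift (fun x => M.vertexOf (h x))
    fun x y hxy => Quotient.sound ((H.sameCycle_iff hs).2 hxy)
  refine ⟨Equiv.ofBijective φ ⟨?_, ?_⟩, fun x => rfl⟩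
  · intro a b hab
    obtain ⟨x, rfl⟩ := medialVertex_surjective s a
    obtain ⟨y, rfl⟩ := medialVertex_surjective s b
    exact Quotient.sound ((H.sameCycle_iff hs).1 (Quotient.exact hab))
  · intro v
    induction v using Quotient.inductionOn with | _ y => ?_
    rcases H.cases y with ⟨x, rfl⟩ | ⟨x, rfl⟩
    · exact ⟨medialVertex s x, rfl⟩
    · refine ⟨medialVertex s (P x), Quotient.sound (SameCycle.symm ⟨1, ?_⟩)⟩
      rw [zpow_one, H.perm]

theorem isSpherical_iff [Finite D] (hs : FixFreeInvol s) : M.IsSpherical ↔ Planar P s := by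
  have := H.finite
  have h1 : Nat.card M.Vertex = cyc s := Nat.card_congr (H.exists_vertex_equiv hs).choose.symm
  have h2 : 2 * Nat.card M.Edge = Nat.card D := M.fixFreeInvol_opp.two_mul_cyc
  have h3 : Nat.card M.Face = cyc P + cyc (P⁻¹ * s) := by
    refine cyc_eq_add (k := M.rot * M.opp) H.inj H.opp_injective H.ne H.cases
      (fun x => (H.perm x).symm) fun x => ?_
    change M.opp (h (P⁻¹ (s x))) = M.rot (M.opp (M.opp (h x)))
    rw [M.opp_opp, H.rot]
  have h4 : cyc (P⁻¹ * s) = cyc (P * s) := by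
    have : s⁻¹ = s := by
      ext x
      rw [inv_eq_iff_eq]
      exact (hs x).1.symm
    rw [← cyc_inv, mul_inv_rev, inv_inv, this, cyc_mul_comm]
  have h5 := H.card
  unfold CombMap.IsSpherical Planar
  omega

theorem isK4MinorFree_iff (hs : FixFreeInvol s) :
    M.IsK4MinorFree ↔ ¬ (medialGraph P s).HasMinor (⊤ : SimpleGraph (Fin 4)) := by
  obtain ⟨φ, hφ⟩ := H.exists_vertex_equiv hs
  have hrel : ∀ a b, (∃ x, medialVertex s x = a ∧ medialVertex s (P x) = b) →
      ∃ d, M.vertexOf d = φ a ∧ M.vertexOf (M.opp d) = φ b := by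
    rintro _ _ ⟨x, rfl, rfl⟩
    refine ⟨h x, (hφ x).symm, ?_⟩
    rw [hφ, ← H.perm]
    exact Quotient.sound ⟨1, rfl⟩
  have hrel' : ∀ a b, (∃ d, M.vertexOf d = φ a ∧ M.vertexOf (M.opp d) = φ b) →
      (∃ x, medialVertex s x = a ∧ medialVertex s (P x) = b) ∨
      ∃ x, medialVertex s x = b ∧ medialVertex s (P x) = a := by
    rintro a b ⟨d, ha, hb⟩
    have hP : ∀ x, M.vertexOf (M.opp (h x)) = φ (medialVertex s (P x)) := by
      intro x
      rw [hφ, ← H.perm]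
      exact Quotient.sound ⟨1, rfl⟩
    rcases H.cases d with ⟨x, rfl⟩ | ⟨x, rfl⟩
    · rw [← hφ] at ha
      rw [hP] at hb
      exact Or.inl ⟨x, φ.injective ha, φ.injective hb⟩
    · rw [M.opp_opp, ← hφ] at hb
      rw [hP] at ha
      exact Or.inr ⟨x, φ.injective hb, φ.injective ha⟩
  have hadj : ∀ a b, M.graph.Adj (φ a) (φ b) ↔ (medialGraph P s).Adj a b := by
    intro a b
    rw [medialGraph_adj, CombMap.graph, SimpleGraph.fromRel_adj, φ.injective.ne_iff]
    refine and_congr_right fun _ => ⟨?_, Or.imp (hrel a b) (hrel b a)⟩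
    rintro (hh | hh)
    · exact hrel' a b hh
    · exact (hrel' b a hh).symm
  refine not_congr ⟨?_, ?_⟩
  · refine SimpleGraph.HasMinor.of_contraction φ (induce_fibre_connected φ) fun a b hab => ?_
    obtain ⟨a, rfl⟩ := φ.surjective a
    obtain ⟨b, rfl⟩ := φ.surjective b
    exact ⟨a, b, rfl, rfl, (hadj a b).1 hab⟩
  · refine SimpleGraph.HasMinor.of_contraction φ.symm (induce_fibre_connected φ.symm) fun a b hab => ?_
    exact ⟨φ a, φ b, φ.symm_apply_apply a, φ.symm_apply_apply b, (hadj a b).2 hab⟩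

end IsMedial

/-! ### Link-diagrams and codes -/

/-- The rotation of the medial map: the half-edges `(x, true)` are those on the side of `x`. -/
def medialRot {D' : Type*} (P s : Perm D') : Perm (D' × Bool) where
  toFun
    | (x, true) => (P⁻¹ (s x), false)
    | (x, false) => (P x, true)
  invFun
    | (x, true) => (P⁻¹ x, false)
    | (x, false) => (s⁻¹ (P x), true)
  left_inv := by rintro ⟨x, _ | _⟩ <;> simp
  right_inv := by rintro ⟨x, _ | _⟩ <;> simp

theorem exists_isMedial {D D' : Type*} (E : D' × Bool ≃ D) (P s : Perm D') :
    ∃ M : CombMap D, IsMedial M P s fun x => E (x, true) := by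
  refine ⟨⟨E.permCongr (medialRot P s), E.permCongr (Equiv.prodCongr (Equiv.refl _) Equiv.boolNot),
    fun d => ?_, fun d => ?_⟩, ?_, ?_, ?_, ?_⟩
  · obtain ⟨⟨x, b⟩, rfl⟩ := E.surjective d
    simp
  · obtain ⟨⟨x, b⟩, rfl⟩ := E.surjective d
    simp
  · exact fun x y hxy => congrArg Prod.fst (E.injective hxy)
  · intro x
    simp [medialRot]
  · intro x
    simp [medialRot]
  · intro y
    obtain ⟨⟨x, b⟩, rfl⟩ := E.surjective y
    cases b <;> simp

/-- The rooted link-diagram `R` has the medial 4-regular map of the map `P`, `s`, rooted at `d`, as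
its underlying map, and the overcrossing strands are given by `u`. -/
def Represents {D D' : Type*} (R : RootedLinkDiagram D) (P s : Perm D') (d : D') (u : Set D') :
    Prop :=
  ∃ h, IsMedial R.toCombMap P s h ∧ h d = R.root ∧ ∀ x, h x ∈ R.upper ↔ x ∈ u

theorem exists_diagram {D D' : Type*} [Finite D] (E : D' × Bool ≃ D) {P s : Perm D'}
    (hs : FixFreeInvol s) (hc : PermConnected P s) (hp : Planar P s) (d : D') {u : Set D'}
    (hu : ∀ x, s x ∈ u ↔ x ∈ u) : ∃ R : RootedLinkDiagram D, Represents R P s d u := by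
  obtain ⟨M, H⟩ := exists_isMedial E P s
  set h : D' → D := fun x => E (x, true)
  let U : Set D := {y | ∃ x, (y = h x ∧ x ∈ u) ∨ (y = M.opp (h x) ∧ P x ∉ u)}
  have hU : ∀ x, h x ∈ U ↔ x ∈ u := by
    refine fun x => ⟨?_, fun hx => ⟨x, Or.inl ⟨rfl, hx⟩⟩⟩
    rintro ⟨z, ⟨hz, hzu⟩ | ⟨hz, _⟩⟩
    · have : x = z := H.inj hz
      rwa [this]
    · exact (H.ne _ _ hz).elim
  have hU' : ∀ x, M.opp (h x) ∈ U ↔ P x ∉ u := by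
    refine fun x => ⟨?_, fun hx => ⟨x, Or.inr ⟨rfl, hx⟩⟩⟩
    rintro ⟨z, ⟨hz, _⟩ | ⟨hz, hzu⟩⟩
    · exact (H.ne _ _ hz.symm).elim
    · have : x = z := H.opp_injective hz
      rwa [this]
  refine ⟨{ M with
    connected := H.isConnected_iff.2 hc
    spherical := (H.isSpherical_iff hs).2 hp
    fourRegular := H.isFourRegular_iff.2 hs
    upper := U
    rot_mem_upper := fun y => ?_
    root := h d }, h, H, rfl, hU⟩
  rcases H.cases y with ⟨x, rfl⟩ | ⟨x, rfl⟩
  · rw [H.rot, hU', hU, show P (P⁻¹ (s x)) = s x by simp, hu]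
  · rw [H.perm, hU, hU', not_not]

theorem exists_represents {D : Type} [Finite D] (R : RootedLinkDiagram D)
    (hR : R.toCombMap.IsK4MinorFree) :
    ∃ (D' : Type) (P s : Perm D') (d : D') (u : Set D'), Finite D' ∧ Good P s ∧
      (∀ x, s x ∈ u ↔ x ∈ u) ∧ Represents R P s d u := by
  obtain ⟨col, hcr, hco⟩ := CombMap.exists_colouring R.connected R.spherical R.fourRegular
  let S : Set D := {x | col x = col R.root}
  have hP : ∀ x ∈ S, (R.rot * R.opp) x ∈ S := by
    intro x hx
    change col (R.rot (R.opp x)) = _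
    rw [hcr, hco, Bool.not_not]
    exact hx
  have hs : ∀ x ∈ S, (R.rot * R.rot) x ∈ S := by
    intro x hx
    change col (R.rot (R.rot x)) = _
    rw [hcr, hcr, Bool.not_not]
    exact hx
  have H : IsMedial R.toCombMap (restrictPerm (R.rot * R.opp) hP) (restrictPerm (R.rot * R.rot) hs)
      (Subtype.val : S → D) := by
    refine ⟨Subtype.val_injective, fun x => rfl, fun x => rfl, fun y => ?_⟩
    rw [Subtype.range_val]
    change col y = _ ↔ ¬ col (R.opp y) = _
    rw [hco]
    cases col y <;> cases col R.root <;> simp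
  have hinv := H.isFourRegular_iff.1 R.fourRegular
  refine ⟨S, _, _, ⟨R.root, rfl⟩, {x | (x : D) ∈ R.upper}, inferInstance,
    ⟨hinv, H.isConnected_iff.1 R.connected, (H.isSpherical_iff hinv).1 R.spherical,
      (H.isK4MinorFree_iff hinv).1 hR⟩, fun x => ?_, _, H, rfl, fun x => Iff.rfl⟩
  change R.rot (R.rot x) ∈ R.upper ↔ (x : D) ∈ R.upper
  rw [R.rot_mem_upper, R.rot_mem_upper, not_not]

theorem IsMedial.exists_sum_equiv {D D' : Type*} {M : CombMap D} {P s : Perm D'} {h : D' → D}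
    (H : IsMedial M P s h) :
    ∃ e : D' ⊕ D' ≃ D, (∀ x, e (Sum.inl x) = h x) ∧ ∀ x, e (Sum.inr x) = M.opp (h x) := by
  refine ⟨Equiv.ofBijective (Sum.elim h fun x => M.opp (h x)) ⟨?_, ?_⟩, fun x => rfl, fun x => rfl⟩
  · exact H.inj.sumElim H.opp_injective fun x y => H.ne x y
  · intro y
    rcases H.cases y with ⟨x, rfl⟩ | ⟨x, rfl⟩
    · exact ⟨Sum.inl x, rfl⟩
    · exact ⟨Sum.inr x, rfl⟩

theorem inv_semiconj {α β : Type*} {f : α → β} {P : Perm α} {P' : Perm β}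
    (h : ∀ x, f (P x) = P' (f x)) (x : α) : f (P⁻¹ x) = P'⁻¹ (f x) := by
  rw [eq_comm, inv_eq_iff_eq, ← h]
  simp

/-- Link-diagrams are the same if and only if the decorated rooted maps which represent them are
isomorphic. -/
theorem Represents.iso_iff {D D₁ D₂ : Type*} [Finite D] {R₁ R₂ : RootedLinkDiagram D}
    {P₁ s₁ : Perm D₁} {d₁ : D₁} {u₁ : Set D₁} {P₂ s₂ : Perm D₂} {d₂ : D₂} {u₂ : Set D₂}
    (h₁ : Represents R₁ P₁ s₁ d₁ u₁) (h₂ : Represents R₂ P₂ s₂ d₂ u₂) :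
    RootedLinkDiagram.Iso R₁ R₂ ↔ ∃ f : D₁ ≃ D₂, (∀ x, f (P₁ x) = P₂ (f x)) ∧
      (∀ x, f (s₁ x) = s₂ (f x)) ∧ f d₁ = d₂ ∧ ∀ x, f x ∈ u₂ ↔ x ∈ u₁ := by
  obtain ⟨h₁, H₁, hr₁, hu₁⟩ := h₁
  obtain ⟨h₂, H₂, hr₂, hu₂⟩ := h₂
  have := H₁.finite
  have := H₂.finite
  constructor
  · rintro ⟨F, hrot, hopp, hupper, hroot⟩
    have hP : ∀ x z, F (h₁ x) = h₂ z → F (h₁ (P₁ x)) = h₂ (P₂ z) := by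
      intro x z hz
      rw [← H₁.perm, hrot, hopp, hz, H₂.perm]
    have hs : ∀ x z, F (h₁ x) = h₂ z → F (h₁ (s₁ x)) = h₂ (s₂ z) := by
      intro x z hz
      rw [← H₁.flip, hrot, hrot, hz, H₂.flip]
    have hd : F (h₁ d₁) = h₂ d₂ := by rw [hr₁, hroot, hr₂]
    -- the image of one black half-edge is black, hence by connectedness the image of each
    have hex : ∀ x, ∃ z, F (h₁ x) = h₂ z := by
      have := (H₁.isConnected_iff.1 R₁.connected) {x | ∃ z, F (h₁ x) = h₂ z} ⟨d₁, d₂, hd⟩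
        (fun x ⟨z, hz⟩ => ⟨_, hP x z hz⟩) (fun x ⟨z, hz⟩ => ⟨_, hs x z hz⟩)
      exact fun x => this.ge (trivial : x ∈ Set.univ)
    choose f hf using hex
    have hinj : Function.Injective f := by
      intro x y hxy
      refine H₁.inj (F.injective ?_)
      rw [hf, hf, hxy]
    have hcard : Nat.card D₂ ≤ Nat.card D₁ := by
      have := H₁.card
      have := H₂.card
      omega
    refine ⟨Equiv.ofBijective f (hinj.bijective_of_nat_card_le hcard), fun x => ?_, fun x => ?_, ?_,
      fun x => ?_⟩
    · exact H₂.inj ((hf _).symm.trans (hP _ _ (hf x)))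
    · exact H₂.inj ((hf _).symm.trans (hs _ _ (hf x)))
    · exact H₂.inj ((hf _).symm.trans hd)
    · change f x ∈ u₂ ↔ _
      rw [← hu₂, ← hf, hupper, hu₁]
  · rintro ⟨f, hP, hs, hd, hu⟩
    obtain ⟨e₁, he₁, he₁'⟩ := H₁.exists_sum_equiv
    obtain ⟨e₂, he₂, he₂'⟩ := H₂.exists_sum_equiv
    let F : Perm D := (e₁.symm.trans (Equiv.sumCongr f f)).trans e₂
    have hF : ∀ x, F (h₁ x) = h₂ (f x) := by
      intro x
      rw [← he₁]
      simp [F, he₂]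
    have hF' : ∀ x, F (R₁.opp (h₁ x)) = R₂.opp (h₂ (f x)) := by
      intro x
      rw [← he₁']
      simp [F, he₂']
    have hupper : ∀ x, F (h₁ x) ∈ R₂.upper ↔ h₁ x ∈ R₁.upper := by
      intro x
      rw [hF, hu₂, hu, hu₁]
    refine ⟨F, fun y => ?_, fun y => ?_, fun y => ?_, ?_⟩
    · rcases H₁.cases y with ⟨x, rfl⟩ | ⟨x, rfl⟩
      · rw [H₁.rot, hF', hF, H₂.rot, inv_semiconj hP, hs]
      · rw [H₁.perm, hF, hF', H₂.perm, hP]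
    · rcases H₁.cases y with ⟨x, rfl⟩ | ⟨x, rfl⟩
      · rw [hF', hF]
      · rw [R₁.opp_opp, hF', hF, R₂.opp_opp]
    · rcases H₁.cases y with ⟨x, rfl⟩ | ⟨x, rfl⟩
      · exact hupper x
      · have k1 := R₁.rot_mem_upper (R₁.opp (h₁ x))
        have k2 := R₂.rot_mem_upper (R₂.opp (h₂ (f x)))
        rw [H₁.perm] at k1
        rw [H₂.perm] at k2
        have k3 := hupper (P₁ x)
        rw [hF, hP] at k3
        rw [hF']
        tauto
    · rw [← hr₁, hF, hd, hr₂]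

/-- An automorphism of a connected map which fixes a dart is trivial. -/
theorem PermConnected.eq_of_fixed {D : Type*} {P s : Perm D} (hc : PermConnected P s) {f : D → D}
    (hP : ∀ x, f (P x) = P (f x)) (hs : ∀ x, f (s x) = s (f x)) {d : D} (hd : f d = d) (x : D) :
    f x = x := by
  have := hc {x | f x = x} ⟨d, hd⟩ (fun x (hx : f x = x) => (hP x).trans (congrArg P hx))
    (fun x (hx : f x = x) => (hs x).trans (congrArg s hx))
  exact this.ge (trivial : x ∈ Set.univ)

theorem card_invariant {D : Type*} [Finite D] (s : Perm D) :
    Nat.card {u : Set D // ∀ x, s x ∈ u ↔ x ∈ u} = 2 ^ cyc s := by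
  classical
  have : Nat.card (Set (Quotient (SameCycle.setoid s))) = 2 ^ cyc s := by
    have := Fintype.ofFinite (Quotient (SameCycle.setoid s))
    rw [Nat.card_eq_fintype_card, Fintype.card_set, cyc, Nat.card_eq_fintype_card]
  rw [← this]
  symm
  refine Nat.card_eq_of_bijective (fun U => ⟨{x | medialVertex s x ∈ U}, fun x => ?_⟩) ⟨?_, ?_⟩
  · have : medialVertex s (s x) = medialVertex s x := Quotient.sound (SameCycle.symm ⟨1, by simp⟩)
    change medialVertex s (s x) ∈ U ↔ medialVertex s x ∈ U
    rw [this]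
  · intro U V hUV
    ext q
    obtain ⟨x, rfl⟩ := medialVertex_surjective s q
    exact Set.ext_iff.1 (congrArg Subtype.val hUV) x
  · rintro ⟨u, hu⟩
    refine ⟨medialVertex s '' u, Subtype.ext (Set.ext fun x => ⟨?_, fun hx => ⟨x, hx, rfl⟩⟩)⟩
    rintro ⟨y, hy, hyx⟩
    have hyx : s.SameCycle y x := Quotient.exact hyx
    exact hyx.mem_of_closed (A := u) (fun z hz => (hu z).2 hz) hy

/-- A ring together with the codes of the legs inserted at its corners, of total size `v`. -/
abbrev NodeCode (v : ℕ) : Type :=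
  {t : Σ q : RingShape, Fin (q.1.2 + 1) × Bool → Code // (Code.node t.1 t.2).size = v}

theorem card_nodeCode {v : ℕ} (hv : v ≠ 0) :
    Nat.card (NodeCode v) = Nat.card {c : Code // c.size = v} := by
  refine Nat.card_eq_of_bijective (fun t => ⟨Code.node t.1.1 t.1.2, t.2⟩) ⟨?_, ?_⟩
  · rintro ⟨⟨q, ch⟩, h⟩ ⟨⟨q', ch'⟩, h'⟩ hh
    obtain ⟨rfl, hch⟩ := Code.node.inj (congrArg Subtype.val hh)
    obtain rfl := eq_of_heq hch
    rfl
  · rintro ⟨c, hc⟩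
    cases c with
    | leaf => exact absurd hc.symm hv
    | node q ch => exact ⟨⟨⟨q, ch⟩, hc⟩, rfl⟩

/-- A diagram is determined by a code and, for each crossing, the choice of one of two strands. -/
theorem RootedLinkDiagram.count_two_mul {v : ℕ} (hv : v ≠ 0) :
    RootedLinkDiagram.count (2 * v) = 2 ^ v * Nat.card {c : Code // c.size = v} := by
  have hdart : ∀ t : NodeCode v, Nat.card (Code.Dart t.1.1 t.1.2) = 2 * v := by
    rintro ⟨⟨q, ch⟩, ht⟩
    exact ((Code.node q ch).card_leg).trans (by rw [ht])
  -- the codes together with a choice of crossings, that is, a set invariant under `flip`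
  let Y : Type := Σ t : NodeCode v,
    {u : Set (Code.Dart t.1.1 t.1.2) // ∀ x, Code.flip t.1.1 t.1.2 x ∈ u ↔ x ∈ u}
  have hY : Nat.card Y = 2 ^ v * Nat.card {c : Code // c.size = v} := by
    have e : ∀ t : NodeCode v, {u : Set (Code.Dart t.1.1 t.1.2) //
        ∀ x, Code.flip t.1.1 t.1.2 x ∈ u ↔ x ∈ u} ≃ Fin (2 ^ v) := by
      intro t
      have h1 := card_invariant (Code.flip t.1.1 t.1.2)
      have h2 := (Code.good t.1.1 t.1.2).inv.two_mul_cyc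
      rw [hdart] at h2
      rw [show cyc (Code.flip t.1.1 t.1.2) = v by omega] at h1
      exact Nat.equivFinOfCardPos (by rw [h1]; positivity) |>.trans (finCongr h1)
    rw [Nat.card_congr ((Equiv.sigmaCongrRight e).trans (Equiv.sigmaEquivProd _ _)), Nat.card_prod,
      card_nodeCode hv, Nat.card_fin, mul_comm]
  let Rep : RootedLinkDiagram.K4MinorFree (Fin (2 * (2 * v))) → Y → Prop := fun R y =>
    Represents R.1 (Code.perm y.1.1.1 y.1.1.2) (Code.flip y.1.1.1 y.1.1.2)
      (Code.root y.1.1.1 y.1.1.2) y.2.1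
  have hex : ∀ y, ∃ R, Rep R y := by
    rintro ⟨t, u, hu⟩
    have hg := Code.good t.1.1 t.1.2
    have hcard : Nat.card (Code.Dart t.1.1 t.1.2 × Bool) = 2 * (2 * v) := by
      rw [Nat.card_prod, hdart, mul_comm]
      simp
    obtain ⟨R, hR⟩ := exists_diagram (Finite.equivFinOfCardEq hcard) hg.inv hg.conn hg.planar
      (Code.root t.1.1 t.1.2) hu
    refine ⟨⟨R, ?_⟩, hR⟩
    obtain ⟨h, H, _⟩ := hR
    exact (H.isK4MinorFree_iff hg.inv).2 hg.free
  have hex' : ∀ R, ∃ y, Rep R y := by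
    rintro ⟨R, hR⟩
    obtain ⟨D', P, s, d, u, _, hg, hu, hrep⟩ := exists_represents R hR
    obtain ⟨q, ch, J, hP, hs, hr⟩ := exists_code _ rfl hg d
    have hv : (Code.node q ch).size = v := by
      obtain ⟨h, H, _⟩ := hrep
      have h1 := H.card
      have h2 := Nat.card_congr J
      have h3 : Nat.card (Code.Dart q ch) = 2 * _ := (Code.node q ch).card_leg
      rw [Nat.card_fin] at h1
      omega
    refine ⟨⟨⟨⟨q, ch⟩, hv⟩, J ⁻¹' u, fun x => ?_⟩, ?_⟩
    · rw [Set.mem_preimage, hs, hu]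
      rfl
    · obtain ⟨h, H, hd, hup⟩ := hrep
      refine ⟨h ∘ J, ⟨H.inj.comp J.injective, fun x => ?_, fun x => ?_, fun y => ?_⟩, ?_, ?_⟩
      · exact (H.perm _).trans (congrArg h (hP x).symm)
      · exact (H.flip _).trans (congrArg h (hs x).symm)
      · rw [J.surjective.range_comp]
        exact H.cover y
      · exact (congrArg h hr).trans hd
      · exact fun x => hup (J x)
  have hiff : ∀ R R' y y', Rep R y → Rep R' y' → (RootedLinkDiagram.Iso R.1 R'.1 ↔ y = y') := by
    rintro R R' ⟨⟨⟨q, ch⟩, ht⟩, u, hu⟩ ⟨⟨⟨q', ch'⟩, ht'⟩, u', hu'⟩ hR hR'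
    rw [Represents.iso_iff hR hR']
    constructor
    · rintro ⟨f, hP, hs, hd, huu⟩
      have hiso : (Code.node q ch).leg.Isomorphic (Code.node q' ch').leg := by
        refine ⟨f, fun (x : Option (Code.Dart q ch)) => ?_, hs⟩
        change openPerm (Code.perm q' ch') (Code.root q' ch') (x.map f) =
          (openPerm (Code.perm q ch) (Code.root q ch) x).map f
        rcases x with _ | x
        · rw [openPerm_none, Option.map_none, openPerm_none, Option.map_some]
          exact congrArg some ((congrArg _ hd.symm).trans (hP _).symm)
        · by_cases hx : x = Code.root q ch
          · rw [hx, openPerm_root, Option.map_some, Option.map_none]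
            refine (congrArg _ ?_).trans openPerm_root
            exact congrArg some hd
          · have hx' : f x ≠ Code.root q' ch' := fun h => hx (f.injective (h.trans hd.symm))
            rw [openPerm_of_ne hx, Option.map_some, openPerm_of_ne hx', Option.map_some]
            exact congrArg some (hP x).symm
      obtain ⟨rfl, hch⟩ := Code.node.inj (Code.eq_of_isomorphic _ _ hiso)
      obtain rfl := eq_of_heq hch
      -- the isomorphism fixes the root, so it is the identity, and the crossings agree
      have hid := (Code.good q ch).conn.eq_of_fixed (f := f) hP hs hd
      obtain rfl : u = u' := by
        ext x
        have := huu x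
        rw [show f x = x from hid x] at this
        exact this.symm
      rfl
    · intro h
      cases h
      exact ⟨Equiv.refl _, fun _ => rfl, fun _ => rfl, rfl, fun _ => Iff.rfl⟩
  choose R hR using hex
  rw [← hY]
  symm
  refine Nat.card_eq_of_bijective (fun y => Quotient.mk (RootedLinkDiagram.k4Setoid _) (R y)) ⟨?_, ?_⟩
  · intro y y' h
    exact (hiff _ _ _ _ (hR y) (hR y')).1 (Quotient.exact h)
  · intro x
    induction x using Quotient.inductionOn with | _ R' => ?_
    obtain ⟨y, hy⟩ := hex' R'
    exact ⟨y, Quotient.sound ((hiff _ _ _ _ (hR y) hy).2 rfl)⟩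

/-! ### Lagrange inversion -/

section Lagrange

open PowerSeries

variable {F : Type*} [Field F] [CharZero F]

/-- The residue of a derivative vanishes: the coefficient in question is the residue of
`w' / w ^ (m + 1)`, where `w = X * φ`. -/
theorem coeff_derivative_mul_inv_pow {φ ψ : F⟦X⟧} (h : φ * ψ = 1) {m : ℕ} (hm : m ≠ 0) :
    coeff m (d⁄dX F (X * φ) * ψ ^ (m + 1)) = 0 := by
  obtain ⟨m, rfl⟩ := Nat.exists_eq_succ_of_ne_zero hm
  have hψ : d⁄dX F ψ = -(d⁄dX F φ * ψ ^ 2) := by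
    have h1 : d⁄dX F (φ * ψ) = 0 := by rw [h]; simp
    rw [Derivation.leibniz, smul_eq_mul, smul_eq_mul] at h1
    linear_combination ψ * h1 - d⁄dX F ψ * h
  have h2 : d⁄dX F (X * φ) * ψ ^ (m + 1 + 1) * ((m + 1 : ℕ) : F⟦X⟧) =
      ψ ^ (m + 1) * ((m + 1 : ℕ) : F⟦X⟧) - X * d⁄dX F (ψ ^ (m + 1)) := by
    rw [Derivation.leibniz, Derivation.leibniz_pow, hψ, derivative_X]
    simp only [smul_eq_mul, nsmul_eq_mul, Nat.add_sub_cancel]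
    linear_combination (ψ ^ (m + 1) * ((m + 1 : ℕ) : F⟦X⟧)) * h
  have h3 := congrArg (coeff (m + 1)) h2
  rw [← map_natCast (C (R := F)), coeff_mul_C, map_sub, coeff_mul_C, coeff_succ_X_mul,
    coeff_derivative] at h3
  push_cast at h3
  rw [sub_self, mul_eq_zero] at h3
  exact h3.resolve_right (by exact_mod_cast Nat.succ_ne_zero m)

/-- The residue of `K / X ^ (m + 1)` is invariant under the substitution of `w = X * φ` for `X`. -/
theorem coeff_eq_coeff_subst {φ ψ : F⟦X⟧} (h : φ * ψ = 1) (m : ℕ) (K : F⟦X⟧) :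
    coeff m K = coeff m (K.subst (X * φ) * d⁄dX F (X * φ) * ψ ^ (m + 1)) := by
  have hsub : HasSubst (X * φ) := HasSubst.of_constantCoeff_zero' (by simp)
  have hK : ∀ K : F⟦X⟧, K.subst (X * φ) = C (coeff 0 K) +
      X * φ * (mk fun i => coeff (i + 1) K).subst (X * φ) := by
    intro K
    conv_lhs => rw [eq_X_mul_shift_add_const K]
    rw [subst_add hsub, subst_mul hsub, subst_X hsub, add_comm, coeff_zero_eq_constantCoeff_apply]
    congr 1
    exact subst_C _
  induction m generalizing K with
  | zero =>
    have h0 : constantCoeff φ * constantCoeff ψ = 1 := by rw [← map_mul, h, map_one]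
    rw [hK, coeff_zero_eq_constantCoeff_apply, coeff_zero_eq_constantCoeff_apply]
    simp [mul_assoc, h0]
  | succ m ih =>
    have hres := coeff_derivative_mul_inv_pow h (Nat.succ_ne_zero m)
    have e : K.subst (X * φ) * d⁄dX F (X * φ) * ψ ^ (m + 1 + 1) =
        C (coeff 0 K) * (d⁄dX F (X * φ) * ψ ^ (m + 1 + 1)) +
        X * ((mk fun i => coeff (i + 1) K).subst (X * φ) * d⁄dX F (X * φ) * ψ ^ (m + 1)) := by
      rw [hK]
      linear_combination (X * (mk fun i => coeff (i + 1) K).subst (X * φ) * d⁄dX F (X * φ) *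
        ψ ^ (m + 1)) * h
    rw [e, map_add, coeff_C_mul, hres, mul_zero, zero_add, coeff_succ_X_mul, ← ih, coeff_mk]

/-- Lagrange inversion for the equation `N = B(z N ^ 2)`. -/
theorem lagrange {B N : F⟦X⟧} (hB : constantCoeff B = 1) (hN : N = B.subst (X * N ^ 2)) (v : ℕ) :
    (2 * v + 1) * coeff v N = coeff v (B ^ (2 * v + 1)) := by
  have hsub : HasSubst (X * N ^ 2) := HasSubst.of_constantCoeff_zero' (by simp)
  have hN0 : constantCoeff N = 1 := by
    have := coeff_subst' hsub B 0
    rw [← hN, finsum_eq_single _ 0] at this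
    · simpa [hB] using this
    · intro n hn
      simp [hn]
  obtain ⟨M, hM⟩ : ∃ M, N * M = 1 := ⟨N⁻¹, PowerSeries.mul_inv_cancel _ (by simp [hN0])⟩
  rcases v with _ | v
  · simp [hN0, hB]
  have hφ : N ^ 2 * M ^ 2 = 1 := by rw [← mul_pow, hM, one_pow]
  have h1 := coeff_eq_coeff_subst hφ v (d⁄dX F B * B ^ (2 * (v + 1)))
  have h2 : (d⁄dX F B * B ^ (2 * (v + 1))).subst (X * N ^ 2) * d⁄dX F (X * N ^ 2) *
      (M ^ 2) ^ (v + 1) = d⁄dX F N := by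
    have h3 := derivative_subst (f := B) hsub
    rw [← hN] at h3
    rw [subst_mul hsub, subst_pow hsub, ← hN, h3, ← pow_mul]
    have h4 : N ^ (2 * (v + 1)) * M ^ (2 * (v + 1)) = 1 := by rw [← mul_pow, hM, one_pow]
    linear_combination ((d⁄dX F B).subst (X * N ^ 2) * d⁄dX F (X * N ^ 2)) * h4
  have h5 : d⁄dX F (B ^ (2 * (v + 1) + 1)) =
      C ((2 * (v + 1) + 1 : ℕ) : F) * (d⁄dX F B * B ^ (2 * (v + 1))) := by
    rw [Derivation.leibniz_pow, map_natCast]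
    simp only [smul_eq_mul, nsmul_eq_mul, Nat.add_sub_cancel]
    ring
  have h6 := congrArg (coeff v) h5
  rw [coeff_C_mul, h1, h2, coeff_derivative, coeff_derivative] at h6
  have hv : (v : F) + 1 ≠ 0 := by exact_mod_cast Nat.succ_ne_zero v
  apply mul_right_cancel₀ hv
  rw [h6]
  push_cast
  ring

end Lagrange

/-! ### The number of codes -/

theorem card_antidiagonal_fibre {A A' : Type*} (w : A → ℕ) (w' : A' → ℕ)
    (h : ∀ n, Finite {a // w a = n}) (h' : ∀ n, Finite {a // w' a = n}) (m : ℕ) :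
    Nat.card {x : A × A' // w x.1 + w' x.2 = m} = ∑ p ∈ Finset.HasAntidiagonal.antidiagonal m,
      Nat.card {a // w a = p.1} * Nat.card {a // w' a = p.2} := by
  let e : {x : A × A' // w x.1 + w' x.2 = m} ≃
      Σ p : Finset.HasAntidiagonal.antidiagonal m, {a // w a = p.1.1} × {a // w' a = p.1.2} :=
    { toFun := fun x => ⟨⟨(w x.1.1, w' x.1.2), Finset.HasAntidiagonal.mem_antidiagonal.2 x.2⟩, ⟨x.1.1, rfl⟩,
        ⟨x.1.2, rfl⟩⟩
      invFun := fun y => ⟨(y.2.1.1, y.2.2.1), by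
        rw [y.2.1.2, y.2.2.2]
        exact Finset.HasAntidiagonal.mem_antidiagonal.1 y.1.2⟩
      left_inv := fun x => rfl
      right_inv := by
        rintro ⟨⟨⟨i, j⟩, hij⟩, ⟨a, ha⟩, ⟨b, hb⟩⟩
        obtain rfl : w a = i := ha
        obtain rfl : w' b = j := hb
        rfl }
  rw [Nat.card_congr e, Nat.card_sigma]
  simp only [Nat.card_prod]
  exact Finset.sum_coe_sort (Finset.HasAntidiagonal.antidiagonal m)
    fun p => Nat.card {a // w a = p.1} * Nat.card {a // w' a = p.2}

namespace Code

theorem finite_size_lt (v : ℕ) : Finite {c : Code // c.size < v} := by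
  classical
  induction v with
  | zero => exact ⟨⟨fun c => absurd c.2 (Nat.not_lt_zero _), fun x => x.elim0, fun c =>
      absurd c.2 (Nat.not_lt_zero _), fun x => x.elim0⟩⟩
  | succ v ih =>
    let g : Option (Σ x : Bool × Fin v, Fin (x.2 + 1) × Bool → {c : Code // c.size < v}) → Code
      | none => leaf
      | some ⟨x, ch⟩ => if h : (x.1, (x.2 : ℕ)) ≠ (false, 1) then
          node ⟨(x.1, x.2), h⟩ fun e => (ch e).1 else leaf
    refine (((Set.finite_range g).subset ?_).to_subtype : Finite {c : Code | c.size < v + 1})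
    rintro (_ | ⟨⟨⟨κ, k⟩, hq⟩, ch⟩) hc
    · exact ⟨none, rfl⟩
    · have hc : k + 1 + ∑ e, (ch e).size < v + 1 := hc
      have hch : ∀ e, (ch e).size < v := fun e => by
        have := Finset.single_le_sum (f := fun e => (ch e).size) (fun _ _ => Nat.zero_le _)
          (Finset.mem_univ e)
        have this : (ch e).size ≤ ∑ e, (ch e).size := this
        omega
      refine ⟨some ⟨(κ, ⟨k, by omega⟩), fun e => ⟨ch e, hch e⟩⟩, ?_⟩
      exact dif_pos hq

theorem finite_size_eq (v : ℕ) : Finite {c : Code // c.size = v} := by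
  have := finite_size_lt (v + 1)
  exact Finite.of_injective (fun c => (⟨c.1, by rw [c.2]; omega⟩ : {c : Code // c.size < v + 1}))
    fun c c' h => Subtype.ext (congrArg (fun c => c.1) h)

open PowerSeries

/-- The generating function of the codes by size. -/
noncomputable def genFun : ℝ⟦X⟧ := mk fun v => (Nat.card {c : Code // c.size = v} : ℝ)

theorem card_tuples (n : ℕ) : ∀ m, Finite {ch : Fin n → Code // ∑ i, (ch i).size = m} ∧
    (Nat.card {ch : Fin n → Code // ∑ i, (ch i).size = m} : ℝ) = coeff m (genFun ^ n) := by
  induction n with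
  | zero =>
    intro m
    refine ⟨inferInstance, ?_⟩
    rw [pow_zero, coeff_one]
    split_ifs with h
    · subst h
      rw [Nat.card_eq_one_iff_unique.2 ⟨inferInstance, ⟨⟨Fin.elim0, rfl⟩⟩⟩, Nat.cast_one]
    · have : IsEmpty {ch : Fin 0 → Code // ∑ i, (ch i).size = m} :=
        ⟨fun ch => h (ch.2.symm.trans (Finset.sum_of_isEmpty _))⟩
      rw [Nat.card_of_isEmpty, Nat.cast_zero]
  | succ n ih =>
    intro m
    have e : {ch : Fin (n + 1) → Code // ∑ i, (ch i).size = m} ≃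
        {x : Code × (Fin n → Code) // x.1.size + ∑ i, (x.2 i).size = m} :=
      (Fin.consEquiv fun _ => Code).symm.subtypeEquiv fun ch => by
        rw [Fin.sum_univ_succ]
        rfl
    refine ⟨?_, ?_⟩
    · rw [e.finite_iff]
      have := finite_size_lt (m + 1)
      have : ∀ j : Fin (m + 1), Finite {ch : Fin n → Code // ∑ i, (ch i).size = j} := fun j => (ih j).1
      refine Finite.of_injective (fun x => ((⟨x.1.1, by have := x.2; omega⟩,
        ⟨⟨∑ i, (x.1.2 i).size, by have := x.2; omega⟩, ⟨x.1.2, rfl⟩⟩) :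
        {c : Code // c.size < m + 1} × Σ j : Fin (m + 1),
          {ch : Fin n → Code // ∑ i, (ch i).size = j})) ?_
      intro x y hxy
      have h1 := congrArg (fun z => z.1.1) hxy
      have h2 := congrArg (fun z => z.2.2.1) hxy
      exact Subtype.ext (Prod.ext h1 h2)
    · rw [Nat.card_congr e, card_antidiagonal_fibre (fun c : Code => c.size)
        (fun ch : Fin n → Code => ∑ i, (ch i).size) finite_size_eq (fun m => (ih m).1), pow_succ',
        coeff_mul]
      push_cast
      refine Finset.sum_congr rfl fun p _ => ?_
      rw [(ih p.2).2, genFun, coeff_mk]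

/-- The generating function of rings by size, together with the empty map: there are two rings with
`n` vertices for `n ≠ 0, 2`, and one for `n = 2`. -/
noncomputable def ringGenFun : ℝ⟦X⟧ := mk fun n => if n = 0 ∨ n = 2 then 1 else 2

/-- A code is a ring with codes at each of its corners, whose number is twice the number of its
vertices. -/
theorem genFun_eq : genFun = ringGenFun.subst (X * genFun ^ 2) := by
  have hsub : HasSubst (X * genFun ^ 2) := HasSubst.of_constantCoeff_zero' (by simp)
  ext v
  rw [coeff_subst' hsub]
  have hterm : ∀ d, coeff v ((X * genFun ^ 2) ^ d) =
      if d ≤ v then coeff (v - d) (genFun ^ (2 * d)) else 0 := by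
    intro d
    rw [mul_pow, ← pow_mul, coeff_X_pow_mul']
  rw [finsum_eq_sum_of_support_subset (s := Finset.range (v + 1))]
  swap
  · intro d hd
    by_contra hdv
    rw [Finset.coe_range, Set.mem_Iio, not_lt] at hdv
    apply hd
    simp only [hterm]
    rw [if_neg (by omega), smul_zero]
  simp only [hterm]
  rw [Finset.sum_range_succ']
  rcases eq_or_ne v 0 with rfl | hv
  · have : Nat.card {c : Code // c.size = 0} = 1 := by
      rw [Nat.card_eq_one_iff_unique]
      refine ⟨⟨?_⟩, ⟨⟨leaf, rfl⟩⟩⟩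
      rintro ⟨c, hc⟩ ⟨c', hc'⟩
      cases c with
      | leaf =>
        cases c' with
        | leaf => rfl
        | node q ch => simp only [size] at hc'; omega
      | node q ch => simp only [size] at hc; omega
    simp [genFun, this, ringGenFun]
  · rw [genFun, coeff_mk, ← card_nodeCode hv, ← genFun]
    -- sort the codes by the shape of the outermost ring
    let e : NodeCode v ≃ Σ x : Bool × Fin v, {ch : Fin (x.2 + 1) × Bool → Code //
        (x.1, (x.2 : ℕ)) ≠ (false, 1) ∧ x.2 + 1 + ∑ e, (ch e).size = v} :=
      { toFun := fun t => ⟨(t.1.1.1.1, ⟨t.1.1.1.2, by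
            have : t.1.1.1.2 + 1 + ∑ e, (t.1.2 e).size = v := t.2
            omega⟩), t.1.2, t.1.1.2, t.2⟩
        invFun := fun y => ⟨⟨⟨(y.1.1, y.1.2), y.2.2.1⟩, y.2.1⟩, y.2.2.2⟩
        left_inv := fun t => rfl
        right_inv := fun y => rfl }
    have hfib : ∀ x : Bool × Fin v, Finite {ch : Fin (x.2 + 1) × Bool → Code //
        (x.1, (x.2 : ℕ)) ≠ (false, 1) ∧ x.2 + 1 + ∑ e, (ch e).size = v} ∧
        (Nat.card {ch : Fin (x.2 + 1) × Bool → Code //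
          (x.1, (x.2 : ℕ)) ≠ (false, 1) ∧ x.2 + 1 + ∑ e, (ch e).size = v} : ℝ) =
        if (x.1, (x.2 : ℕ)) ≠ (false, 1) then
          coeff (v - (x.2 + 1)) (genFun ^ (2 * ((x.2 : ℕ) + 1))) else 0 := by
      rintro ⟨κ, k, hk⟩
      by_cases hq : (κ, k) ≠ (false, 1)
      · have e' : {ch : Fin (k + 1) × Bool → Code //
            (κ, k) ≠ (false, 1) ∧ k + 1 + ∑ e, (ch e).size = v} ≃
            {ch : Fin (2 * (k + 1)) → Code // ∑ i, (ch i).size = v - (k + 1)} := by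
          have e₀ : Fin (k + 1) × Bool ≃ Fin (2 * (k + 1)) :=
            Fintype.equivFinOfCardEq (by simp [mul_comm])
          refine (e₀.arrowCongr (Equiv.refl Code)).subtypeEquiv fun ch => ?_
          have : ∑ i, ((e₀.arrowCongr (Equiv.refl Code)) ch i).size = ∑ e, (ch e).size := by
            rw [← e₀.sum_comp]
            simp
          rw [this]
          constructor
          · rintro ⟨_, h⟩
            omega
          · intro h
            exact ⟨hq, by omega⟩
        have := card_tuples (2 * (k + 1)) (v - (k + 1))
        refine ⟨e'.finite_iff.2 this.1, ?_⟩
        rw [Nat.card_congr e', this.2]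
        exact (if_pos hq).symm
      · have : IsEmpty {ch : Fin (k + 1) × Bool → Code //
            (κ, k) ≠ (false, 1) ∧ k + 1 + ∑ e, (ch e).size = v} := ⟨fun ch => hq ch.2.1⟩
        refine ⟨inferInstance, ?_⟩
        change (Nat.card {ch : Fin (k + 1) × Bool → Code //
            (κ, k) ≠ (false, 1) ∧ k + 1 + ∑ e, (ch e).size = v} : ℝ) = if (κ, k) ≠ (false, 1) then _ else _
        rw [if_neg hq, Nat.card_of_isEmpty, Nat.cast_zero]
    have := fun x => (hfib x).1
    rw [Nat.card_congr e, Nat.card_sigma, Nat.cast_sum, Finset.sum_congr rfl fun x _ => (hfib x).2,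
      Fintype.sum_prod_type, Fintype.sum_bool, ← Finset.sum_add_distrib,
      Fin.sum_univ_eq_sum_range (fun k => (if (true, k) ≠ (false, 1) then
          coeff (v - (k + 1)) (genFun ^ (2 * (k + 1))) else 0) +
        if (false, k) ≠ (false, 1) then coeff (v - (k + 1)) (genFun ^ (2 * (k + 1))) else 0) v]
    have h0 : (if 0 ≤ v then coeff (v - 0) (genFun ^ (2 * 0)) else 0) = 0 := by
      simp [coeff_one, hv]
    rw [h0, smul_zero, add_zero]
    refine Finset.sum_congr rfl fun k hk => ?_
    rw [Finset.mem_range] at hk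
    rw [if_pos (by omega : k + 1 ≤ v), ringGenFun, coeff_mk]
    -- the ring with two vertices occurs for `κ = true` only
    by_cases h1 : k = 1
    · simp [h1]
    · simp [h1]
      ring

/-- The number of codes of a given size. -/
theorem card_size_eq (v : ℕ) : (2 * v + 1) * (Nat.card {c : Code // c.size = v} : ℝ) =
    coeff v (ringGenFun ^ (2 * v + 1)) := by
  have := lagrange (by simp [ringGenFun, ← coeff_zero_eq_constantCoeff_apply]) genFun_eq v
  rwa [genFun, coeff_mk] at this

end Code

/-! ### The coefficients of powers as Fourier integrals -/

/-- The sum of the power series `Code.ringGenFun`. -/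
noncomputable def ringFun {K : Type*} [Field K] (z : K) : K := 2 / (1 - z) - 1 - z ^ 2

section Fourier

open PowerSeries MeasureTheory

theorem hasSum_ringGenFun {z : ℂ} (hz : ‖z‖ < 1) :
    HasSum (fun n => ((coeff n Code.ringGenFun : ℝ) : ℂ) * z ^ n) (ringFun z) := by
  have h1 := (hasSum_geometric_of_norm_lt_one hz).mul_left 2
  have h2 := hasSum_ite_eq 0 (1 : ℂ)
  have h3 := hasSum_ite_eq 2 (z ^ 2)
  have h := (h1.sub h2).sub h3
  rw [← div_eq_mul_inv] at h
  refine (congrArg (HasSum · _) (funext fun n => ?_)).mpr h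
  rw [Code.ringGenFun, coeff_mk]
  rcases eq_or_ne n 0 with rfl | h0
  · norm_num
  · rcases eq_or_ne n 2 with rfl | h2
    · norm_num
      ring
    · simp [h0, h2]

theorem summable_ringGenFun {z : ℂ} (hz : ‖z‖ < 1) :
    Summable fun n => ‖((coeff n Code.ringGenFun : ℝ) : ℂ) * z ^ n‖ := by
  refine Summable.of_nonneg_of_le (fun _ => norm_nonneg _) (fun n => ?_)
    ((summable_geometric_of_lt_one (norm_nonneg z) hz).mul_left 2)
  rw [norm_mul, norm_pow]
  gcongr
  rw [Code.ringGenFun, coeff_mk]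
  split_ifs <;> norm_num

theorem summable_norm_and_tsum_of_antidiagonal {f g h : ℕ → ℂ} {a b : ℂ}
    (hh : ∀ n, h n = ∑ p ∈ Finset.HasAntidiagonal.antidiagonal n, f p.1 * g p.2)
    (hf : Summable fun n => ‖f n‖) (hg : Summable fun n => ‖g n‖)
    (ha : ∑' n, f n = a) (hb : ∑' n, g n = b) :
    (Summable fun n => ‖h n‖) ∧ ∑' n, h n = a * b := by
  obtain rfl : h = _ := funext hh
  rw [← ha, ← hb]
  exact ⟨summable_norm_sum_mul_antidiagonal_of_summable_norm hf hg,
    (tsum_mul_tsum_eq_tsum_sum_antidiagonal_of_summable_norm hf hg).symm⟩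

theorem summable_ringGenFun_pow {z : ℂ} (hz : ‖z‖ < 1) (m : ℕ) :
    (Summable fun n => ‖((coeff n (Code.ringGenFun ^ m) : ℝ) : ℂ) * z ^ n‖) ∧
      ∑' n, ((coeff n (Code.ringGenFun ^ m) : ℝ) : ℂ) * z ^ n = ringFun z ^ m := by
  induction m with
  | zero =>
    have : ∀ n, ((coeff n (Code.ringGenFun ^ 0) : ℝ) : ℂ) * z ^ n = if n = 0 then 1 else 0 := by
      intro n
      rw [pow_zero, coeff_one]
      split_ifs with h
      · simp [h]
      · simp
    simp only [this]
    refine ⟨?_, by simp⟩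
    refine summable_of_ne_finset_zero (s := {0}) fun n hn => ?_
    rw [Finset.mem_singleton] at hn
    simp [hn]
  | succ m ih =>
    have key : ∀ n, ((coeff n (Code.ringGenFun ^ (m + 1)) : ℝ) : ℂ) * z ^ n =
        ∑ p ∈ Finset.HasAntidiagonal.antidiagonal n,
          (((coeff p.1 (Code.ringGenFun ^ m) : ℝ) : ℂ) * z ^ p.1) *
            (((coeff p.2 Code.ringGenFun : ℝ) : ℂ) * z ^ p.2) := by
      intro n
      rw [pow_succ, coeff_mul, Complex.ofReal_sum, Finset.sum_mul]
      refine Finset.sum_congr rfl fun p hp => ?_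
      rw [← Finset.HasAntidiagonal.mem_antidiagonal.1 hp, pow_add]
      push_cast
      ring
    rw [pow_succ (ringFun z)]
    exact summable_norm_and_tsum_of_antidiagonal key ih.1 (summable_ringGenFun hz) ih.2
      (hasSum_ringGenFun hz).tsum_eq

theorem integral_exp_int (k : ℤ) : ∫ θ in (-Real.pi)..Real.pi, Complex.exp (k * θ * Complex.I) =
    if k = 0 then (2 * Real.pi : ℂ) else 0 := by
  split_ifs with h
  · simp [h]
    ring
  · have hk : (k : ℂ) * Complex.I ≠ 0 := by simp [h]
    have := integral_exp_mul_complex (a := -Real.pi) (b := Real.pi) hk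
    simp only [mul_right_comm _ _ Complex.I]
    rw [this, div_eq_zero_iff]
    left
    have h2 : Complex.exp (k * Complex.I * Real.pi) =
        Complex.exp (k * Complex.I * (-Real.pi : ℝ)) := by
      rw [Complex.exp_eq_exp_iff_exists_int]
      refine ⟨k, ?_⟩
      push_cast
      ring
    rw [h2, sub_self]

theorem integral_ringFun_pow {r : ℝ} (h0 : 0 < r) (h1 : r < 1) (m v : ℕ) :
    ∫ θ in (-Real.pi)..Real.pi, ringFun (r * Complex.exp (θ * Complex.I)) ^ m *
      Complex.exp (-(v * θ * Complex.I)) =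
      2 * Real.pi * r ^ v * ((coeff v (Code.ringGenFun ^ m) : ℝ) : ℂ) := by
  have hz : ∀ θ : ℝ, ‖(r * Complex.exp (θ * Complex.I) : ℂ)‖ = r := by
    intro θ
    rw [norm_mul, Complex.norm_exp_ofReal_mul_I, mul_one, Complex.norm_real, Real.norm_of_nonneg h0.le]
  have hr : ‖(r : ℂ)‖ < 1 := by rwa [Complex.norm_real, Real.norm_of_nonneg h0.le]
  have hterm : ∀ (n : ℕ) (θ : ℝ), ((coeff n (Code.ringGenFun ^ m) : ℝ) : ℂ) *
      (r * Complex.exp (θ * Complex.I)) ^ n * Complex.exp (-(v * θ * Complex.I)) =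
      ((coeff n (Code.ringGenFun ^ m) : ℝ) : ℂ) * r ^ n * Complex.exp (((n - v : ℤ) : ℂ) * θ * Complex.I) := by
    intro n θ
    rw [mul_pow, ← Complex.exp_nat_mul]
    have : Complex.exp (((n - v : ℤ) : ℂ) * θ * Complex.I) =
        Complex.exp (n * (θ * Complex.I)) * Complex.exp (-(v * θ * Complex.I)) := by
      rw [← Complex.exp_add]
      congr 1
      push_cast
      ring
    rw [this]
    ring
  -- integrate the power series term by term
  have hsum := intervalIntegral.hasSum_integral_of_dominated_convergence (μ := volume)
    (a := -Real.pi) (b := Real.pi)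
    (F := fun n θ => ((coeff n (Code.ringGenFun ^ m) : ℝ) : ℂ) * (r * Complex.exp (θ * Complex.I)) ^ n *
      Complex.exp (-(v * θ * Complex.I)))
    (f := fun θ => ringFun (r * Complex.exp (θ * Complex.I)) ^ m *
      Complex.exp (-(v * θ * Complex.I)))
    (fun n _ => ‖((coeff n (Code.ringGenFun ^ m) : ℝ) : ℂ) * (r : ℂ) ^ n‖) ?_ ?_ ?_ ?_ ?_
  · rw [← hsum.tsum_eq, tsum_eq_single v]
    · simp only [hterm, sub_self]
      simp
      ring
    · intro n hn
      simp only [hterm]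
      rw [intervalIntegral.integral_const_mul, integral_exp_int, if_neg (by omega), mul_zero]
  · intro n
    exact (by fun_prop : Continuous _).aestronglyMeasurable
  · intro n
    refine Filter.Eventually.of_forall fun θ _ => ?_
    have : ‖Complex.exp (-(v * θ * Complex.I))‖ = 1 := by
      rw [show -(v * θ * Complex.I) = ((-(v * θ) : ℝ) : ℂ) * Complex.I by push_cast; ring,
        Complex.norm_exp_ofReal_mul_I]
    rw [norm_mul, this, mul_one, norm_mul, norm_mul, norm_pow, norm_pow, hz,
      show ‖(r : ℂ)‖ = r by rw [Complex.norm_real, Real.norm_of_nonneg h0.le]]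
  · exact Filter.Eventually.of_forall fun θ _ => (summable_ringGenFun_pow hr m).1
  · exact intervalIntegrable_const
  · refine Filter.Eventually.of_forall fun θ _ => HasSum.mul_right _ ?_
    have := summable_ringGenFun_pow (z := r * Complex.exp (θ * Complex.I)) (by rwa [hz]) m
    rw [← this.2]
    exact this.1.of_norm.hasSum

end Fourier

/-! ### A local limit theorem -/

section LocalLimit

open MeasureTheory

/-- Laplace's method for the integrals of the powers of `g`: the mass concentrates where
`θ` is of order `1 / √n`. -/
theorem tendsto_sqrt_mul_integral_pow {g h : ℝ → ℂ} {c S : ℝ} (hc : 0 < c)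
    (hg : Continuous g) (hh : Continuous h) (hh0 : h 0 = 1) (hh1 : ∀ θ, ‖h θ‖ ≤ 1)
    (hbound : ∀ θ, |θ| ≤ Real.pi → ‖g θ‖ ≤ Real.exp (-c * θ ^ 2))
    (hexp : (fun θ : ℝ => g θ - (1 - S * θ ^ 2 / 2)) =o[𝓝 0] fun θ => θ ^ 2) :
    Tendsto (fun n : ℕ => (√n : ℂ) * ∫ θ in (-Real.pi)..Real.pi, g θ ^ n * h θ) atTop
      (𝓝 (√(2 * Real.pi / S) : ℝ)) := by
  have hscale : Tendsto (fun n : ℕ => √(n : ℝ)) atTop atTop :=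
    Real.tendsto_sqrt_atTop.comp tendsto_natCast_atTop_atTop
  have hzero : ∀ t : ℝ, Tendsto (fun n : ℕ => t / √(n : ℝ)) atTop (𝓝 0) := fun t =>
    hscale.const_div_atTop t
  have hpoint : ∀ t : ℝ, Tendsto (fun n : ℕ => g (t / √(n : ℝ)) ^ n) atTop
      (𝓝 (Complex.exp ((-(S / 2) * t ^ 2 : ℝ) : ℂ))) := by
    intro t
    refine Complex.tendsto_pow_exp_of_isLittleO_sub_add_div _ ?_
    have h1 := hexp.comp_tendsto (hzero t)
    refine IsLittleO.trans_isBigO (h1.congr' ?_ EventuallyEq.rfl) ?_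
    · filter_upwards with n
      have hn : (√(n : ℝ) : ℂ) ^ 2 = n := by
        rw [← Complex.ofReal_pow, Real.sq_sqrt n.cast_nonneg, Complex.ofReal_natCast]
      simp only [Function.comp_apply]
      push_cast
      rw [div_pow, hn]
      ring
    · refine IsBigO.of_bound (t ^ 2) ?_
      filter_upwards with n
      simp only [Function.comp_apply]
      rw [div_pow, Real.sq_sqrt n.cast_nonneg, norm_div, norm_div, norm_one,
        Complex.norm_natCast, Real.norm_of_nonneg (sq_nonneg t), Real.norm_of_nonneg n.cast_nonneg]
      exact le_of_eq (by ring)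
  -- substitute `θ = t / √n`
  have hint : ∀ n : ℕ, n ≠ 0 → (√n : ℂ) * ∫ θ in (-Real.pi)..Real.pi, g θ ^ n * h θ =
      ∫ t : ℝ, (Set.Ioc (-Real.pi * √n) (Real.pi * √n)).indicator
        (fun t => g (t / √n) ^ n * h (t / √n)) t := by
    intro n hn
    have hs : 0 < √(n : ℝ) := Real.sqrt_pos.2 (by positivity)
    rw [integral_indicator measurableSet_Ioc, ← intervalIntegral.integral_of_le (by
        have := mul_pos Real.pi_pos hs
        linarith),
      intervalIntegral.integral_comp_div (fun θ => g θ ^ n * h θ) hs.ne',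
      mul_div_cancel_right₀ _ hs.ne', mul_div_cancel_right₀ _ hs.ne', Complex.real_smul]
  have hlim : ∫ t : ℝ, Complex.exp ((-(S / 2) * t ^ 2 : ℝ) : ℂ) = (√(2 * Real.pi / S) : ℝ) := by
    simp only [← Complex.ofReal_exp]
    rw [integral_complex_ofReal, integral_gaussian, div_div_eq_mul_div, mul_comm Real.pi]
  rw [← hlim]
  refine Tendsto.congr' (EventuallyEq.symm (eventually_ne_atTop 0 |>.mono hint)) ?_
  refine tendsto_integral_of_dominated_convergence (fun t => Real.exp (-c * t ^ 2)) ?_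
    (integrable_exp_neg_mul_sq hc) ?_ ?_
  · intro n
    refine Measurable.aestronglyMeasurable (Measurable.indicator ?_ measurableSet_Ioc)
    exact (by fun_prop : Continuous _).measurable
  · intro n
    refine Eventually.of_forall fun t => ?_
    rw [Set.indicator_apply]
    split_ifs with ht
    · rcases Nat.eq_zero_or_pos n with rfl | hn
      · simp at ht
      have hs : 0 < √(n : ℝ) := Real.sqrt_pos.2 (by positivity)
      have hb := hbound (t / √n) (by
        rw [abs_div, abs_of_pos hs, div_le_iff₀ hs, abs_le]
        exact ⟨by linarith [ht.1], ht.2⟩)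
      rw [norm_mul, norm_pow]
      calc ‖g (t / √n)‖ ^ n * ‖h (t / √n)‖ ≤ Real.exp (-c * (t / √n) ^ 2) ^ n * 1 := by
            gcongr
            exact hh1 _
        _ = Real.exp (-c * t ^ 2) := by
            rw [mul_one, ← Real.exp_nat_mul, div_pow, Real.sq_sqrt n.cast_nonneg]
            congr 1
            field_simp
    · rw [norm_zero]
      exact (Real.exp_pos _).le
  · refine Eventually.of_forall fun t => ?_
    have h2 : Tendsto (fun n : ℕ => g (t / √(n : ℝ)) ^ n * h (t / √(n : ℝ))) atTop
        (𝓝 (Complex.exp ((-(S / 2) * t ^ 2 : ℝ) : ℂ))) := by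
      have := (hpoint t).mul ((hh.tendsto 0).comp (hzero t))
      rwa [hh0, mul_one] at this
    refine h2.congr' ?_
    have hbig : Tendsto (fun n : ℕ => Real.pi * √(n : ℝ)) atTop atTop :=
      hscale.const_mul_atTop Real.pi_pos
    filter_upwards [hbig.eventually_gt_atTop |t|] with n hn
    rw [Set.indicator_of_mem]
    have := abs_lt.1 hn
    exact ⟨by linarith [this.1], this.2.le⟩

/-- The second order expansion of `exp (i l θ)`. -/
theorem exp_mul_I_sub_isLittleO (l : ℝ) :
    (fun θ : ℝ => Complex.exp (l * θ * Complex.I) - (1 + l * θ * Complex.I - l ^ 2 * θ ^ 2 / 2))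
      =o[𝓝 0] fun θ => θ ^ 2 := by
  have hlim : Tendsto (fun θ : ℝ => (l * θ * Complex.I : ℂ)) (𝓝 0) (𝓝 0) := by
    have : Continuous (fun θ : ℝ => (l * θ * Complex.I : ℂ)) := by fun_prop
    simpa using this.tendsto 0
  have hO : (fun θ : ℝ => Complex.exp (l * θ * Complex.I) -
      (1 + l * θ * Complex.I - l ^ 2 * θ ^ 2 / 2)) =O[𝓝 0] fun θ => θ ^ 3 := by
    refine IsBigO.of_bound (|l| ^ 3 * (4 * (6 * 3 : ℝ)⁻¹)) ?_
    filter_upwards [(hlim.norm.eventually (ge_mem_nhds (by norm_num : ‖(0 : ℂ)‖ < 1)))] with θ hθ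
    have := Complex.exp_bound hθ (n := 3) (by norm_num)
    simp only [Finset.sum_range_succ, Finset.sum_range_zero, Nat.factorial] at this
    refine (Eq.le ?_).trans (this.trans (Eq.le ?_))
    · congr 2
      push_cast
      linear_combination -(l ^ 2 * θ ^ 2 / 2 : ℂ) * Complex.I_sq
    · rw [norm_mul, norm_mul, Complex.norm_real, Complex.norm_real, Complex.norm_I]
      simp only [Real.norm_eq_abs, abs_pow]
      push_cast
      ring
  refine hO.trans_isLittleO ?_
  have h := (isBigO_refl (fun θ : ℝ => θ ^ 2) (𝓝 0)).mul_isLittleO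
    ((isLittleO_one_iff ℝ).2 (tendsto_id (α := ℝ) (x := 𝓝 0)))
  refine h.congr (fun θ => ?_) fun θ => ?_
  · simp only [id]; ring
  · ring

end LocalLimit

/-! ### The saddle point -/

section SaddlePoint

open MeasureTheory

theorem ringFun_eq_div {K : Type*} [Field K] {z : K} (hz : 1 - z ≠ 0) :
    ringFun z = (1 + z - z ^ 2 + z ^ 3) / (1 - z) := by
  rw [ringFun]
  field_simp
  ring

theorem one_lt_ringFun {r : ℝ} (h0 : 0 < r) (h1 : r < 1) : 1 < ringFun r := by
  have h : 0 < 1 - r := by linarith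
  rw [ringFun_eq_div h.ne', lt_div_iff₀ h]
  nlinarith [mul_pos h0 h, pow_pos h0 3]

/-- On the circle of radius `r` the function `ringFun` is largest at `r`: the first two terms
`1 + 2 z` of its expansion, whose coefficients are positive, already give a quadratic gap. -/
theorem norm_ringFun_le {r : ℝ} (h0 : 0 < r) (h1 : r < 1) {θ : ℝ} (hθ : |θ| ≤ Real.pi) :
    ‖ringFun (r * Complex.exp (θ * Complex.I))‖ ≤
      ringFun r - 4 * r / (Real.pi ^ 2 * (1 + 2 * r)) * θ ^ 2 := by
  set z : ℂ := r * Complex.exp (θ * Complex.I) with hz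
  have hnz : ‖z‖ = r := by
    rw [hz, norm_mul, Complex.norm_exp_ofReal_mul_I, mul_one, Complex.norm_real,
      Real.norm_of_nonneg h0.le]
  have hr1 : 0 < 1 - r := by linarith
  have h1z : 1 - r ≤ ‖1 - z‖ := by
    have := norm_sub_norm_le 1 z
    rwa [norm_one, hnz] at this
  have hne : 1 - z ≠ 0 := norm_pos_iff.1 (hr1.trans_le h1z)
  have hsplit : ringFun z = (1 + 2 * z) + (z ^ 2 + 2 * z ^ 3 / (1 - z)) := by
    rw [ringFun]
    field_simp
    ring
  have hsplit' : ringFun r = (1 + 2 * r) + (r ^ 2 + 2 * r ^ 3 / (1 - r)) := by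
    rw [ringFun]
    have := hr1.ne'
    field_simp
    ring
  have htail : ‖z ^ 2 + 2 * z ^ 3 / (1 - z)‖ ≤ r ^ 2 + 2 * r ^ 3 / (1 - r) := by
    refine (norm_add_le _ _).trans ?_
    rw [norm_div, norm_mul 2, norm_pow z, norm_pow z, hnz, Complex.norm_ofNat]
    gcongr
  have hcos := Real.cos_le_one_sub_mul_cos_sq hθ
  have hsq : ‖1 + 2 * z‖ ^ 2 = 1 + 4 * r ^ 2 + 4 * r * Real.cos θ := by
    rw [← Complex.normSq_eq_norm_sq, Complex.normSq_apply, hz]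
    simp [Complex.exp_ofReal_mul_I_re, Complex.exp_ofReal_mul_I_im]
    linear_combination 4 * r ^ 2 * Real.sin_sq_add_cos_sq θ
  -- `k` is chosen so that the square of the right-hand side is at least `(1 + 2 r) ^ 2 - 8 r θ ^ 2 / π ^ 2`
  have hhead : ‖1 + 2 * z‖ ≤ (1 + 2 * r) - 4 * r / (Real.pi ^ 2 * (1 + 2 * r)) * θ ^ 2 := by
    set k := 4 * r / (Real.pi ^ 2 * (1 + 2 * r)) with hk
    have hk2 : k * (1 + 2 * r) = 4 * r / Real.pi ^ 2 := by
      rw [hk]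
      field_simp
    have hpi := Real.pi_pos
    have hθ2 : θ ^ 2 ≤ Real.pi ^ 2 := sq_le_sq' (abs_le.1 hθ).1 (abs_le.1 hθ).2
    have hnn : 0 ≤ (1 + 2 * r) - k * θ ^ 2 := by
      have : k * θ ^ 2 * (1 + 2 * r) ≤ 4 * r := by
        rw [mul_right_comm, hk2, div_mul_eq_mul_div, div_le_iff₀ (by positivity)]
        gcongr
      nlinarith [sq_nonneg (1 - 2 * r)]
    refine abs_le_of_sq_le_sq' ?_ hnn |>.2
    rw [hsq]
    have h2 : 4 * r * Real.cos θ ≤ 4 * r - 2 * (k * (1 + 2 * r)) * θ ^ 2 := by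
      rw [hk2]
      calc 4 * r * Real.cos θ ≤ 4 * r * (1 - 2 / Real.pi ^ 2 * θ ^ 2) := by gcongr
        _ = _ := by ring
    nlinarith [sq_nonneg (k * θ ^ 2)]
  rw [hsplit, hsplit']
  refine (norm_add_le _ _).trans ?_
  linarith

/-- Minus the second derivative at `0` of the integrand normalised as in `saddle_expansion`: the
variance of the Gaussian that approximates its powers. -/
noncomputable def saddleVariance (r : ℝ) : ℝ :=
  ((1 + r - 9 * r ^ 2 + 25 * r ^ 3) / 4 + r * ringFun r) / (1 + r - r ^ 2 + r ^ 3)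

/-- The integrand on the circle of radius `r`, normalised to be `1` at `θ = 0`. The quartic
equation for `r` is the saddle point equation, which makes the linear term vanish. -/
theorem saddle_expansion {r : ℝ} (h0 : 0 < r) (h1 : r < 1)
    (hr : 3 * r ^ 4 - 6 * r ^ 3 + 2 * r ^ 2 - 4 * r + 1 = 0) :
    (fun θ : ℝ => ringFun (r * Complex.exp (θ * Complex.I)) / (ringFun r : ℝ) *
      Complex.exp (((-1 / 2 : ℝ) : ℂ) * θ * Complex.I) - (1 - saddleVariance r * θ ^ 2 / 2))
      =o[𝓝 0] fun θ => θ ^ 2 := by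
  have hr1 : 1 - r ≠ 0 := by linarith
  have hB := one_lt_ringFun h0 h1
  have hBeq := ringFun_eq_div hr1
  set B := ringFun r with hBdef
  set S := saddleVariance r with hS
  have hP : 1 + r - r ^ 2 + r ^ 3 = B * (1 - r) := by rw [hBeq]; field_simp
  have hSeq : S * (B * (1 - r)) = (1 + r - 9 * r ^ 2 + 25 * r ^ 3) / 4 + r * B := by
    rw [hS, saddleVariance, hP, div_mul_cancel₀]
    exact mul_ne_zero (by linarith) hr1
  have hlin : -1 / 2 + r / 2 - 3 * r ^ 2 / 2 + 5 * r ^ 3 / 2 + B * r = 0 := by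
    have : (-1 / 2 + r / 2 - 3 * r ^ 2 / 2 + 5 * r ^ 3 / 2 + B * r) * (1 - r) = 0 := by
      linear_combination (-1 / 2 : ℝ) * hr - r * hP
    exact (mul_eq_zero.1 this).resolve_right hr1
  have hPc : (1 + r - r ^ 2 + r ^ 3 : ℂ) = B * (1 - r) := by exact_mod_cast hP
  have hSc : (S * (B * (1 - r)) : ℂ) = (1 + r - 9 * r ^ 2 + 25 * r ^ 3) / 4 + r * B := by
    have := congrArg (fun x : ℝ => (x : ℂ)) hSeq
    push_cast at this
    exact this
  have hlc : (-1 / 2 + r / 2 - 3 * r ^ 2 / 2 + 5 * r ^ 3 / 2 + B * r : ℂ) = 0 := by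
    have := congrArg (fun x : ℝ => (x : ℂ)) hlin
    push_cast at this
    exact this
  have hBc : (B : ℂ) ≠ 0 := by exact_mod_cast (by linarith : B ≠ 0)
  have hne : ∀ θ : ℝ, (1 - r * Complex.exp (θ * Complex.I) : ℂ) ≠ 0 := by
    intro θ h
    have h2 : ‖(r * Complex.exp (θ * Complex.I) : ℂ)‖ = 1 := by
      rw [← sub_eq_zero.1 h, norm_one]
    rw [norm_mul, Complex.norm_exp_ofReal_mul_I, mul_one, Complex.norm_real,
      Real.norm_of_nonneg h0.le] at h2
    linarith
  -- the difference is a combination of Taylor remainders, divided by `B (1 - r exp (i θ))`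
  set E : ℝ → ℝ → ℂ := fun l θ => Complex.exp (l * θ * Complex.I) -
    (1 + l * θ * Complex.I - l ^ 2 * θ ^ 2 / 2) with hE
  have hEo : ∀ l, E l =o[𝓝 0] fun θ : ℝ => θ ^ 2 := exp_mul_I_sub_isLittleO
  have hcont : ∀ {u : ℝ → ℂ}, Continuous u → u =O[𝓝 0] fun _ => (1 : ℝ) := fun hu =>
    (hu.tendsto 0).isBigO_one ℝ
  have hsmall : (fun θ : ℝ => (θ : ℂ) ^ 2 * (θ * (B * r * S / 2 * (Complex.I - θ / 2)))) =o[𝓝 0]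
      fun θ : ℝ => θ ^ 2 := by
    have h2 : (fun θ : ℝ => (θ : ℂ) ^ 2) =O[𝓝 0] fun θ : ℝ => θ ^ 2 :=
      IsBigO.of_bound 1 (Eventually.of_forall fun θ => by simp)
    have hc : Continuous (fun θ : ℝ => (θ * (B * r * S / 2 * (Complex.I - θ / 2)) : ℂ)) := by
      fun_prop
    have h3 := h2.mul_isLittleO ((isLittleO_one_iff ℝ).2 (by simpa using hc.tendsto 0))
    simpa using h3
  have hnum : (fun θ : ℝ => E (-1 / 2) θ + r * E (1 / 2) θ - r ^ 2 * E (3 / 2) θ +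
      r ^ 3 * E (5 / 2) θ + (B * r * (1 - S * θ ^ 2 / 2)) * E 1 θ -
      (θ : ℂ) ^ 2 * (θ * (B * r * S / 2 * (Complex.I - θ / 2)))) =o[𝓝 0] fun θ : ℝ => θ ^ 2 := by
    have h5 : (fun θ : ℝ => (B * r * (1 - S * θ ^ 2 / 2) : ℂ) * E 1 θ) =o[𝓝 0]
        fun θ : ℝ => θ ^ 2 := by
      simpa using (hcont (u := fun θ : ℝ => (B * r * (1 - S * θ ^ 2 / 2) : ℂ))
        (by fun_prop)).mul_isLittleO (hEo 1)
    exact (((((hEo _).add ((hEo _).const_mul_left _)).sub ((hEo _).const_mul_left _)).add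
      ((hEo _).const_mul_left _)).add h5).sub hsmall
  have hinv : (fun θ : ℝ => (B * (1 - r * Complex.exp (θ * Complex.I)))⁻¹) =O[𝓝 0]
      fun _ => (1 : ℝ) :=
    hcont (Continuous.inv₀ (by fun_prop) fun θ => mul_ne_zero hBc (hne θ))
  have := hinv.mul_isLittleO hnum
  simp only [one_mul] at this
  refine this.congr_left fun θ => ?_
  have hq := hne θ
  rw [ringFun_eq_div hq, inv_mul_eq_div, div_eq_iff (mul_ne_zero hBc hq)]
  set w := Complex.exp (θ * Complex.I / 2) with hw
  have e1 : Complex.exp (θ * Complex.I) = w ^ 2 := by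
    rw [hw, ← Complex.exp_nat_mul]; congr 1; push_cast; ring
  have ew (k : ℕ) : Complex.exp (((k / 2 : ℝ) : ℂ) * θ * Complex.I) = w ^ k := by
    rw [hw, ← Complex.exp_nat_mul]; congr 1; push_cast; ring
  have em : Complex.exp (((-1 / 2 : ℝ) : ℂ) * θ * Complex.I) = w⁻¹ := by
    rw [hw, ← Complex.exp_neg]; congr 1; push_cast; ring
  have hw0 : w ≠ 0 := Complex.exp_ne_zero _
  have e12 := ew 1
  have e32 := ew 3
  have e52 := ew 5
  push_cast at e12 e32 e52
  rw [em]
  simp only [hE, em]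
  push_cast
  rw [e12, e32, e52, one_mul, e1]
  rw [e1] at hq
  have hmul : ((1 + r * w ^ 2 - (r * w ^ 2) ^ 2 + (r * w ^ 2) ^ 3) / (1 - r * w ^ 2) / B * w⁻¹ -
      (1 - S * θ ^ 2 / 2)) * (B * (1 - r * w ^ 2)) =
      w⁻¹ + r * w - r ^ 2 * w ^ 3 + r ^ 3 * w ^ 5 -
        (1 - S * θ ^ 2 / 2) * (B * (1 - r * w ^ 2)) := by
    field_simp
  rw [hmul]
  linear_combination -hPc - Complex.I * θ * hlc - θ ^ 2 / 2 * hSc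

end SaddlePoint

/-! ### The asymptotics of the coefficients -/

section Coefficients

open PowerSeries MeasureTheory

theorem tendsto_coeff_ringGenFun {r : ℝ} (h0 : 0 < r) (h1 : r < 1)
    (hr : 3 * r ^ 4 - 6 * r ^ 3 + 2 * r ^ 2 - 4 * r + 1 = 0) :
    Tendsto (fun v : ℕ => coeff v (Code.ringGenFun ^ (2 * v + 1)) * r ^ v * √((2 * v + 1 : ℕ) : ℝ) /
      ringFun r ^ (2 * v + 1)) atTop (𝓝 (√(2 * Real.pi / saddleVariance r) / (2 * Real.pi))) := by
  have hB := one_lt_ringFun h0 h1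
  have hB0 : 0 < ringFun r := by linarith
  have hpi := Real.pi_pos
  have hne : ∀ θ : ℝ, (1 - r * Complex.exp (θ * Complex.I) : ℂ) ≠ 0 := by
    intro θ h
    have h2 : ‖(r * Complex.exp (θ * Complex.I) : ℂ)‖ = 1 := by
      rw [← sub_eq_zero.1 h, norm_one]
    rw [norm_mul, Complex.norm_exp_ofReal_mul_I, mul_one, Complex.norm_real,
      Real.norm_of_nonneg h0.le] at h2
    linarith
  have hnexp : ∀ x : ℝ, ∀ θ : ℝ, ‖Complex.exp (x * θ * Complex.I)‖ = 1 := by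
    intro x θ
    rw [← Complex.ofReal_mul, Complex.norm_exp_ofReal_mul_I]
  set k := 4 * r / (Real.pi ^ 2 * (1 + 2 * r)) with hk
  have hk0 : 0 < k := by positivity
  have key := tendsto_sqrt_mul_integral_pow (g := fun θ : ℝ =>
      ringFun (r * Complex.exp (θ * Complex.I)) / (ringFun r : ℝ) *
        Complex.exp (((-1 / 2 : ℝ) : ℂ) * θ * Complex.I))
    (h := fun θ : ℝ => Complex.exp (((1 / 2 : ℝ) : ℂ) * θ * Complex.I))
    (c := k / ringFun r) (S := saddleVariance r) (div_pos hk0 hB0) ?_ (by fun_prop) (by simp)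
    (fun θ => (hnexp _ θ).le) ?_ (saddle_expansion h0 h1 hr)
  · have hodd : Tendsto (fun v : ℕ => 2 * v + 1) atTop atTop :=
      tendsto_atTop_mono (fun v => by rw [id]; omega) tendsto_id
    have key2 := Complex.continuous_re.continuousAt.tendsto.comp (key.comp hodd)
    rw [Complex.ofReal_re] at key2
    refine (key2.div_const (2 * Real.pi)).congr fun v => ?_
    have hint : ∫ θ in (-Real.pi)..Real.pi, (ringFun (r * Complex.exp (θ * Complex.I)) /
        (ringFun r : ℝ) * Complex.exp (((-1 / 2 : ℝ) : ℂ) * θ * Complex.I)) ^ (2 * v + 1) *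
        Complex.exp (((1 / 2 : ℝ) : ℂ) * θ * Complex.I) =
        (2 * Real.pi * r ^ v * ((coeff v (Code.ringGenFun ^ (2 * v + 1)) : ℝ) : ℂ)) /
          (ringFun r : ℝ) ^ (2 * v + 1) := by
      rw [← integral_ringFun_pow h0 h1, ← intervalIntegral.integral_div]
      refine intervalIntegral.integral_congr fun θ _ => ?_
      have : Complex.exp (-(v * θ * Complex.I)) =
          Complex.exp (((-1 / 2 : ℝ) : ℂ) * θ * Complex.I) ^ (2 * v + 1) *
            Complex.exp (((1 / 2 : ℝ) : ℂ) * θ * Complex.I) := by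
        rw [← Complex.exp_nat_mul, ← Complex.exp_add]
        congr 1
        push_cast
        ring
      simp only [this]
      ring
    simp only [Function.comp_apply]
    rw [hint, show (√((2 * v + 1 : ℕ) : ℝ) : ℂ) * ((2 * Real.pi * r ^ v *
        ((coeff v (Code.ringGenFun ^ (2 * v + 1)) : ℝ) : ℂ)) / (ringFun r : ℝ) ^ (2 * v + 1)) =
        ((√((2 * v + 1 : ℕ) : ℝ) * ((2 * Real.pi * r ^ v *
        coeff v (Code.ringGenFun ^ (2 * v + 1))) / ringFun r ^ (2 * v + 1)) : ℝ) : ℂ) by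
          push_cast; ring, Complex.ofReal_re]
    field_simp
  · refine Continuous.mul (Continuous.div_const ?_ _) (by fun_prop)
    refine Continuous.sub (Continuous.sub (Continuous.div (by fun_prop) (by fun_prop) hne)
      (by fun_prop)) (by fun_prop)
  · intro θ hθ
    rw [norm_mul, hnexp, mul_one, norm_div, Complex.norm_real, Real.norm_of_nonneg hB0.le]
    refine ((div_le_div_iff_of_pos_right hB0).2 (norm_ringFun_le h0 h1 hθ)).trans ?_
    rw [sub_div, div_self hB0.ne', ← hk]
    have := Real.add_one_le_exp (-(k / ringFun r) * θ ^ 2)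
    refine le_trans (le_of_eq ?_) this
    ring

end Coefficients

/-! ### The constants -/

theorem exists_saddlePoint : ∃ r : ℝ, 0.2608704656 ≤ r ∧ r ≤ 0.2608704657 ∧
    3 * r ^ 4 - 6 * r ^ 3 + 2 * r ^ 2 - 4 * r + 1 = 0 := by
  have hc : ContinuousOn (fun r : ℝ => 3 * r ^ 4 - 6 * r ^ 3 + 2 * r ^ 2 - 4 * r + 1)
      (Set.Icc 0.2608704656 0.2608704657) := by fun_prop
  obtain ⟨r, ⟨h1, h2⟩, h3⟩ := intermediate_value_Icc' (by norm_num) hc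
    (show (0 : ℝ) ∈ Set.Icc _ _ by constructor <;> norm_num)
  exact ⟨r, h1, h2, h3⟩

theorem ringFun_bounds {r : ℝ} (h1 : 0.2608704656 ≤ r) (h2 : r ≤ 0.2608704657) :
    1.637832249 ≤ ringFun r ∧ ringFun r ≤ 1.63783225 := by
  have ha : (0.2608704656 : ℝ) ^ 2 ≤ r ^ 2 := by gcongr
  have hb : r ^ 2 ≤ (0.2608704657 : ℝ) ^ 2 := by gcongr
  have hr : 0 < 1 - r := by linarith
  norm_num at ha hb h1 h2
  rw [ringFun]
  constructor
  · have : 2.7058856491 ≤ 2 / (1 - r) := by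
      rw [le_div_iff₀ hr]; linarith
    linarith
  · have : 2 / (1 - r) ≤ 2.7058856496 := by
      rw [div_le_iff₀ hr]; linarith
    linarith

theorem saddleVariance_bounds {r : ℝ} (h1 : 0.2608704656 ≤ r) (h2 : r ≤ 0.2608704657) :
    0 < saddleVariance r ∧ 3.0453 ^ 2 * saddleVariance r < 2 * ringFun r ^ 2 ∧
      2 * ringFun r ^ 2 < 3.04532 ^ 2 * saddleVariance r := by
  obtain ⟨hB1, hB2⟩ := ringFun_bounds h1 h2
  have ha : (0.2608704656 : ℝ) ^ 2 ≤ r ^ 2 := by gcongr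
  have hb : r ^ 2 ≤ (0.2608704657 : ℝ) ^ 2 := by gcongr
  have hc : (0.2608704656 : ℝ) ^ 3 ≤ r ^ 3 := by gcongr
  have hd : r ^ 3 ≤ (0.2608704657 : ℝ) ^ 3 := by gcongr
  have hrB1 : 0.2608704656 * 1.637832249 ≤ r * ringFun r := by gcongr
  have hrB2 : r * ringFun r ≤ 0.2608704657 * 1.63783225 := by gcongr
  have hS1 : (1.637832249 : ℝ) ^ 2 ≤ ringFun r ^ 2 := by gcongr
  have hS2 : ringFun r ^ 2 ≤ (1.63783225 : ℝ) ^ 2 := by gcongr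
  norm_num at ha hb hc hd hrB1 hrB2 hS1 hS2 h1 h2
  have hP : 0 < 1 + r - r ^ 2 + r ^ 3 := by linarith
  have hl : 0.5784 ≤ saddleVariance r := by
    rw [saddleVariance, le_div_iff₀ hP]; linarith
  refine ⟨by linarith, ?_, ?_⟩
  · have : saddleVariance r ≤ 0.578504 := by
      rw [saddleVariance, div_le_iff₀ hP]; linarith
    linarith
  · have : 0.578501 ≤ saddleVariance r := by
      rw [saddleVariance, le_div_iff₀ hP]; linarith
    linarith

/-! ### The asymptotics of the number of diagrams -/

/-- With `m = 2 v + 1`, the number of diagrams is `2 ^ v / m` times a coefficient whose size is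
`√(2 π / S) / (2 π) * m ^ (-1 / 2) * B ^ m / r ^ v`, where `B = ringFun r`. Replacing `m` by `2 v`
in the factor `m ^ (-3 / 2)` does not change the asymptotics. -/
theorem RootedLinkDiagram.count_two_mul_isEquivalent {r : ℝ} (h0 : 0 < r) (h1 : r < 1)
    (hr : 3 * r ^ 4 - 6 * r ^ 3 + 2 * r ^ 2 - 4 * r + 1 = 0) (hS : 0 < saddleVariance r) :
    (fun v : ℕ => (RootedLinkDiagram.count (2 * v) : ℝ)) ~[atTop] fun v : ℕ =>
      -(√2 * ringFun r / √(saddleVariance r)) / Real.Gamma (-1 / 2) *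
        ((2 * v : ℕ) : ℝ) ^ (-3 / 2 : ℝ) * (2 : ℝ) ^ (((2 * v : ℕ) : ℝ) / 2) *
        (√r / ringFun r) ^ (-((2 * v : ℕ) : ℝ)) := by
  have hB0 : 0 < ringFun r := by linarith [one_lt_ringFun h0 h1]
  have hpi := Real.pi_pos
  have hL : √(2 * Real.pi / saddleVariance r) / (2 * Real.pi) ≠ 0 := by positivity
  have hu := (isEquivalent_const_iff_tendsto hL).2 (tendsto_coeff_ringGenFun h0 h1 hr)
  set S := saddleVariance r
  set B := ringFun r
  have hm : (fun v : ℕ => ((2 * v + 1 : ℕ) : ℝ) ^ (-3 / 2 : ℝ)) ~[atTop]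
      fun v : ℕ => ((2 * v : ℕ) : ℝ) ^ (-3 / 2 : ℝ) := by
    have hbase : (fun v : ℕ => ((2 * v + 1 : ℕ) : ℝ)) ~[atTop] fun v : ℕ => ((2 * v : ℕ) : ℝ) := by
      refine IsLittleO.isEquivalent ?_
      have : Tendsto (fun v : ℕ => ((2 * v : ℕ) : ℝ)) atTop atTop :=
        tendsto_natCast_atTop_atTop.comp (tendsto_id.const_mul_atTop' two_pos)
      refine ((isLittleO_const_left (c := (1 : ℝ))).2 (Or.inr (tendsto_norm_atTop_atTop.comp this)))
        |>.congr_left fun v => ?_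
      simp
    exact IsEquivalent.rpow (fun v => Nat.cast_nonneg _) hbase
  have hX : (fun v : ℕ => 2 ^ v * B ^ (2 * v + 1) / r ^ v) ~[atTop]
      fun v : ℕ => 2 ^ v * B ^ (2 * v + 1) / r ^ v := IsEquivalent.refl
  refine ((hu.mul hm).mul hX).congr_left ?_ |>.congr_right ?_
  · filter_upwards [eventually_ne_atTop 0] with v hv
    have hcard := Code.card_size_eq v
    rw [RootedLinkDiagram.count_two_mul hv]
    simp only [Pi.mul_apply]
    rw [← hcard]
    have hm0 : (0 : ℝ) < ((2 * v + 1 : ℕ) : ℝ) := by positivity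
    have : ((2 * v + 1 : ℕ) : ℝ) ^ (-3 / 2 : ℝ) =
        (√((2 * v + 1 : ℕ) : ℝ))⁻¹ * (((2 * v + 1 : ℕ) : ℝ))⁻¹ := by
      rw [Real.sqrt_eq_rpow, ← Real.rpow_neg hm0.le, ← Real.rpow_neg_one (((2 * v + 1 : ℕ) : ℝ)),
        ← Real.rpow_add hm0]
      norm_num
    rw [this]
    have hs : √((2 * v + 1 : ℕ) : ℝ) ≠ 0 := (Real.sqrt_pos.2 hm0).ne'
    push_cast at *
    field_simp
  · filter_upwards with v
    simp only [Pi.mul_apply, Function.const_apply]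
    -- `Γ(-1/2) = -2 √π`, from `Γ(1/2) = √π`
    have hG : Real.Gamma (-1 / 2) = -2 * √Real.pi := by
      have h := Real.Gamma_add_one (s := -1 / 2) (by norm_num)
      rw [show (-1 / 2 + 1 : ℝ) = 1 / 2 by norm_num, Real.Gamma_one_half_eq] at h
      linarith
    have h2 : (2 : ℝ) ^ (((2 * v : ℕ) : ℝ) / 2) = 2 ^ v := by
      rw [← Real.rpow_natCast]
      congr 1
      push_cast
      ring
    have h3 : (√r / B) ^ (-((2 * v : ℕ) : ℝ)) = B ^ (2 * v) / r ^ v := by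
      rw [Real.rpow_neg (by positivity), Real.rpow_natCast, div_pow, pow_mul (√r),
        Real.sq_sqrt h0.le, inv_div]
    have h4 : √(2 * Real.pi / S) / (2 * Real.pi) = -(√2 / √S) / (-2 * √Real.pi) := by
      rw [Real.sqrt_div (by positivity), Real.sqrt_mul (by norm_num)]
      have hp : √Real.pi * √Real.pi = Real.pi := Real.mul_self_sqrt hpi.le
      have : √Real.pi ≠ 0 := (Real.sqrt_pos.2 hpi).ne'
      have : √S ≠ 0 := (Real.sqrt_pos.2 hS).ne'
      rw [div_eq_div_iff (by positivity) (by simpa using ‹√Real.pi ≠ 0›)]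
      field_simp
      rw [sq, hp]
    rw [hG, h2, h3, h4]
    ring

theorem isEquivalent_even_of_two_mul {u w : ℕ → ℝ}
    (h : (fun v : ℕ => u (2 * v)) ~[atTop] fun v : ℕ => w (2 * v)) :
    u ~[atTop ⊓ 𝓟 {n : ℕ | Even n}] w := by
  have hle : atTop ⊓ 𝓟 {n : ℕ | Even n} ≤ map (fun v : ℕ => 2 * v) atTop := by
    intro s hs
    rw [mem_map, mem_atTop_sets] at hs
    obtain ⟨N, hN⟩ := hs
    rw [mem_inf_principal]
    filter_upwards [eventually_ge_atTop (2 * N)] with n hn he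
    obtain ⟨k, rfl⟩ := he
    have := hN k (by omega)
    rwa [Set.mem_preimage, two_mul] at this
  exact IsLittleO.mono (isLittleO_map.2 h) hle

theorem theorem7 :
    ∃ ρ c : ℝ,
      |ρ - 0.31184| < 1 / 10 ^ 5 ∧ |2 / ρ - 6.41337| < 1 / 10 ^ 5 ∧
      |c - (-3.04531)| < 1 / 10 ^ 5 ∧
      (fun n : ℕ => (RootedLinkDiagram.count n : ℝ))
        ~[atTop ⊓ 𝓟 {n : ℕ | Even n}]
      (fun n : ℕ => c / Real.Gamma (-1 / 2) * (n : ℝ) ^ (-3 / 2 : ℝ) *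
        (2 : ℝ) ^ ((n : ℝ) / 2) * ρ ^ (-(n : ℝ))) := by
  obtain ⟨r, h1, h2, hr⟩ := exists_saddlePoint
  have h0 : 0 < r := by linarith
  have hlt : r < 1 := by linarith
  obtain ⟨hB1, hB2⟩ := ringFun_bounds h1 h2
  obtain ⟨hS, hc1, hc2⟩ := saddleVariance_bounds h1 h2
  have hB0 : 0 < ringFun r := by linarith
  have hs0 : 0 < √r := Real.sqrt_pos.2 h0
  have hsl : 0.510754799 ≤ √r := Real.le_sqrt_of_sq_le (by norm_num at h1 ⊢; linarith)
  have hsu : √r ≤ 0.5107548 := Real.sqrt_le_iff.2 ⟨by norm_num, by norm_num at h2 ⊢; linarith⟩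
  refine ⟨√r / ringFun r, -(√2 * ringFun r / √(saddleVariance r)), ?_, ?_, ?_,
    isEquivalent_even_of_two_mul (RootedLinkDiagram.count_two_mul_isEquivalent h0 hlt hr hS)⟩
  · rw [abs_sub_lt_iff, sub_lt_iff_lt_add, sub_lt_comm, div_lt_iff₀ hB0, lt_div_iff₀ hB0]
    constructor
    · linarith
    · linarith
  · rw [div_div_eq_mul_div, abs_sub_lt_iff, sub_lt_iff_lt_add, sub_lt_comm, div_lt_iff₀ hs0,
      lt_div_iff₀ hs0]
    constructor
    · linarith
    · linarith
  · have hsq : (√2 * ringFun r / √(saddleVariance r)) ^ 2 =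
        2 * ringFun r ^ 2 / saddleVariance r := by
      rw [div_pow, mul_pow, Real.sq_sqrt hS.le, Real.sq_sqrt (by norm_num)]
    have hl : 3.0453 < √2 * ringFun r / √(saddleVariance r) := by
      refine lt_of_pow_lt_pow_left₀ 2 (by positivity) ?_
      rwa [hsq, lt_div_iff₀ hS]
    have hu : √2 * ringFun r / √(saddleVariance r) < 3.04532 := by
      refine lt_of_pow_lt_pow_left₀ 2 (by norm_num) ?_
      rwa [hsq, div_lt_iff₀ hS]
    rw [abs_sub_lt_iff]
    constructor <;> linarith
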